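/- Let $k,d,n$ be integers with $k>d+1\ge 4$ and $n>n_1(k,d):=d+2(k-d)^2\,(k^{k-d}-1)^k\,k!$. Write $[a,b]=\{a,a+1,\dots,b\}$ (empty if $a>b$), $[n]=[1,n]$, and let $\binom{[n]}{k}$ be the set of all $k$-subsets of $[n]$. A family $\mathcal F\subseteq\binom{[n]}{k}$ is *$d$-wise intersecting* if $F_1\cap\dots\cap F_d\ne\emptyset$ for all (not necessarily distinct) $F_1,\dots,F_d\in\mathcal F$; it is *non-trivial* if no element of $[n]$ belongs to all members of $\mathcal F$; a $d$-wise intersecting $\mathcal F\subseteq\binom{[n]}{k}$ is *maximal* if $\mathcal F\cup\{A\}$ is not $d$-wise intersecting for every $A\in\binom{[n]}{k}\setminus\mathcal F$. Two families of subsets of $[n]$ are isomorphic, $\mathcal F\cong\mathcal F'$, if some permutation of $[n]$ maps $\mathcal F$ onto $\mathcal F'$. A maximal non-trivial $d$-wise intersecting family $\mathcal F\subseteq\binom{[n]}{k}$ is called a *fourth largest* one if exactly three different numbers larger than $|\mathcal F|$ occur as sizes of maximal non-trivial $d$-wise intersecting families in $\binom{[n]}{k}$. Put $$\begin{aligned}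 \mathcal H(k,d,l)=&\left\{F\in\tbinom{[n]}{k}:[d-1]\subseteq F,\ F\cap[d,d+l-1]\ne\emptyset\right\}\\ &\cup\left\{F\in\tbinom{[n]}{k}:|[d-1]\cap F|=d-2,\ [d,d+l-1]\subseteq F\right\},\\ \mathcal G(k,d)=&\left\{F\in\tbinom{[n]}{k}:[d-1]\subseteq F,\ F\cap[d,k-1]\ne\emptyset\right\}\cup\{[2,k]\cup\{i\}:i\in[k+2,n]\}\\ &\cup\left\{F\in\tbinom{[n]}{k}:[d-1]\cup[k,k+1]\subseteq F\right\}\cup\{[2,k-1]\cup\{k+1,i\}:i\in[k+2,n]\}\\ &\cup\left\{F\in\tbinom{[n]}{k}:|[d-1]\cap F|=d-2,\ [d,k+1]\subseteq F\right\},\\ \mathcal S_1(k,3)=&\left\{F\in\tbinom{[n]}{k}:[2]\subseteq F,\ F\cap[3,k-1]\ne\emptyset\right\}\cup\left\{F\in\tbinom{[n]}{k}:[2]\cup[k,k+2]\subseteq F\right\}\\ &\cup\{[2,k]\cup\{i\}:i\in[k+1,n]\}\cup\left\{[2,k+2]\setminus\{k\},\ [k+1]\setminus\{2\},\ [k+2]\setminus\{2,k+1\}\right\}.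 \end{aligned}$$ Then a family $\mathcal F$ is a fourth largest maximal non-trivial $d$-wise intersecting family in $\binom{[n]}{k}$ if and only if 1. $\mathcal F\cong\mathcal G(d+2,d)$, when $k=d+2$; 2. $\mathcal F\cong\mathcal H(d+3,d,3)$, when $k=d+3$; 3. $\mathcal F\cong\mathcal G(k,d)$, when $d+4\le k\le 2d+1$; 4. $\mathcal F\cong\mathcal S_1(k,3)$, when $k>2d+1$ and $d=3$; 5. $\mathcal F\cong\mathcal H(k,d,k-d)$, when $k>2d+1$ and $d\ge 4$. -/

import Mathlib

open Finset

/-- The family of all `k`-subsets of `[n] = {1, …, n}`. -/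
def kSubsets (n k : ℕ) : Finset (Finset ℕ) := (Icc 1 n).powersetCard k

/-- `F` is `d`-wise intersecting: any `d` (not necessarily distinct) members have a common
element. -/
def DWiseIntersecting (d : ℕ) (F : Finset (Finset ℕ)) : Prop :=
  ∀ A : Fin d → Finset ℕ, (∀ i, A i ∈ F) → ∃ x, ∀ i, x ∈ A i

/-- All members of the family `F` of subsets of `[n]` contain a common element of `[n]`. -/
def TrivialFamily (n : ℕ) (F : Finset (Finset ℕ)) : Prop :=
  ∃ x ∈ Icc 1 n, ∀ A ∈ F, x ∈ A

/-- `F` is a maximal non-trivial `d`-wise intersecting family of `k`-subsets of `[n]`. -/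
structure IsMaxNontrivial (n k d : ℕ) (F : Finset (Finset ℕ)) : Prop where
  uniform : F ⊆ kSubsets n k
  intersecting : DWiseIntersecting d F
  nontrivial : ¬ TrivialFamily n F
  maximal : ∀ A ∈ kSubsets n k, A ∉ F → ¬ DWiseIntersecting d (insert A F)

/-- `F` is an `r`-th largest maximal non-trivial `d`-wise intersecting family of `k`-subsets of
`[n]`: exactly `r - 1` different sizes larger than `|F|` occur among such families (the set of
these sizes is finite). -/
def IsNthLargest (r n k d : ℕ) (F : Finset (Finset ℕ)) : Prop :=
  IsMaxNontrivial n k d F ∧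
    {m : ℕ | F.card < m ∧ ∃ F', IsMaxNontrivial n k d F' ∧ F'.card = m}.ncard + 1 = r

/-- Two families of subsets of `[n]` are isomorphic: a permutation of `[n]` (extended by the
identity outside `[n]`) takes one to the other. -/
def FamilyIso (n : ℕ) (F F' : Finset (Finset ℕ)) : Prop :=
  ∃ π : Equiv.Perm ℕ, (∀ x, x ∉ Icc 1 n → π x = x) ∧ F.image (fun A => A.image π) = F'

/-- The family `𝓗(k,d,l)` on `[n]`. -/
def familyH (n k d l : ℕ) : Finset (Finset ℕ) :=
  {F ∈ kSubsets n k | Icc 1 (d - 1) ⊆ F ∧ F ∩ Icc d (d + l - 1) ≠ ∅} ∪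
  {F ∈ kSubsets n k | (Icc 1 (d - 1) ∩ F).card = d - 2 ∧ Icc d (d + l - 1) ⊆ F}

/-- The family `𝓖(k,d)` on `[n]`. -/
def familyG (n k d : ℕ) : Finset (Finset ℕ) :=
  {F ∈ kSubsets n k | Icc 1 (d - 1) ⊆ F ∧ F ∩ Icc d (k - 1) ≠ ∅} ∪
  (Icc (k + 2) n).image (fun i => Icc 2 k ∪ {i}) ∪
  {F ∈ kSubsets n k | Icc 1 (d - 1) ∪ Icc k (k + 1) ⊆ F} ∪
  (Icc (k + 2) n).image (fun i => Icc 2 (k - 1) ∪ {k + 1, i}) ∪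
  {F ∈ kSubsets n k | (Icc 1 (d - 1) ∩ F).card = d - 2 ∧ Icc d (k + 1) ⊆ F}

/-- The family `𝓢₁(k,3)` on `[n]`. -/
def familyS₁ (n k : ℕ) : Finset (Finset ℕ) :=
  {F ∈ kSubsets n k | Icc 1 2 ⊆ F ∧ F ∩ Icc 3 (k - 1) ≠ ∅} ∪
  {F ∈ kSubsets n k | Icc 1 2 ∪ Icc k (k + 2) ⊆ F} ∪
  (Icc (k + 1) n).image (fun i => Icc 2 k ∪ {i}) ∪
  {Icc 2 (k + 2) \ {k}, Icc 1 (k + 1) \ {2}, Icc 1 (k + 2) \ {2, k + 1}}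

/-- The bound `n₁(k,d) = d + 2(k-d)²(k^(k-d) - 1)^k k!`. -/
def nOne (k d : ℕ) : ℕ := d + 2 * (k - d) ^ 2 * (k ^ (k - d) - 1) ^ k * k.factorial

/-! Call a set generating if all its `k`-supersets in `[n]` belong to the family `F`. Let `F` be
maximal. Generating sets of size at most `k` have at least `d` elements, and any two distinct or
equal ones share at least `d - 1`, because non-triviality supplies a member missing any prescribed
point. A non-generating set can be branched on: by maximality it is disjoint from some intersection
of `d - 1` members, and this intersection has at most `k` points and meets every member. Branching
to depth `d + 1` gives `|F| ≤ g·C(n-d, k-d) + k^(d+1)·C(n-d-1, k-d-1)`, where `g` counts the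
generating `d`-sets (`IsMaxNontrivial.card_le`). For large `n` the families with `g < k - d` are
therefore too small to matter (`lt_starSize`).

If `g ≥ k - d ≥ 2`, the generating `d`-sets either form a sunflower `D ∪ {x}`, `x ∈ X`, with `|D| =
d - 1`, or three of them have no common `(d-1)`-subset; the second case forces the `𝓗`-family with
`|X| = 2`. In a sunflower every member contains `D`, or misses one point `i` of `D` and contains
`X`. If every member containing `D` meets `X`, then `F` is again an `𝓗`-family, with `k-d ≤ |X| ≤
k-d+2`. Otherwise look at the traces, the parts outside `D ∪ X` of the members missing `i`. One
trace for each `i ∈ D` always have a common point, yet no point lies in all traces; this forces `|X|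
= k - d` and all traces to be pairs. For `d ≥ 4` all indices but one then carry a single pair `{a,
b}`, which gives `𝓖` (`cross_intersecting_pairs_of_three_le`). For `d = 3` two cross-intersecting
graphs remain, and they give `𝓖`, `𝓢₁`, or a family smaller than `𝓢₁` (`cross_intersecting_pairs`).
The outcome is `IsMaxNontrivial.isStructured`.

What remains is to order the sizes `h(l)`, `g`, `s` of these models. Always `h(k-d+2) > h(k-d+1) >
g`, and `s < g` when `d = 3`. The family with `|X| = 2` has about `(d+1)·C(n-d, k-d)` members, so it
is among the three largest exactly while `k ≤ 2d + 1`. The comparison of `g` and `s` with `h(k-d)`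
depends on the degree in `n` of the first binomial coefficient beyond the common star. Since all
model families of one type with the same `|X|` are isomorphic, sizes determine the families. -/

variable {n k d : ℕ} {F : Finset (Finset ℕ)}

/-! ### Extensions of sets and common elements. -/

lemma mem_kSubsets {A : Finset ℕ} : A ∈ kSubsets n k ↔ A ⊆ Icc 1 n ∧ A.card = k :=
  mem_powersetCard

/-- A set `T` extends to a `k`-set whose new elements avoid `R`. -/
lemma exists_kSubset_extension {T : Finset ℕ} (R : Finset ℕ) (hT : T ⊆ Icc 1 n)
    (hTk : T.card ≤ k) (h : R.card + k ≤ n) :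
    ∃ A ∈ kSubsets n k, T ⊆ A ∧ ∀ x ∈ A, x ∈ R → x ∈ T := by
  have h1 : (Icc 1 n).card ≤ (T ∪ (Icc 1 n \ R)).card + (R \ T).card := by
    rw [← card_union_of_disjoint]
    · apply card_le_card
      intro x hx
      simp only [mem_union, mem_sdiff]
      tauto
    · rw [disjoint_left]
      intro x hx
      simp only [mem_union, mem_sdiff] at hx ⊢
      tauto
  have h2 : (R \ T).card ≤ R.card := card_le_card sdiff_subset
  rw [Nat.card_Icc] at h1
  obtain ⟨A, hTA, hA, hc⟩ := exists_subsuperset_card_eq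
    (subset_union_left (s₁ := T) (s₂ := Icc 1 n \ R)) hTk (by omega : k ≤ _)
  refine ⟨A, mem_kSubsets.2 ⟨hA.trans (union_subset hT sdiff_subset), hc⟩, hTA, ?_⟩
  intro x hx hxR
  have := hA hx
  simp only [mem_union, mem_sdiff] at this
  tauto

/-- At most `d` members of a `d`-wise intersecting family have a common element. -/
lemma DWiseIntersecting.exists_common (hF : DWiseIntersecting d F) {ι : Type*} (s : Finset ι)
    (t : ι → Finset ℕ) (ht : ∀ i ∈ s, t i ∈ F) (hs : s.card ≤ d) (hne : s.Nonempty) :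
    ∃ x, ∀ i ∈ s, x ∈ t i := by
  classical
  obtain ⟨i₀, hi₀⟩ := hne
  let e := s.equivFin
  let A : Fin d → Finset ℕ := fun j =>
    if h : j.1 < s.card then t (e.symm ⟨j.1, h⟩) else t i₀
  obtain ⟨x, hx⟩ := hF A (fun j => by
    simp only [A]
    split_ifs with h
    · exact ht _ (e.symm ⟨j.1, h⟩).2
    · exact ht _ hi₀)
  refine ⟨x, fun i hi => ?_⟩
  have h1 := hx ⟨(e ⟨i, hi⟩).1, lt_of_lt_of_le (e ⟨i, hi⟩).2 hs⟩
  simpa [A] using h1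

/-- A member of a `d`-wise intersecting family and at most `d - 1` further members have a
common element. -/
lemma DWiseIntersecting.exists_common_mem (hF : DWiseIntersecting d F) {ι : Type*} (s : Finset ι)
    (t : ι → Finset ℕ) (ht : ∀ i ∈ s, t i ∈ F) (hs : s.card + 1 ≤ d) {E : Finset ℕ} (hE : E ∈ F) :
    ∃ x ∈ E, ∀ i ∈ s, x ∈ t i := by
  classical
  obtain ⟨x, hx⟩ := hF.exists_common (insertNone s) (fun o => o.elim E t)
    (by
      intro o ho
      cases o with
      | none => exact hE
      | some i => exact ht i (by simpa using ho))
    (by simpa using hs) ⟨none, by simp⟩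
  exact ⟨x, hx none (by simp), fun i hi => hx (some i) (by simpa using hi)⟩

/-! ### Generating sets. -/

/-- All `k`-subsets of `[n]` containing `T` belong to `F`. -/
def Generates (n k : ℕ) (F : Finset (Finset ℕ)) (T : Finset ℕ) : Prop :=
  ∀ A ∈ kSubsets n k, T ⊆ A → A ∈ F

/-- A non-trivial `d`-wise intersecting family of `k`-subsets of `[n]`. -/
structure IsNontrivialIntersecting (n k d : ℕ) (F : Finset (Finset ℕ)) : Prop where
  uniform : F ⊆ kSubsets n k
  intersecting : DWiseIntersecting d F
  nontrivial : ¬ TrivialFamily n F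

lemma IsMaxNontrivial.toNontrivial (hF : IsMaxNontrivial n k d F) :
    IsNontrivialIntersecting n k d F :=
  ⟨hF.uniform, hF.intersecting, hF.nontrivial⟩

namespace IsNontrivialIntersecting

variable (hF : IsNontrivialIntersecting n k d F)
include hF

lemma exists_notMem {x : ℕ} (hx : x ∈ Icc 1 n) : ∃ A ∈ F, x ∉ A := by
  have := hF.nontrivial
  unfold TrivialFamily at this
  push Not at this
  exact this x hx

/-- Extend `T` to a member whose new elements avoid `E`. Whatever this member shares with `E` lies
in `T`, so `T` itself acts as one of the `d` sets. -/
lemma exists_common_mem_generator (hn : 2 * k ≤ n) {T : Finset ℕ} (hT : T ⊆ Icc 1 n)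
    (hTk : T.card ≤ k) (hg : Generates n k F T) {ι : Type*} (s : Finset ι)
    (t : ι → Finset ℕ) (ht : ∀ i ∈ s, t i ∈ F) (hs : s.card + 2 ≤ d) {E : Finset ℕ}
    (hE : E ∈ F) : ∃ x ∈ T, x ∈ E ∧ ∀ i ∈ s, x ∈ t i := by
  classical
  have hEk := (mem_kSubsets.1 (hF.uniform hE)).2
  obtain ⟨A, hA, hTA, hAE⟩ := exists_kSubset_extension (k := k) E hT hTk (by omega)
  obtain ⟨x, hx, hxt⟩ := hF.intersecting.exists_common_mem (insertNone s) (fun o => o.elim E t)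
    (by
      intro o ho
      cases o with
      | none => exact hE
      | some i => exact ht i (by simpa using ho))
    (by simp; omega) (hg A hA hTA)
  have hxE : x ∈ E := hxt none (by simp)
  exact ⟨x, hAE x hx hxE, hxE, fun i hi => hxt (some i) (by simpa using hi)⟩

/-- If `T ∩ E` had at most `d - 2` points, a member missing each of them could be chosen; together
with `E` and `T` these are at most `d` sets without a common point. -/
lemma card_inter_ge (hn : 2 * k ≤ n) {T : Finset ℕ} (hT : T ⊆ Icc 1 n)
    (hTk : T.card ≤ k) (hg : Generates n k F T) {E : Finset ℕ} (hE : E ∈ F) :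
    d ≤ (T ∩ E).card + 1 := by
  by_contra hlt
  have h1 : ∀ x ∈ T ∩ E, ∃ A ∈ F, x ∉ A := fun x hx =>
    hF.exists_notMem (hT (mem_inter.1 hx).1)
  choose! t ht htx using h1
  obtain ⟨x, hxT, hxE, hx⟩ := hF.exists_common_mem_generator hn hT hTk hg (T ∩ E) t ht
    (by omega) hE
  exact htx x (mem_inter.2 ⟨hxT, hxE⟩) (hx x (mem_inter.2 ⟨hxT, hxE⟩))

/-- Apply `card_inter_ge` to a member that extends `S` by points outside `T`. -/
lemma card_inter_ge_of_generates (hn : 2 * k ≤ n) {T S : Finset ℕ}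
    (hT : T ⊆ Icc 1 n) (hTk : T.card ≤ k) (hg : Generates n k F T)
    (hS : S ⊆ Icc 1 n) (hSk : S.card ≤ k) (hgS : Generates n k F S) :
    d ≤ (T ∩ S).card + 1 := by
  obtain ⟨A, hA, hSA, hAT⟩ := exists_kSubset_extension (k := k) T hS hSk (by omega)
  have h1 := hF.card_inter_ge hn hT hTk hg (hgS A hA hSA)
  have h2 : T ∩ A ⊆ T ∩ S := fun x hx => by
    rw [mem_inter] at hx ⊢
    exact ⟨hx.1, hAT x hx.2 hx.1⟩
  have := card_le_card h2
  omega

/-- A member missing some `x ∈ T` still meets `T` in `d - 1` points, all different from `x`. Such an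
`x` exists because `d ≥ 2` excludes `T = ∅`. -/
lemma card_generator_ge (hn : 2 * k ≤ n) (hd : 2 ≤ d) (hn1 : 1 ≤ n) {T : Finset ℕ}
    (hT : T ⊆ Icc 1 n) (hTk : T.card ≤ k) (hg : Generates n k F T) : d ≤ T.card := by
  by_contra hlt
  obtain ⟨x, hx⟩ : T.Nonempty := by
    obtain ⟨A, hA, -⟩ := hF.exists_notMem (x := 1) (by simp [hn1])
    have := hF.card_inter_ge hn hT hTk hg hA
    rw [nonempty_iff_ne_empty]
    rintro rfl
    simp at this
    omega
  obtain ⟨A, hA, hxA⟩ := hF.exists_notMem (hT hx)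
  have h1 := hF.card_inter_ge hn hT hTk hg hA
  have h2 : T ∩ A ⊆ T.erase x := fun y hy => by
    rw [mem_inter] at hy
    exact mem_erase.2 ⟨fun h => hxA (h ▸ hy.2), hy.1⟩
  have h3 := card_le_card h2
  have h4 := card_erase_lt_of_mem hx
  omega

end IsNontrivialIntersecting

/-! ### Branching and the upper bound on the size. -/

namespace IsMaxNontrivial

variable (hF : IsMaxNontrivial n k d F)
include hF

lemma nonempty (hn1 : 1 ≤ n) : F.Nonempty := by
  obtain ⟨A, hA, -⟩ := hF.toNontrivial.exists_notMem (x := 1) (by simp [hn1])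
  exact ⟨A, hA⟩

/-- A `k`-set meeting all intersections of `d - 1` members belongs to a maximal family. -/
lemma mem_of_forall_common (hn1 : 1 ≤ n) (hd : 1 ≤ d) {A : Finset ℕ} (hA : A ∈ kSubsets n k)
    (h : ∀ t : Fin (d - 1) → Finset ℕ, (∀ i, t i ∈ F) → ∃ x ∈ A, ∀ i, x ∈ t i) : A ∈ F := by
  by_contra hAF
  apply hF.maximal A hA hAF
  obtain ⟨d, rfl⟩ : ∃ e, d = e + 1 := ⟨d - 1, by omega⟩
  obtain ⟨G, hG⟩ := hF.nonempty hn1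
  intro t ht
  by_cases hall : ∀ i, t i ∈ F
  · exact hF.intersecting t hall
  push Not at hall
  obtain ⟨j, hj⟩ := hall
  have hjA : t j = A := (mem_insert.1 (ht j)).resolve_right hj
  -- Position `j` holds `A`. Among the other `d - 1` positions any further copy of `A` is replaced
  -- by an arbitrary member `G`, which only strengthens the demand on `x`.
  obtain ⟨x, hxA, hx⟩ := h (fun i => if t (j.succAbove i) ∈ F then t (j.succAbove i) else G)
    (fun i => by split_ifs with h <;> assumption)
  refine ⟨x, fun i => ?_⟩
  by_cases hi : t i ∈ F
  · rcases Fin.eq_self_or_eq_succAbove j i with rfl | ⟨i', rfl⟩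
    · exact absurd hi hj
    · simpa [hi] using hx i'
  · rw [(mem_insert.1 (ht i)).resolve_right hi]
    exact hxA

/-- Some `k`-superset of `S` is not in `F`, so by maximality it misses the intersection of certain
`d - 1` members. That intersection is `I`: it meets every further member because `F` is `d`-wise
intersecting. -/
lemma exists_branch (hn1 : 1 ≤ n) (hd : 2 ≤ d) {S : Finset ℕ} (hS : ¬ Generates n k F S) :
    ∃ I : Finset ℕ, I ⊆ Icc 1 n ∧ I.card ≤ k ∧ Disjoint I S ∧ ∀ A ∈ F, (A ∩ I).Nonempty := by
  unfold Generates at hS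
  push Not at hS
  obtain ⟨A, hA, hSA, hAF⟩ := hS
  have := mt (hF.mem_of_forall_common hn1 (by omega) hA) hAF
  push Not at this
  obtain ⟨t, ht, htA⟩ := this
  let i₀ : Fin (d - 1) := ⟨0, by omega⟩
  have h0 := mem_kSubsets.1 (hF.uniform (ht i₀))
  refine ⟨{x ∈ t i₀ | ∀ i, x ∈ t i}, (filter_subset _ _).trans h0.1,
    (card_le_card (filter_subset _ _)).trans h0.2.le, ?_, ?_⟩
  · rw [disjoint_left]
    intro x hx hxS
    obtain ⟨i, hi⟩ := htA x (hSA hxS)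
    exact hi ((mem_filter.1 hx).2 i)
  · intro B hB
    obtain ⟨x, hxB, hx⟩ := hF.intersecting.exists_common_mem univ t (fun i _ => ht i)
      (by simp; omega) hB
    exact ⟨x, mem_inter.2 ⟨hxB, mem_filter.2 ⟨hx i₀ (mem_univ _), fun i => hx i (mem_univ _)⟩⟩⟩

/-- A search tree of depth `j` in which each node has at most `k` children. Every member follows a
path down the tree until it reaches a leaf or a generating set; the latter has fewer than `j ≤ d +
1` elements. -/
lemma exists_branching (hn1 : 1 ≤ n) (hd : 2 ≤ d) (j : ℕ) (hj : j ≤ d + 1) :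
    ∃ C : Finset (Finset ℕ), C.card ≤ k ^ j ∧ (∀ S ∈ C, S ⊆ Icc 1 n ∧ S.card = j) ∧
      ∀ A ∈ F, (∃ B ⊆ A, B.card ≤ d ∧ Generates n k F B) ∨ ∃ S ∈ C, S ⊆ A := by
  classical
  induction j with
  | zero => exact ⟨{∅}, by simp, by simp, fun A _ => Or.inr ⟨∅, by simp, by simp⟩⟩
  | succ j ih =>
    obtain ⟨C, hC, hCS, hCF⟩ := ih (by omega)
    have h1 : ∀ S : Finset ℕ, ∃ I : Finset ℕ, I.card ≤ k ∧ (¬ Generates n k F S →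
        I ⊆ Icc 1 n ∧ Disjoint I S ∧ ∀ A ∈ F, (A ∩ I).Nonempty) := by
      intro S
      by_cases hS : Generates n k F S
      · exact ⟨∅, by simp, fun h => absurd hS h⟩
      · obtain ⟨I, hI, hIk, h⟩ := hF.exists_branch hn1 hd hS
        exact ⟨I, hIk, fun _ => ⟨hI, h⟩⟩
    choose I hIk hI using h1
    -- Generating sets leave the tree; each other `S` is replaced by the sets `S ∪ {x}` with `x ∈ I
    -- S`, which are one larger since `I S` is disjoint from `S`.
    refine ⟨{S ∈ C | ¬ Generates n k F S}.biUnion fun S => (I S).image fun x => insert x S,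
      ?_, ?_, ?_⟩
    · refine (card_biUnion_le_card_mul _ _ k fun S _ => card_image_le.trans (hIk S)).trans ?_
      rw [pow_succ]
      exact Nat.mul_le_mul_right _ ((card_le_card (filter_subset _ _)).trans hC)
    · intro T hT
      simp only [mem_biUnion, mem_filter, mem_image] at hT
      obtain ⟨S, ⟨hS, hg⟩, x, hx, rfl⟩ := hT
      obtain ⟨hI1, hI2, -⟩ := hI S hg
      refine ⟨insert_subset (hI1 hx) (hCS S hS).1, ?_⟩
      rw [card_insert_of_notMem (disjoint_left.1 hI2 hx), (hCS S hS).2]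
    · intro A hA
      rcases hCF A hA with h | ⟨S, hS, hSA⟩
      · exact Or.inl h
      by_cases hg : Generates n k F S
      · exact Or.inl ⟨S, hSA, by rw [(hCS S hS).2]; omega, hg⟩
      obtain ⟨-, -, hI3⟩ := hI S hg
      obtain ⟨x, hx⟩ := hI3 A hA
      rw [mem_inter] at hx
      refine Or.inr ⟨insert x S, ?_, insert_subset hx.1 hSA⟩
      simp only [mem_biUnion, mem_filter, mem_image]
      exact ⟨S, ⟨hS, hg⟩, x, hx.2, rfl⟩

end IsMaxNontrivial

/-- The number of `k`-subsets of `[n]` containing `S` and avoiding `R`. -/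
lemma card_filter_subset_disjoint {S R : Finset ℕ} (hS : S ⊆ Icc 1 n) (hR : R ⊆ Icc 1 n)
    (hSR : Disjoint S R) (hSk : S.card ≤ k) :
    {A ∈ kSubsets n k | S ⊆ A ∧ Disjoint A R}.card = (n - S.card - R.card).choose (k - S.card) := by
  have hc : ((Icc 1 n \ S) \ R).card = n - S.card - R.card := by
    rw [card_sdiff_of_subset, card_sdiff_of_subset hS, Nat.card_Icc]
    · simp
    · exact subset_sdiff.2 ⟨hR, hSR.symm⟩
  rw [← hc, ← card_powersetCard]
  refine card_bij' (fun A _ => A \ S) (fun B _ => B ∪ S) ?_ ?_ ?_ ?_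
  · intro A hA
    simp only [mem_filter, mem_kSubsets] at hA
    obtain ⟨⟨h1, h2⟩, h3, h4⟩ := hA
    rw [mem_powersetCard]
    refine ⟨subset_sdiff.2 ⟨sdiff_subset_sdiff h1 subset_rfl, h4.mono_left sdiff_subset⟩, ?_⟩
    rw [card_sdiff_of_subset h3, h2]
  · intro B hB
    rw [mem_powersetCard] at hB
    obtain ⟨h1, h2⟩ := hB
    rw [subset_sdiff, subset_sdiff] at h1
    simp only [mem_filter, mem_kSubsets]
    refine ⟨⟨union_subset h1.1.1 hS, ?_⟩, subset_union_right, disjoint_union_left.2 ⟨h1.2, hSR⟩⟩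
    rw [card_union_of_disjoint h1.1.2, h2]
    omega
  · intro A hA
    simp only [mem_filter] at hA
    exact sdiff_union_of_subset hA.2.1
  · intro B hB
    rw [mem_powersetCard, subset_sdiff, subset_sdiff] at hB
    rw [union_sdiff_right, sdiff_eq_self_of_disjoint hB.1.1.2]

lemma card_filter_subset {S : Finset ℕ} (hS : S ⊆ Icc 1 n) (hSk : S.card ≤ k) :
    {A ∈ kSubsets n k | S ⊆ A}.card = (n - S.card).choose (k - S.card) := by
  simpa using card_filter_subset_disjoint (R := ∅) hS (by simp) (by simp) hSk

open Classical in
/-- The `d`-sets generating members of `F`. -/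
noncomputable def generators (n k d : ℕ) (F : Finset (Finset ℕ)) : Finset (Finset ℕ) :=
  {B ∈ (Icc 1 n).powersetCard d | Generates n k F B}

lemma mem_generators {B : Finset ℕ} :
    B ∈ generators n k d F ↔ B ⊆ Icc 1 n ∧ B.card = d ∧ Generates n k F B := by
  simp [generators, mem_powersetCard, and_assoc]

/-- Run the tree to depth `d + 1`. Generating sets met on the way have at most, hence exactly, `d`
elements; each of the at most `k ^ (d + 1)` leaves accounts for at most `C(n-d-1, k-d-1)` members.
-/
lemma IsMaxNontrivial.card_le (hF : IsMaxNontrivial n k d F) (hn : 2 * k ≤ n) (hd : 2 ≤ d)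
    (hk : d + 1 ≤ k) :
    F.card ≤ (generators n k d F).card * (n - d).choose (k - d) +
      k ^ (d + 1) * (n - d - 1).choose (k - d - 1) := by
  classical
  obtain ⟨C, hC, hCS, hCF⟩ := hF.exists_branching (by omega) hd (d + 1) le_rfl
  have hsub : F ⊆ ((generators n k d F).biUnion fun B => {A ∈ kSubsets n k | B ⊆ A}) ∪
      C.biUnion fun S => {A ∈ kSubsets n k | S ⊆ A} := by
    intro A hA
    have hAk := hF.uniform hA
    simp only [mem_union, mem_biUnion, mem_filter]
    rcases hCF A hA with ⟨B, hBA, hB, hg⟩ | ⟨S, hS, hSA⟩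
    · have hBn := hBA.trans (mem_kSubsets.1 hAk).1
      have := hF.toNontrivial.card_generator_ge hn hd (by omega) hBn (by omega) hg
      exact Or.inl ⟨B, mem_generators.2 ⟨hBn, by omega, hg⟩, hAk, hBA⟩
    · exact Or.inr ⟨S, hS, hAk, hSA⟩
  refine (card_le_card hsub).trans ((card_union_le _ _).trans (add_le_add ?_ ?_))
  · refine card_biUnion_le_card_mul _ _ _ fun B hB => ?_
    rw [mem_generators] at hB
    rw [card_filter_subset hB.1 (by omega), hB.2.1]
  · refine (card_biUnion_le_card_mul _ _ _ fun S hS => ?_).trans (Nat.mul_le_mul_right _ hC)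
    obtain ⟨h1, h2⟩ := hCS S hS
    rw [card_filter_subset h1 (by omega), h2, Nat.sub_sub, Nat.sub_sub]

/-! ### Configurations `(D, X)` and maximality of the three model families. -/

variable {D X : Finset ℕ}

lemma sdiff_eq_singleton_iff {A : Finset ℕ} {i : ℕ} :
    D \ A = {i} ↔ i ∈ D ∧ i ∉ A ∧ D.erase i ⊆ A := by
  simp only [Finset.ext_iff, mem_sdiff, mem_singleton, subset_iff, mem_erase]
  constructor
  · intro h
    refine ⟨((h i).2 rfl).1, ((h i).2 rfl).2, fun x hx => ?_⟩
    by_contra hxA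
    exact hx.1 ((h x).1 ⟨hx.2, hxA⟩)
  · rintro ⟨h1, h2, h3⟩ x
    constructor
    · rintro ⟨hx, hxA⟩
      by_contra hne
      exact hxA (h3 ⟨hne, hx⟩)
    · rintro rfl
      exact ⟨h1, h2⟩

lemma not_subset_of_sdiff_eq {A : Finset ℕ} {i : ℕ} (h : D \ A = {i}) : ¬ D ⊆ A := fun hs =>
  (sdiff_eq_singleton_iff.1 h).2.1 (hs (sdiff_eq_singleton_iff.1 h).1)

/-- A criterion for being `d`-wise intersecting. -/
lemma dWiseIntersecting_of_structure (hD : D.card + 1 = d) (hX : X.Nonempty)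
    (h1 : ∀ A ∈ F, D ⊆ A ∨ ∃ i, D \ A = {i} ∧ X ⊆ A)
    (h2 : ∀ t : ℕ → Finset ℕ, (∀ i ∈ D, t i ∈ F ∧ D \ t i = {i} ∧ X ⊆ t i) →
      ∀ E ∈ F, D ⊆ E → Disjoint E X → ∃ y ∈ E, ∀ i ∈ D, y ∈ t i) :
    DWiseIntersecting d F := by
  classical
  intro A hA
  by_contra hno
  push Not at hno
  -- `j x` is the position of a set missing `x`. A set misses at most one point of `D`, so `j` is
  -- injective on `D` and uses up `d - 1` of the `d` positions.
  choose j hj using hno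
  have hmiss : ∀ i ∈ D, D \ A (j i) = {i} ∧ X ⊆ A (j i) := by
    intro i hi
    rcases h1 _ (hA (j i)) with h | ⟨i', h, hXA⟩
    · exact absurd (h hi) (hj i)
    · have : i ∈ D \ A (j i) := mem_sdiff.2 ⟨hi, hj i⟩
      rw [h, mem_singleton] at this
      subst this
      exact ⟨h, hXA⟩
  have hinj : Set.InjOn j D := by
    intro a ha b hb hab
    have h3 := (hmiss a ha).1
    rw [hab, (hmiss b hb).1, singleton_inj] at h3
    exact h3.symm
  have hcard : (D.image j).card = D.card := card_image_of_injOn hinj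
  -- The single position left over. A point of `A j₀` common to all `A (j i)`, `i ∈ D`, would be
  -- common to all `d` sets; a point of `X` serves unless `A j₀` contains `D` and avoids `X`.
  obtain ⟨j₀, hj₀⟩ : ∃ j₀, j₀ ∉ D.image j := by
    by_contra h
    push Not at h
    have := card_le_card (fun x _ => h x : (univ : Finset (Fin d)) ⊆ D.image j)
    simp at this
    omega
  have huniv : insert j₀ (D.image j) = univ := by
    apply eq_univ_of_card
    rw [card_insert_of_notMem hj₀]
    simp
    omega
  have hall : ∀ y, y ∈ A j₀ → (∀ i ∈ D, y ∈ A (j i)) → False := by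
    intro y hy hyD
    have := mem_univ (j y)
    rw [← huniv, mem_insert, mem_image] at this
    rcases this with h | ⟨i, hi, h⟩
    · exact hj y (h ▸ hy)
    · exact hj y (h ▸ hyD i hi)
  rcases h1 _ (hA j₀) with h | ⟨i, -, h⟩
  · by_cases hdis : Disjoint (A j₀) X
    · obtain ⟨y, hy, hyt⟩ := h2 (fun i => A (j i))
        (fun i hi => ⟨hA _, hmiss i hi⟩) _ (hA j₀) h hdis
      exact hall y hy hyt
    · rw [not_disjoint_iff] at hdis
      obtain ⟨y, hy, hyX⟩ := hdis
      exact hall y hy fun i hi => (hmiss i hi).2 hyX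
  · obtain ⟨y, hy⟩ := hX
    exact hall y (h hy) fun i hi => (hmiss i hi).2 hy

/-- With one set missing each `i ∈ D`, every common point is pushed out of `D`; exactly one place
remains for `E` because `|D| = d - 1`. -/
lemma DWiseIntersecting.exists_common_notMem (hF : DWiseIntersecting d F) (hD : D.card + 1 = d)
    {t : ℕ → Finset ℕ} (ht : ∀ i ∈ D, t i ∈ F) (htD : ∀ i ∈ D, i ∉ t i) {E : Finset ℕ}
    (hE : E ∈ F) : ∃ y ∈ E, y ∉ D ∧ ∀ i ∈ D, y ∈ t i := by
  obtain ⟨y, hy, hyt⟩ := hF.exists_common_mem D t ht hD.le hE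
  exact ⟨y, hy, fun h => htD y h (hyt y h), hyt⟩

/-- The data defining the large families: disjoint sets `D` of size `d - 1` and `X`. -/
structure Config (n k d : ℕ) (D X : Finset ℕ) : Prop where
  three_le : 3 ≤ d
  lt : d + 2 ≤ k
  large : 4 * k ≤ n
  D_subset : D ⊆ Icc 1 n
  X_subset : X ⊆ Icc 1 n
  disj : Disjoint D X
  card_D : D.card + 1 = d
  two_le : 2 ≤ X.card
  -- The `d - 2 + |X|` points of `D.erase i ∪ X` must fit into a `k`-set.
  card_le : X.card + d ≤ k + 2

namespace Config

variable (hc : Config n k d D X)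
include hc

lemma X_nonempty : X.Nonempty := card_pos.1 (by have := hc.two_le; omega)

lemma D_nonempty : D.Nonempty := card_pos.1 (by have := hc.card_D; have := hc.three_le; omega)

lemma card_insert {x : ℕ} (hx : x ∈ X) : (insert x D).card = d := by
  rw [card_insert_of_notMem (disjoint_right.1 hc.disj hx), hc.card_D]

lemma insert_subset {x : ℕ} (hx : x ∈ X) : insert x D ⊆ Icc 1 n :=
  Finset.insert_subset (hc.X_subset hx) hc.D_subset

lemma card_erase_union {i : ℕ} (hi : i ∈ D) : (D.erase i ∪ X).card + 2 = X.card + d := by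
  rw [card_union_of_disjoint (hc.disj.mono_left (erase_subset _ _)), card_erase_of_mem hi]
  have := hc.card_D
  have := hc.three_le
  omega

lemma erase_union_subset (i : ℕ) : D.erase i ∪ X ⊆ Icc 1 n :=
  union_subset ((erase_subset _ _).trans hc.D_subset) hc.X_subset

/-- Members of an intersecting family generated by the sets `D ∪ {x}`, `x ∈ X`, contain `D` or
`X` and all but one elements of `D`. -/
lemma subset_or (hF : IsNontrivialIntersecting n k d F)
    (hg : ∀ x ∈ X, Generates n k F (insert x D)) {A : Finset ℕ} (hA : A ∈ F) :
    D ⊆ A ∨ ∃ i, D \ A = {i} ∧ X ⊆ A := by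
  have hl := hc.large
  have hdk := hc.lt
  have hDc := hc.card_D
  have hd := hc.three_le
  by_cases hDA : D ⊆ A
  · exact Or.inl hDA
  right
  have h1 : ∀ x ∈ X, d ≤ (insert x D ∩ A).card + 1 := fun x hx =>
    hF.card_inter_ge (by omega) (hc.insert_subset hx) (by rw [hc.card_insert hx]; omega)
      (hg x hx) hA
  have h2 : (D ∩ A).card < D.card := card_lt_card
    ⟨inter_subset_left, fun h => hDA (h.trans inter_subset_right)⟩
  -- If `x ∉ A`, then `insert x D` meets `A` only inside `D`, in fewer than `d - 1` points.
  have hX : X ⊆ A := by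
    intro x hx
    by_contra hxA
    have := h1 x hx
    rw [insert_inter_of_notMem hxA] at this
    omega
  obtain ⟨x, hx⟩ := hc.X_nonempty
  have h3 := h1 x hx
  rw [insert_inter_of_mem (hX hx), card_insert_of_notMem
    (fun h => disjoint_right.1 hc.disj hx (mem_inter.1 h).1)] at h3
  have h4 := card_sdiff_add_card_inter D A
  obtain ⟨i, hi⟩ := card_eq_one.1 (by omega : (D \ A).card = 1)
  exact ⟨i, hi, hX⟩

/-- For `y ∉ D` choose `x ∈ X` other than `y` and extend `D ∪ {x}` while avoiding `y`; this is where
`|X| ≥ 2` enters. -/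
lemma nontrivial (hg : ∀ x ∈ X, Generates n k F (insert x D))
    (hD : ∀ i ∈ D, ∃ A ∈ F, i ∉ A) : ¬ TrivialFamily n F := by
  rintro ⟨y, hy, h⟩
  by_cases hyD : y ∈ D
  · obtain ⟨A, hA, hyA⟩ := hD y hyD
    exact hyA (h A hA)
  have hl := hc.large
  have hdk := hc.lt
  obtain ⟨x, hx, hxy⟩ := exists_mem_ne (by have := hc.two_le; omega : 1 < X.card) y
  obtain ⟨A, hA, hDA, hAy⟩ := exists_kSubset_extension (k := k) {y} (hc.insert_subset hx)
    (by rw [hc.card_insert hx]; omega) (by simp; omega)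
  have := hAy y (h A (hg x hx A hA hDA)) (mem_singleton_self y)
  rw [mem_insert] at this
  exact this.elim (fun h => hxy h.symm) hyD

end Config

/-- The enlarged family is again non-trivial and intersecting, so `Config.subset_or` can be applied
to it and in particular to the new set `A`. -/
lemma isMaxNontrivial_of (hF : IsNontrivialIntersecting n k d F)
    (h : ∀ A ∈ kSubsets n k, IsNontrivialIntersecting n k d (insert A F) → A ∈ F) :
    IsMaxNontrivial n k d F := by
  refine ⟨hF.uniform, hF.intersecting, hF.nontrivial, fun A hA hAF hins => hAF (h A hA ?_)⟩
  refine ⟨insert_subset hA hF.uniform, hins, ?_⟩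
  rintro ⟨x, hx, hxA⟩
  exact hF.nontrivial ⟨x, hx, fun B hB => hxA B (mem_insert_of_mem hB)⟩

open Classical in
/-- The family `𝓗` with `D` and `X` in place of `[d - 1]` and `[d, d + l - 1]`. -/
noncomputable def HFam (n k : ℕ) (D X : Finset ℕ) : Finset (Finset ℕ) :=
  {A ∈ kSubsets n k | (D ⊆ A ∧ (A ∩ X).Nonempty) ∨ ∃ i, D \ A = {i} ∧ X ⊆ A}

lemma mem_HFam {A : Finset ℕ} : A ∈ HFam n k D X ↔ A ∈ kSubsets n k ∧
    ((D ⊆ A ∧ (A ∩ X).Nonempty) ∨ ∃ i, D \ A = {i} ∧ X ⊆ A) := by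
  classical exact mem_filter

open Classical in
/-- The family `𝓖` with `D`, `X`, `i₀`, `{a, b}` in place of `[d - 1]`, `[d, k - 1]`, `1`,
`{k, k + 1}`. -/
noncomputable def GFam (n k : ℕ) (D X : Finset ℕ) (i₀ a b : ℕ) : Finset (Finset ℕ) :=
  {A ∈ kSubsets n k | (D ⊆ A ∧ ((A ∩ X).Nonempty ∨ (a ∈ A ∧ b ∈ A))) ∨
    (D \ A = {i₀} ∧ X ⊆ A ∧ (a ∈ A ∨ b ∈ A)) ∨ ∃ i, D \ A = {i} ∧ X ⊆ A ∧ a ∈ A ∧ b ∈ A}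

lemma mem_GFam {A : Finset ℕ} {i₀ a b : ℕ} : A ∈ GFam n k D X i₀ a b ↔ A ∈ kSubsets n k ∧
    ((D ⊆ A ∧ ((A ∩ X).Nonempty ∨ (a ∈ A ∧ b ∈ A))) ∨
    (D \ A = {i₀} ∧ X ⊆ A ∧ (a ∈ A ∨ b ∈ A)) ∨ ∃ i, D \ A = {i} ∧ X ⊆ A ∧ a ∈ A ∧ b ∈ A) := by
  classical exact mem_filter

open Classical in
/-- The family `𝓢₁` with `D`, `X`, `i₁`, `i₂`, `a`, `b`, `c` in place of `[2]`, `[3, k - 1]`,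
`1`, `2`, `k`, `k + 1`, `k + 2`. -/
noncomputable def SFam (n k : ℕ) (D X : Finset ℕ) (i₁ i₂ a b c : ℕ) : Finset (Finset ℕ) :=
  {A ∈ kSubsets n k | (D ⊆ A ∧ ((A ∩ X).Nonempty ∨ (a ∈ A ∧ b ∈ A ∧ c ∈ A))) ∨
    (D \ A = {i₁} ∧ X ⊆ A ∧ (a ∈ A ∨ (b ∈ A ∧ c ∈ A))) ∨
    (D \ A = {i₂} ∧ X ⊆ A ∧ a ∈ A ∧ (b ∈ A ∨ c ∈ A))}

lemma mem_SFam {A : Finset ℕ} {i₁ i₂ a b c : ℕ} :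
    A ∈ SFam n k D X i₁ i₂ a b c ↔ A ∈ kSubsets n k ∧
    ((D ⊆ A ∧ ((A ∩ X).Nonempty ∨ (a ∈ A ∧ b ∈ A ∧ c ∈ A))) ∨
    (D \ A = {i₁} ∧ X ⊆ A ∧ (a ∈ A ∨ (b ∈ A ∧ c ∈ A))) ∨
    (D \ A = {i₂} ∧ X ⊆ A ∧ a ∈ A ∧ (b ∈ A ∨ c ∈ A))) := by
  classical exact mem_filter

lemma inter_nonempty_of_insert_subset {x : ℕ} {A : Finset ℕ} (hx : x ∈ X) (h : insert x D ⊆ A) :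
    D ⊆ A ∧ (A ∩ X).Nonempty :=
  ⟨(subset_insert _ _).trans h, x, mem_inter.2 ⟨h (mem_insert_self _ _), hx⟩⟩

namespace Config

/-- Extensions of `D \ {i} ∪ X ∪ Y` whose new elements avoid `D` and `R`. -/
lemma exists_missing (hc : Config n k d D X) {i : ℕ} (hi : i ∈ D) {Y R : Finset ℕ}
    (hY : Y ⊆ Icc 1 n) (hYD : Disjoint Y D)
    (hYc : Y.card + X.card + d ≤ k + 2) (hR : R.card ≤ 2 * k) :
    ∃ A ∈ kSubsets n k, D \ A = {i} ∧ X ⊆ A ∧ Y ⊆ A ∧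
      ∀ x ∈ A, x ∈ R → x ∉ D → x ∈ X ∨ x ∈ Y := by
  have h1 := hc.card_erase_union hi
  have h2 := card_union_le (D.erase i ∪ X) Y
  have h3 := hc.card_D
  have h4 := hc.lt
  have h5 := hc.large
  have h6 := card_union_le R D
  obtain ⟨A, hA, hTA, hAR⟩ := exists_kSubset_extension (k := k) (T := D.erase i ∪ X ∪ Y) (R ∪ D)
    (union_subset (hc.erase_union_subset i) hY) (by omega) (by omega)
  have hDA : D.erase i ⊆ A := subset_union_left.trans (subset_union_left.trans hTA)
  refine ⟨A, hA, sdiff_eq_singleton_iff.2 ⟨hi, ?_, hDA⟩,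
    subset_union_right.trans (subset_union_left.trans hTA), subset_union_right.trans hTA, ?_⟩
  · intro hiA
    have := hAR i hiA (mem_union_right _ hi)
    simp only [mem_union, mem_erase, ne_eq, not_true_eq_false, false_and, false_or] at this
    exact this.elim (disjoint_left.1 hc.disj hi) (fun h => disjoint_left.1 hYD h hi)
  · intro x hx hxR hxD
    have := hAR x hx (mem_union_left _ hxR)
    simp only [mem_union, mem_erase, hxD, and_false, false_or] at this
    exact this

/-- Extensions of `D ∪ Y` whose new elements avoid `R`. -/
lemma exists_containing (hc : Config n k d D X) {Y R : Finset ℕ}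
    (hY : Y ⊆ Icc 1 n) (hYc : Y.card + d ≤ k + 1) (hR : R.card ≤ 3 * k) :
    ∃ A ∈ kSubsets n k, D ⊆ A ∧ Y ⊆ A ∧ ∀ x ∈ A, x ∈ R → x ∉ D → x ∈ Y := by
  have h2 := card_union_le D Y
  have h3 := hc.card_D
  have h5 := hc.large
  obtain ⟨A, hA, hTA, hAR⟩ := exists_kSubset_extension (k := k) (T := D ∪ Y) R
    (union_subset hc.D_subset hY) (by omega) (by omega)
  refine ⟨A, hA, subset_union_left.trans hTA, subset_union_right.trans hTA, ?_⟩
  intro x hx hxR hxD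
  have := hAR x hx hxR
  simp only [mem_union, hxD, false_or] at this
  exact this

lemma dWiseIntersecting_HFam (hc : Config n k d D X) : DWiseIntersecting d (HFam n k D X) := by
  refine dWiseIntersecting_of_structure hc.card_D hc.X_nonempty ?_ ?_
  · intro A hA
    rcases (mem_HFam.1 hA).2 with h | h
    · exact Or.inl h.1
    · exact Or.inr h
  · intro t _ E hE hDE hEX
    rcases (mem_HFam.1 hE).2 with ⟨-, h⟩ | ⟨i, h, -⟩
    · rw [disjoint_iff_inter_eq_empty.1 hEX] at h
      simp at h
    · exact absurd hDE (not_subset_of_sdiff_eq h)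

/-- A candidate outside the family would contain `D` and avoid `X`. Members missing each `i ∈ D`,
with all free elements chosen outside `A`, can meet `A` outside `D` only in `X`, which is
impossible. -/
lemma isMaxNontrivial_HFam (hc : Config n k d D X) : IsMaxNontrivial n k d (HFam n k D X) := by
  have hg : ∀ x ∈ X, Generates n k (HFam n k D X) (insert x D) := fun x hx A hA hDA =>
    mem_HFam.2 ⟨hA, Or.inl (inter_nonempty_of_insert_subset hx hDA)⟩
  have hl := hc.card_le
  refine isMaxNontrivial_of ⟨fun A hA => (mem_HFam.1 hA).1, hc.dWiseIntersecting_HFam,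
    hc.nontrivial hg ?_⟩ ?_
  · intro i hi
    obtain ⟨A, hA, hiA, hXA, -⟩ := hc.exists_missing (k := k) hi (empty_subset _)
      (disjoint_empty_left D) (by simpa using hl) (R := ∅) (by simp)
    exact ⟨A, mem_HFam.2 ⟨hA, Or.inr ⟨i, hiA, hXA⟩⟩, (sdiff_eq_singleton_iff.1 hiA).2.1⟩
  · intro A hA hI
    have hAk := (mem_kSubsets.1 hA).2
    rcases hc.subset_or hI (fun x hx B hB h => mem_insert_of_mem (hg x hx B hB h))
      (mem_insert_self A _) with hDA | h
    swap
    · exact mem_HFam.2 ⟨hA, Or.inr h⟩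
    by_contra hAH
    have hdis : A ∩ X = ∅ := by
      rw [mem_HFam] at hAH
      by_contra h
      exact hAH ⟨hA, Or.inl ⟨hDA, nonempty_iff_ne_empty.2 h⟩⟩
    have h1 : ∀ i ∈ D, ∃ T ∈ kSubsets n k, D \ T = {i} ∧ X ⊆ T ∧ ∅ ⊆ T ∧
        ∀ x ∈ T, x ∈ A → x ∉ D → x ∈ X ∨ x ∈ (∅ : Finset ℕ) := fun i hi =>
      hc.exists_missing hi (empty_subset _) (disjoint_empty_left D) (by simpa using hl) (by omega)
    choose! t ht hiD hX hY hR using h1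
    obtain ⟨y, hyA, hyD, hy⟩ := hI.intersecting.exists_common_notMem hc.card_D (t := t)
      (fun i hi => mem_insert_of_mem (mem_HFam.2 ⟨ht i hi, Or.inr ⟨i, hiD i hi, hX i hi⟩⟩))
      (fun i hi => (sdiff_eq_singleton_iff.1 (hiD i hi)).2.1) (mem_insert_self A _)
    obtain ⟨i, hi⟩ := hc.D_nonempty
    have h2 := hR i hi y (hy i hi) hyA hyD
    simp only [notMem_empty, or_false] at h2
    have : y ∈ A ∩ X := mem_inter.2 ⟨hyA, h2⟩
    simp [hdis] at this

/-- Only a set `E` that contains `D` and avoids `X` needs care, and it contains both `a` and `b`.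
The set missing `i₀` contains one of them, and the sets missing other points of `D` contain both. -/
lemma dWiseIntersecting_GFam (hc : Config n k d D X) (i₀ a b : ℕ) :
    DWiseIntersecting d (GFam n k D X i₀ a b) := by
  refine dWiseIntersecting_of_structure hc.card_D hc.X_nonempty ?_ ?_
  · intro A hA
    rcases (mem_GFam.1 hA).2 with h | h | ⟨i, h⟩
    · exact Or.inl h.1
    · exact Or.inr ⟨i₀, h.1, h.2.1⟩
    · exact Or.inr ⟨i, h.1, h.2.1⟩
  · intro t ht E hE hDE hEX
    have hab : a ∈ E ∧ b ∈ E := by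
      rcases (mem_GFam.1 hE).2 with ⟨-, h | h⟩ | ⟨h, -⟩ | ⟨i, h, -⟩
      · rw [disjoint_iff_inter_eq_empty.1 hEX] at h
        simp at h
      · exact h
      · exact absurd hDE (not_subset_of_sdiff_eq h)
      · exact absurd hDE (not_subset_of_sdiff_eq h)
    have h1 : ∀ i ∈ D, (a ∈ t i ∧ b ∈ t i) ∨ (i = i₀ ∧ (a ∈ t i ∨ b ∈ t i)) := by
      intro i hi
      obtain ⟨h2, h3, -⟩ := ht i hi
      rcases (mem_GFam.1 h2).2 with h | h | ⟨j, h⟩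
      · exact absurd h.1 (not_subset_of_sdiff_eq h3)
      · rw [h3, singleton_inj] at h
        exact Or.inr ⟨h.1, h.2.2⟩
      · exact Or.inl h.2.2
    by_cases h2 : ∀ i ∈ D, a ∈ t i
    · exact ⟨a, hab.1, h2⟩
    · push Not at h2
      obtain ⟨i, hi, hai⟩ := h2
      refine ⟨b, hab.2, fun j hj => ?_⟩
      have h3 := h1 i hi
      rcases h1 j hj with h | h
      · exact h.2
      · have : i = j := by
          rcases h3 with h3 | h3
          · exact absurd h3.1 hai
          · rw [h3.1, h.1]
        subst this
        tauto

/-- Each condition on a candidate `A` is forced by testing it against members with almost no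
freedom: outside `D ∪ X` they offer only `a`, only `b`, or only these two as possible common points.
-/
lemma isMaxNontrivial_GFam (hc : Config n k d D X) (hX : X.card + d = k) {i₀ a b : ℕ}
    (hi₀ : i₀ ∈ D) (ha : a ∈ Icc 1 n) (hb : b ∈ Icc 1 n) (haD : a ∉ D) (hbD : b ∉ D) (haX : a ∉ X)
    (hbX : b ∉ X) (hab : a ≠ b) : IsMaxNontrivial n k d (GFam n k D X i₀ a b) := by
  have hlt := hc.lt
  have hDc := hc.card_D
  have hg : ∀ x ∈ X, Generates n k (GFam n k D X i₀ a b) (insert x D) := fun x hx A hA hDA =>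
    have h := inter_nonempty_of_insert_subset hx hDA
    mem_GFam.2 ⟨hA, Or.inl ⟨h.1, Or.inl h.2⟩⟩
  have hY : ({a, b} : Finset ℕ) ⊆ Icc 1 n := Finset.insert_subset ha (singleton_subset_iff.2 hb)
  have hYD : Disjoint ({a, b} : Finset ℕ) D := by simp [disjoint_left, haD, hbD]
  have hYc : ({a, b} : Finset ℕ).card = 2 := card_pair hab
  -- `D.erase i ∪ X ∪ {a, b}` already has `k` elements, so it is the member itself.
  have hfull : ∀ i ∈ D, ∃ T ∈ GFam n k D X i₀ a b, D \ T = {i} ∧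
      ∀ x ∈ T, x ∉ D → x ∈ X ∨ x = a ∨ x = b := by
    intro i hi
    obtain ⟨A, hA, hiA, hXA, hYA, -⟩ := hc.exists_missing (k := k) hi hY hYD (by omega) (R := ∅)
      (by simp)
    refine ⟨A, mem_GFam.2 ⟨hA, Or.inr (Or.inr ⟨i, hiA, hXA, hYA (by simp), hYA (by simp)⟩)⟩,
      hiA, ?_⟩
    have hsub : D.erase i ∪ X ∪ {a, b} ⊆ A :=
      union_subset (union_subset (sdiff_eq_singleton_iff.1 hiA).2.2 hXA) hYA
    have hcard : (D.erase i ∪ X ∪ {a, b}).card = k := by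
      rw [card_union_of_disjoint, hYc, hc.card_erase_union hi, hX]
      rw [disjoint_comm, disjoint_union_right]
      exact ⟨hYD.mono_right (erase_subset _ _), by simp [disjoint_left, haX, hbX]⟩
    have hA2 := eq_of_subset_of_card_le hsub (by rw [hcard, (mem_kSubsets.1 hA).2])
    intro x hx hxD
    rw [← hA2] at hx
    simp only [mem_union, mem_erase, hxD, mem_insert, mem_singleton] at hx
    tauto
  choose! t htF htD htx using hfull
  -- The set `D.erase i₀ ∪ X ∪ {c}` has `k - 1` elements; its one free element is placed outside
  -- `R`.
  have hgen : ∀ c, c = a ∨ c = b → ∀ R : Finset ℕ, R.card ≤ 2 * k → ∃ T ∈ GFam n k D X i₀ a b,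
      D \ T = {i₀} ∧ ∀ x ∈ T, x ∈ R → x ∉ D → x ∈ X ∨ x = c := by
    intro c hcab R hR
    obtain ⟨A, hA, hiA, hXA, hYA, hAR⟩ := hc.exists_missing (k := k) hi₀ (Y := {c})
      (singleton_subset_iff.2 (by rcases hcab with rfl | rfl <;> assumption))
      (disjoint_singleton_left.2 (by rcases hcab with rfl | rfl <;> assumption))
      (by simp; omega) hR
    rw [singleton_subset_iff] at hYA
    refine ⟨A, mem_GFam.2 ⟨hA, Or.inr (Or.inl ⟨hiA, hXA, ?_⟩)⟩, hiA, ?_⟩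
    · rcases hcab with rfl | rfl <;> tauto
    · simpa using hAR
  refine isMaxNontrivial_of ⟨fun A hA => (mem_GFam.1 hA).1, hc.dWiseIntersecting_GFam _ _ _,
    hc.nontrivial hg fun i hi => ⟨t i, htF i hi, (sdiff_eq_singleton_iff.1 (htD i hi)).2.1⟩⟩ ?_
  intro A hA hI
  have hAk := (mem_kSubsets.1 hA).2
  have htI : ∀ i ∈ D, t i ∈ insert A (GFam n k D X i₀ a b) := fun i hi =>
    mem_insert_of_mem (htF i hi)
  rcases hc.subset_or hI (fun x hx B hB h => mem_insert_of_mem (hg x hx B hB h))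
    (mem_insert_self A _) with hDA | ⟨i, hiA, hXA⟩
  · rw [mem_GFam]
    refine ⟨hA, Or.inl ⟨hDA, or_iff_not_imp_left.2 fun hAX => ?_⟩⟩
    -- Using at `i₀` a member that can share with `A` outside `D ∪ X` only the point `c` forces `c ∈
    -- A`.
    have key : ∀ c, c = a ∨ c = b → c ∈ A := by
      intro c hcab
      obtain ⟨T, hT, hTD, hTA⟩ := hgen c hcab A (by omega)
      obtain ⟨y, hyA, hyD, hy⟩ := hI.intersecting.exists_common_notMem hc.card_D
        (t := Function.update t i₀ T) (fun i hi => by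
          by_cases h : i = i₀
          · subst h; simpa using Or.inr hT
          · simpa [h] using Or.inr (htF i hi))
        (fun i hi => by
          by_cases h : i = i₀
          · subst h; simpa using (sdiff_eq_singleton_iff.1 hTD).2.1
          · simpa [h] using (sdiff_eq_singleton_iff.1 (htD i hi)).2.1) (mem_insert_self A _)
      have h1 := hy i₀ hi₀
      rw [Function.update_self] at h1
      rcases hTA y h1 hyA hyD with h | rfl
      · exact absurd ⟨y, mem_inter.2 ⟨hyA, h⟩⟩ hAX
      · exact hyA
    exact ⟨key a (Or.inl rfl), key b (Or.inr rfl)⟩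
  · have hiD := (sdiff_eq_singleton_iff.1 hiA).1
    have hXk := card_union_le A X
    -- `E ⊇ D ∪ {a, b}` otherwise avoids `A ∪ X`, so a point it shares with `A` outside `D` must be
    -- `a` or `b`.
    obtain ⟨E, hE, hDE, hYE, hER⟩ := hc.exists_containing (k := k) hY (by omega)
      (R := A ∪ X) (by omega)
    have hEk := (mem_kSubsets.1 hE).2
    have hEG : E ∈ insert A (GFam n k D X i₀ a b) := mem_insert_of_mem
      (mem_GFam.2 ⟨hE, Or.inl ⟨hDE, Or.inr ⟨hYE (by simp), hYE (by simp)⟩⟩⟩)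
    have hsimpE : ∀ y ∈ E, y ∈ A ∨ y ∈ X → y ∉ D → y = a ∨ y = b := by
      intro y hy hyA hyD
      have := hER y hy (mem_union.2 hyA) hyD
      simpa using this
    rw [mem_GFam]
    by_cases hii : i = i₀
    · subst hii
      refine ⟨hA, Or.inr (Or.inl ⟨hiA, hXA, ?_⟩)⟩
      obtain ⟨y, hyE, hyD, hy⟩ := hI.intersecting.exists_common_notMem hc.card_D
        (t := Function.update t i A) (fun j hj => by
          by_cases h : j = i
          · subst h; simp
          · simpa [h] using Or.inr (htF j hj))
        (fun j hj => by
          by_cases h : j = i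
          · subst h; simpa using (sdiff_eq_singleton_iff.1 hiA).2.1
          · simpa [h] using (sdiff_eq_singleton_iff.1 (htD j hj)).2.1) hEG
      have h1 := hy i hiD
      rw [Function.update_self] at h1
      rcases hsimpE y hyE (Or.inl h1) hyD with rfl | rfl <;> tauto
    · refine ⟨hA, Or.inr (Or.inr ⟨i, hiA, hXA, ?_⟩)⟩
      -- Here `A` is the set missing `i ≠ i₀`, and at `i₀` a member is used that meets `E` outside
      -- `D ∪ X` at most in `c`; the common point with `E` can only be `c`.
      have key : ∀ c, c = a ∨ c = b → c ∈ A := by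
        intro c hcab
        obtain ⟨T, hT, hTD, hTA⟩ := hgen c hcab E (by omega)
        obtain ⟨y, hyE, hyD, hy⟩ := hI.intersecting.exists_common_notMem hc.card_D
          (t := Function.update (Function.update t i₀ T) i A) (fun j hj => by
            by_cases h : j = i
            · subst h; simp
            · by_cases h' : j = i₀
              · subst h'; simpa [h] using Or.inr hT
              · simpa [h, h'] using Or.inr (htF j hj))
          (fun j hj => by
            by_cases h : j = i
            · subst h; simpa using (sdiff_eq_singleton_iff.1 hiA).2.1
            · by_cases h' : j = i₀
              · subst h'; simpa [h] using (sdiff_eq_singleton_iff.1 hTD).2.1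
              · simpa [h, h'] using (sdiff_eq_singleton_iff.1 (htD j hj)).2.1) hEG
        have h1 := hy i hiD
        rw [Function.update_self] at h1
        have h2 := hy i₀ hi₀
        rw [Function.update_of_ne (Ne.symm hii), Function.update_self] at h2
        rcases hTA y h2 hyE hyD with h | rfl
        · rcases hsimpE y hyE (Or.inr h) hyD with rfl | rfl
          · exact absurd h haX
          · exact absurd h hbX
        · exact h1
      exact ⟨key a (Or.inl rfl), key b (Or.inr rfl)⟩

end Config

namespace Config

/-- A set containing `a` or `{b, c}` and a set containing `{a, b}` or `{a, c}` always share a point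
of `{a, b, c}`, and `E` contains all three. -/
lemma dWiseIntersecting_SFam (hc : Config n k d D X) {i₁ i₂ : ℕ} (hD : D = {i₁, i₂})
    (hi : i₁ ≠ i₂) (a b c : ℕ) : DWiseIntersecting d (SFam n k D X i₁ i₂ a b c) := by
  refine dWiseIntersecting_of_structure hc.card_D hc.X_nonempty ?_ ?_
  · intro A hA
    rcases (mem_SFam.1 hA).2 with h | h | h
    · exact Or.inl h.1
    · exact Or.inr ⟨i₁, h.1, h.2.1⟩
    · exact Or.inr ⟨i₂, h.1, h.2.1⟩
  · intro t ht E hE hDE hEX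
    have habc : a ∈ E ∧ b ∈ E ∧ c ∈ E := by
      rcases (mem_SFam.1 hE).2 with ⟨-, h | h⟩ | ⟨h, -⟩ | ⟨h, -⟩
      · rw [disjoint_iff_inter_eq_empty.1 hEX] at h
        simp at h
      · exact h
      · exact absurd hDE (not_subset_of_sdiff_eq h)
      · exact absurd hDE (not_subset_of_sdiff_eq h)
    have hi₁ : i₁ ∈ D := by simp [hD]
    have hi₂ : i₂ ∈ D := by simp [hD]
    have h1 : a ∈ t i₁ ∨ (b ∈ t i₁ ∧ c ∈ t i₁) := by
      obtain ⟨h2, h3, -⟩ := ht i₁ hi₁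
      rcases (mem_SFam.1 h2).2 with h | h | h
      · exact absurd h.1 (not_subset_of_sdiff_eq h3)
      · exact h.2.2
      · rw [h3, singleton_inj] at h
        exact absurd h.1 hi
    have h2 : a ∈ t i₂ ∧ (b ∈ t i₂ ∨ c ∈ t i₂) := by
      obtain ⟨h2, h3, -⟩ := ht i₂ hi₂
      rcases (mem_SFam.1 h2).2 with h | h | h
      · exact absurd h.1 (not_subset_of_sdiff_eq h3)
      · rw [h3, singleton_inj] at h
        exact absurd h.1.symm hi
      · exact h.2.2
    have h3 : ∀ y, y ∈ t i₁ → y ∈ t i₂ → ∀ i ∈ D, y ∈ t i := by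
      intro y hy1 hy2 i hi
      rw [hD, mem_insert, mem_singleton] at hi
      rcases hi with rfl | rfl <;> assumption
    rcases h1 with h | ⟨h, h'⟩
    · exact ⟨a, habc.1, h3 a h h2.1⟩
    · rcases h2.2 with h4 | h4
      · exact ⟨b, habc.2.1, h3 b h h4⟩
      · exact ⟨c, habc.2.2, h3 c h' h4⟩

/-- The two sets missing `i₂` with traces `{a, b}` and `{a, c}`, the set missing `i₁` with trace
`{b, c}`, and a set missing `i₁` with trace `a` plus one free element suffice to force every
condition on a candidate. -/
lemma isMaxNontrivial_SFam (hc : Config n k d D X) (hX : X.card + d = k)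
    {i₁ i₂ a b c : ℕ} (hD : D = {i₁, i₂}) (hi : i₁ ≠ i₂)
    (ha : a ∈ Icc 1 n) (hb : b ∈ Icc 1 n) (hc' : c ∈ Icc 1 n)
    (haD : a ∉ D) (hbD : b ∉ D) (hcD : c ∉ D) (haX : a ∉ X) (hbX : b ∉ X) (hcX : c ∉ X)
    (hab : a ≠ b) (hac : a ≠ c) (hbc : b ≠ c) :
    IsMaxNontrivial n k d (SFam n k D X i₁ i₂ a b c) := by
  have hlt := hc.lt
  have hDc := hc.card_D
  have hd3 : d = 3 := by
    rw [hD, card_pair hi] at hDc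
    omega
  have hi₁ : i₁ ∈ D := by simp [hD]
  have hi₂ : i₂ ∈ D := by simp [hD]
  have hg : ∀ x ∈ X, Generates n k (SFam n k D X i₁ i₂ a b c) (insert x D) := fun x hx A hA hDA =>
    have h := inter_nonempty_of_insert_subset hx hDA
    mem_SFam.2 ⟨hA, Or.inl ⟨h.1, Or.inl h.2⟩⟩
  have hpair : ∀ i ∈ D, ∀ u v, u ∈ Icc 1 n → v ∈ Icc 1 n → u ∉ D → v ∉ D → u ∉ X → v ∉ X →
      u ≠ v → ∃ T ∈ kSubsets n k, D \ T = {i} ∧ X ⊆ T ∧ u ∈ T ∧ v ∈ T ∧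
        ∀ x ∈ T, x ∉ D → x ∈ X ∨ x = u ∨ x = v := by
    intro i hi u v hu hv huD hvD huX hvX huv
    have hYc : ({u, v} : Finset ℕ).card = 2 := card_pair huv
    have hYD : Disjoint ({u, v} : Finset ℕ) D := by simp [disjoint_left, huD, hvD]
    obtain ⟨A, hA, hiA, hXA, hYA, -⟩ := hc.exists_missing (k := k) hi
      (Finset.insert_subset hu (singleton_subset_iff.2 hv)) hYD (by omega) (R := ∅) (by simp)
    refine ⟨A, hA, hiA, hXA, hYA (by simp), hYA (by simp), ?_⟩
    have hsub : D.erase i ∪ X ∪ {u, v} ⊆ A :=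
      union_subset (union_subset (sdiff_eq_singleton_iff.1 hiA).2.2 hXA) hYA
    have hcard : (D.erase i ∪ X ∪ {u, v}).card = k := by
      rw [card_union_of_disjoint, hYc, hc.card_erase_union hi, hX]
      rw [disjoint_comm, disjoint_union_right]
      exact ⟨hYD.mono_right (erase_subset _ _), by simp [disjoint_left, huX, hvX]⟩
    have hA2 := eq_of_subset_of_card_le hsub (by rw [hcard, (mem_kSubsets.1 hA).2])
    intro x hx hxD
    rw [← hA2] at hx
    simp only [mem_union, mem_erase, hxD, mem_insert, mem_singleton] at hx
    tauto
  obtain ⟨Tb, hTb, hTbD, hTbX, hTba, hTbb, hTb'⟩ :=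
    hpair i₂ hi₂ a b ha hb haD hbD haX hbX hab
  obtain ⟨Tc, hTc, hTcD, hTcX, hTca, hTcc, hTc'⟩ :=
    hpair i₂ hi₂ a c ha hc' haD hcD haX hcX hac
  obtain ⟨Ta, hTa, hTaD, hTaX, hTab, hTac, hTa'⟩ :=
    hpair i₁ hi₁ b c hb hc' hbD hcD hbX hcX hbc
  have hTbF : Tb ∈ SFam n k D X i₁ i₂ a b c :=
    mem_SFam.2 ⟨hTb, Or.inr (Or.inr ⟨hTbD, hTbX, hTba, Or.inl hTbb⟩)⟩
  have hTcF : Tc ∈ SFam n k D X i₁ i₂ a b c :=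
    mem_SFam.2 ⟨hTc, Or.inr (Or.inr ⟨hTcD, hTcX, hTca, Or.inr hTcc⟩)⟩
  have hTaF : Ta ∈ SFam n k D X i₁ i₂ a b c :=
    mem_SFam.2 ⟨hTa, Or.inr (Or.inl ⟨hTaD, hTaX, Or.inr ⟨hTab, hTac⟩⟩)⟩
  have hgen : ∀ R : Finset ℕ, R.card ≤ 2 * k → ∃ T ∈ SFam n k D X i₁ i₂ a b c,
      D \ T = {i₁} ∧ ∀ x ∈ T, x ∈ R → x ∉ D → x ∈ X ∨ x = a := by
    intro R hR
    obtain ⟨A, hA, hiA, hXA, hYA, hAR⟩ := hc.exists_missing (k := k) hi₁ (Y := {a})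
      (by simpa using ha) (by simpa using haD) (by simp; omega) hR
    rw [singleton_subset_iff] at hYA
    exact ⟨A, mem_SFam.2 ⟨hA, Or.inr (Or.inl ⟨hiA, hXA, Or.inl hYA⟩)⟩, hiA, by simpa using hAR⟩
  refine isMaxNontrivial_of ⟨fun A hA => (mem_SFam.1 hA).1, hc.dWiseIntersecting_SFam hD hi _ _ _,
    hc.nontrivial hg fun i hiD => ?_⟩ ?_
  · rw [hD, mem_insert, mem_singleton] at hiD
    rcases hiD with rfl | rfl
    · exact ⟨Ta, hTaF, (sdiff_eq_singleton_iff.1 hTaD).2.1⟩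
    · exact ⟨Tb, hTbF, (sdiff_eq_singleton_iff.1 hTbD).2.1⟩
  intro A hA hI
  have hAk := (mem_kSubsets.1 hA).2
  have common : ∀ T₁ T₂ E, T₁ ∈ insert A (SFam n k D X i₁ i₂ a b c) →
      T₂ ∈ insert A (SFam n k D X i₁ i₂ a b c) → E ∈ insert A (SFam n k D X i₁ i₂ a b c) →
      D \ T₁ = {i₁} → D \ T₂ = {i₂} → ∃ y ∈ E, y ∉ D ∧ y ∈ T₁ ∧ y ∈ T₂ := by
    intro T₁ T₂ E h1 h2 hE h3 h4
    obtain ⟨y, hyE, hyD, hy⟩ := hI.intersecting.exists_common_notMem hc.card_D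
      (t := fun i => if i = i₁ then T₁ else T₂) (fun i _ => by
        split_ifs <;> assumption)
      (fun i hiD => by
        by_cases h : i = i₁
        · subst h
          simpa using (sdiff_eq_singleton_iff.1 h3).2.1
        · rw [hD, mem_insert, mem_singleton] at hiD
          rcases hiD with rfl | rfl
          · exact absurd rfl h
          · simpa [h] using (sdiff_eq_singleton_iff.1 h4).2.1) hE
    exact ⟨y, hyE, hyD, by simpa using hy i₁ hi₁, by simpa [hi.symm] using hy i₂ hi₂⟩
  have old : ∀ T, T ∈ SFam n k D X i₁ i₂ a b c → T ∈ insert A (SFam n k D X i₁ i₂ a b c) :=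
    fun T hT => mem_insert_of_mem hT
  have hAI := mem_insert_self A (SFam n k D X i₁ i₂ a b c)
  rw [mem_SFam]
  refine ⟨hA, ?_⟩
  rcases hc.subset_or hI (fun x hx B hB h => mem_insert_of_mem (hg x hx B hB h))
    (mem_insert_self A _) with hDA | ⟨i, hiA, hXA⟩
  · refine Or.inl ⟨hDA, or_iff_not_imp_left.2 fun hAX => ?_⟩
    have hAX' : ∀ y ∈ A, y ∉ X := fun y hy hyX => hAX ⟨y, mem_inter.2 ⟨hy, hyX⟩⟩
    refine ⟨?_, ?_, ?_⟩
    · obtain ⟨T, hT, hTD, hTA⟩ := hgen A (by omega)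
      obtain ⟨y, hyE, hyD, hy, -⟩ := common T Tb A (old _ hT) (old _ hTbF) hAI hTD hTbD
      rcases hTA y hy hyE hyD with h | rfl
      · exact absurd h (hAX' y hyE)
      · exact hyE
    · obtain ⟨y, hyE, hyD, hy, hy2⟩ := common Ta Tb A (old _ hTaF) (old _ hTbF) hAI hTaD hTbD
      have h1 := hTa' y hy hyD
      have h2 := hTb' y hy2 hyD
      have h3 := hAX' y hyE
      rcases h1 with h | rfl | rfl
      · exact absurd h h3
      · exact hyE
      · rcases h2 with h | h | h
        · exact absurd h h3
        · exact absurd h.symm hac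
        · exact absurd h.symm hbc
    · obtain ⟨y, hyE, hyD, hy, hy2⟩ := common Ta Tc A (old _ hTaF) (old _ hTcF) hAI hTaD hTcD
      have h1 := hTa' y hy hyD
      have h2 := hTc' y hy2 hyD
      have h3 := hAX' y hyE
      rcases h1 with h | rfl | rfl
      · exact absurd h h3
      · rcases h2 with h | h | h
        · exact absurd h h3
        · exact absurd h.symm hab
        · exact absurd h hbc
      · exact hyE
  · have hiD := (sdiff_eq_singleton_iff.1 hiA).1
    have hXk := card_union_le A X
    have habc := card_le_three (a := a) (b := b) (c := c)
    -- `E ⊇ D ∪ {a, b, c}` avoids `X`, so the common points it enforces lie in the traces.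
    obtain ⟨E, hE, hDE, hYE, hER⟩ := hc.exists_containing (k := k) (Y := {a, b, c})
      (by simp only [Finset.insert_subset_iff, singleton_subset_iff]; exact ⟨ha, hb, hc'⟩)
      (by omega) (R := A ∪ X) (by omega)
    have hEk := (mem_kSubsets.1 hE).2
    have hEG : E ∈ insert A (SFam n k D X i₁ i₂ a b c) := mem_insert_of_mem
      (mem_SFam.2 ⟨hE, Or.inl ⟨hDE, Or.inr ⟨hYE (by simp), hYE (by simp), hYE (by simp)⟩⟩⟩)
    have hEX : ∀ y ∈ E, y ∉ D → y ∉ X := by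
      intro y hy hyD hyX
      have := hER y hy (mem_union_right _ hyX) hyD
      simp only [mem_insert, mem_singleton] at this
      rcases this with rfl | rfl | rfl <;> contradiction
    right
    rw [hD, mem_insert, mem_singleton] at hiD
    rcases hiD with rfl | rfl
    · left
      refine ⟨hiA, hXA, ?_⟩
      obtain ⟨y, hyE, hyD, hy, hy2⟩ := common A Tb E hAI (old _ hTbF) hEG hiA hTbD
      obtain ⟨z, hzE, hzD, hz, hz2⟩ := common A Tc E hAI (old _ hTcF) hEG hiA hTcD
      rcases hTb' y hy2 hyD with h | rfl | rfl
      · exact absurd h (hEX y hyE hyD)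
      · exact Or.inl hy
      · rcases hTc' z hz2 hzD with h | rfl | rfl
        · exact absurd h (hEX z hzE hzD)
        · exact Or.inl hz
        · exact Or.inr ⟨hy, hz⟩
    · right
      refine ⟨hiA, hXA, ?_, ?_⟩
      · obtain ⟨T, hT, hTD, hTA⟩ := hgen E (by omega)
        obtain ⟨y, hyE, hyD, hy, hy2⟩ := common T A E (old _ hT) hAI hEG hTD hiA
        rcases hTA y hy hyE hyD with h | rfl
        · exact absurd h (hEX y hyE hyD)
        · exact hy2
      · obtain ⟨y, hyE, hyD, hy, hy2⟩ := common Ta A E (old _ hTaF) hAI hEG hTaD hiA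
        rcases hTa' y hy hyD with h | rfl | rfl
        · exact absurd h (hEX y hyE hyD)
        · exact Or.inl hy2
        · exact Or.inr hy2

end Config

/-! ### Cross-intersecting families of pairs. -/

/-- `Q` consists of two pairs `{a, b}`, `{a, c}`, and `{b, c} ∈ P`. -/
def IsCherry (P Q : Finset (Finset ℕ)) : Prop :=
  ∃ a b c, a ≠ b ∧ a ≠ c ∧ b ≠ c ∧ Q = {{a, b}, {a, c}} ∧ {b, c} ∈ P

lemma eq_pair_of_card_two {A : Finset ℕ} (hA : A.card = 2) {x y : ℕ} (hx : x ∈ A) (hy : y ∈ A)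
    (hxy : x ≠ y) : A = {x, y} := by
  refine (eq_of_subset_of_card_le (insert_subset hx (singleton_subset_iff.2 hy)) ?_).symm
  rw [card_pair hxy, hA]

lemma eq_pair_of_disjoint {A B₁ B₂ : Finset ℕ} (hA : A.card = 2) (hB : Disjoint B₁ B₂)
    (h1 : (A ∩ B₁).Nonempty) (h2 : (A ∩ B₂).Nonempty) : ∃ x ∈ B₁, ∃ y ∈ B₂, A = {x, y} := by
  obtain ⟨x, hx⟩ := h1
  obtain ⟨y, hy⟩ := h2
  rw [mem_inter] at hx hy
  exact ⟨x, hx.2, y, hy.2, eq_pair_of_card_two hA hx.1 hy.1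
    fun h => disjoint_left.1 hB hx.2 (h ▸ hy.2)⟩

lemma card_le_four_of_disjoint {P : Finset (Finset ℕ)} {B₁ B₂ : Finset ℕ} (h1 : B₁.card = 2)
    (h2 : B₂.card = 2) (h : ∀ A ∈ P, ∃ x ∈ B₁, ∃ y ∈ B₂, A = {x, y}) : P.card ≤ 4 := by
  have hsub : P ⊆ (B₁ ×ˢ B₂).image fun p => {p.1, p.2} := by
    intro A hA
    obtain ⟨x, hx, y, hy, rfl⟩ := h A hA
    exact mem_image.2 ⟨(x, y), mem_product.2 ⟨hx, hy⟩, rfl⟩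
  refine (card_le_card hsub).trans (card_image_le.trans ?_)
  rw [card_product, h1, h2]

/-- A third transversal pair not through `x` would be disjoint from `{x, y₁}` or `{x, y₂}`. So `P`
consists of these two, and the pair of their other ends is `B₂ ∈ Q`. -/
lemma isCherry_of_star {P Q : Finset (Finset ℕ)} {B₁ B₂ : Finset ℕ} (hB₂ : B₂ ∈ Q)
    (h2 : B₂.card = 2) (hB : Disjoint B₁ B₂)
    (h : ∀ A ∈ P, ∃ x ∈ B₁, ∃ y ∈ B₂, A = {x, y})
    (hP : ∀ A ∈ P, ∀ A' ∈ P, ¬ Disjoint A A') {x y₁ y₂ : ℕ} (hx : x ∈ B₁) (hy₁ : y₁ ∈ B₂)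
    (hy₂ : y₂ ∈ B₂) (hy : y₁ ≠ y₂) (hA₁ : {x, y₁} ∈ P) (hA₂ : {x, y₂} ∈ P) : IsCherry Q P := by
  have hne : ∀ u ∈ B₁, ∀ v ∈ B₂, u ≠ v := fun u hu v hv h => disjoint_left.1 hB hu (h ▸ hv)
  have hB₂' := eq_pair_of_card_two h2 hy₁ hy₂ hy
  refine ⟨x, y₁, y₂, hne x hx y₁ hy₁, hne x hx y₂ hy₂, hy, ?_, hB₂' ▸ hB₂⟩
  ext A
  simp only [mem_insert, mem_singleton]
  constructor
  · intro hA
    obtain ⟨u, hu, v, hv, rfl⟩ := h A hA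
    have hux : u = x := by
      by_contra hux
      rw [hB₂', mem_insert, mem_singleton] at hv
      rcases hv with rfl | rfl
      · refine hP _ hA _ hA₂ ?_
        simp [Ne.symm hux, (hne u hu _ hy₂).symm, hy.symm, hne x hx _ hy₁]
      · refine hP _ hA _ hA₁ ?_
        simp [Ne.symm hux, (hne u hu _ hy₁).symm, hy, hne x hx _ hy₂]
    subst hux
    rw [hB₂', mem_insert, mem_singleton] at hv
    rcases hv with rfl | rfl <;> simp
  · rintro (rfl | rfl) <;> assumption

/-- Two disjoint pairs in `Q` make `P` a set of edges of a four-cycle. If `P` also has two disjoint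
edges, `Q` is equally restricted, and each end of an edge of `P` is its whole intersection with `B₁`
or `B₂`; two edges have at least three ends. Otherwise `P` is a star with two edges. -/
lemma isCherry_or_of_disjoint {P Q : Finset (Finset ℕ)} (hP2 : ∀ A ∈ P, A.card = 2)
    (hQ2 : ∀ B ∈ Q, B.card = 2) (hcross : ∀ A ∈ P, ∀ B ∈ Q, (A ∩ B).Nonempty)
    (hP : 2 ≤ P.card) {B₁ B₂ : Finset ℕ} (hB₁ : B₁ ∈ Q) (hB₂ : B₂ ∈ Q) (hB : Disjoint B₁ B₂) :
    IsCherry Q P ∨ (P.card ≤ 4 ∧ Q.card ≤ 4 ∧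
      ∃ U : Finset ℕ, U.card = 3 ∧ ∀ u ∈ U, ∃ A ∈ P, ∃ B ∈ Q, A ∩ B = {u}) := by
  have h : ∀ A ∈ P, ∃ x ∈ B₁, ∃ y ∈ B₂, A = {x, y} := fun A hA =>
    eq_pair_of_disjoint (hP2 A hA) hB (hcross A hA _ hB₁) (hcross A hA _ hB₂)
  obtain ⟨A₁, hA₁, A₂, hA₂, hne⟩ := one_lt_card.1 (by omega : 1 < P.card)
  by_cases hPd : ∃ A ∈ P, ∃ A' ∈ P, Disjoint A A'
  · right
    refine ⟨card_le_four_of_disjoint (hQ2 _ hB₁) (hQ2 _ hB₂) h, ?_, ?_⟩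
    · obtain ⟨A, hA, A', hA', hAA⟩ := hPd
      refine card_le_four_of_disjoint (hP2 _ hA) (hP2 _ hA') fun B hBQ =>
        eq_pair_of_disjoint (hQ2 B hBQ) hAA ?_ ?_
      · rw [inter_comm]; exact hcross _ hA _ hBQ
      · rw [inter_comm]; exact hcross _ hA' _ hBQ
    · have hU : 3 ≤ (A₁ ∪ A₂).card := by
        by_contra hlt
        have h1 := hP2 _ hA₁
        have h2 := hP2 _ hA₂
        have e1 := eq_of_subset_of_card_le (subset_union_left (s₁ := A₁) (s₂ := A₂)) (by omega)
        have e2 := eq_of_subset_of_card_le (subset_union_right (s₁ := A₁) (s₂ := A₂)) (by omega)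
        exact hne (e1.trans e2.symm)
      obtain ⟨U, hU, hUc⟩ := exists_subset_card_eq hU
      refine ⟨U, hUc, fun u hu => ?_⟩
      have key : ∀ A ∈ P, u ∈ A → ∃ A ∈ P, ∃ B ∈ Q, A ∩ B = {u} := by
        intro A hA huA
        obtain ⟨x, hx, y, hy, rfl⟩ := h A hA
        rw [mem_insert, mem_singleton] at huA
        rcases huA with rfl | rfl
        · refine ⟨_, hA, B₁, hB₁, ?_⟩
          rw [insert_inter_of_mem hx, singleton_inter_of_notMem (disjoint_right.1 hB hy)]
          simp
        · refine ⟨_, hA, B₂, hB₂, ?_⟩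
          rw [insert_inter_of_notMem (disjoint_left.1 hB hx), singleton_inter_of_mem hy]
      rcases mem_union.1 (hU hu) with h | h
      · exact key _ hA₁ h
      · exact key _ hA₂ h
  · left
    push Not at hPd
    obtain ⟨x₁, hx₁, y₁, hy₁, rfl⟩ := h A₁ hA₁
    obtain ⟨x₂, hx₂, y₂, hy₂, rfl⟩ := h A₂ hA₂
    by_cases hx : x₁ = x₂
    · subst hx
      exact isCherry_of_star hB₂ (hQ2 _ hB₂) hB h hPd hx₁ hy₁ hy₂ (fun h => hne (by rw [h]))
        hA₁ hA₂
    · have hy : y₁ = y₂ := by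
        by_contra hy
        refine hPd _ hA₁ _ hA₂ ?_
        have h1 : y₁ ≠ x₂ := fun h => disjoint_left.1 hB hx₂ (h ▸ hy₁)
        have h2 : x₁ ≠ y₂ := fun h => disjoint_left.1 hB hx₁ (h ▸ hy₂)
        simp [Ne.symm hx, Ne.symm hy, h1.symm, h2.symm]
      subst hy
      rw [pair_comm] at hA₁ hA₂
      refine isCherry_of_star hB₁ (hQ2 _ hB₁) hB.symm (fun A hA => ?_) hPd hy₁ hx₁ hx₂ hx hA₁ hA₂
      obtain ⟨x, hx, y, hy, rfl⟩ := h A hA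
      exact ⟨y, hy, x, hx, pair_comm _ _⟩

/-- Pairwise intersecting pairs form a star or a triangle. In a star with centre `a` some `A ∈ P`
misses `a`, so `A` consists of the outer ends of any two pairs in `Q`, which leaves `Q` only two
pairs. -/
lemma isCherry_or_triangle {P Q : Finset (Finset ℕ)} (hP2 : ∀ A ∈ P, A.card = 2)
    (hQ2 : ∀ B ∈ Q, B.card = 2) (hcross : ∀ A ∈ P, ∀ B ∈ Q, (A ∩ B).Nonempty)
    (hno : ∀ y, (∃ A ∈ P, y ∉ A) ∨ ∃ B ∈ Q, y ∉ B) (hQ : 2 ≤ Q.card)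
    (hQd : ∀ B ∈ Q, ∀ B' ∈ Q, ¬ Disjoint B B') :
    IsCherry P Q ∨ ∃ a b c, a ≠ b ∧ a ≠ c ∧ b ≠ c ∧ {a, b} ∈ Q ∧ {a, c} ∈ Q ∧ {b, c} ∈ Q := by
  obtain ⟨B₁, hB₁, B₂, hB₂, hne⟩ := one_lt_card.1 (by omega : 1 < Q.card)
  obtain ⟨a, ha₁, ha₂⟩ := not_disjoint_iff.1 (hQd _ hB₁ _ hB₂)
  obtain ⟨b, hb, hba⟩ := exists_mem_ne (by rw [hQ2 _ hB₁]; omega : 1 < B₁.card) a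
  obtain ⟨c, hc, hca⟩ := exists_mem_ne (by rw [hQ2 _ hB₂]; omega : 1 < B₂.card) a
  obtain rfl := eq_pair_of_card_two (hQ2 _ hB₁) ha₁ hb hba.symm
  obtain rfl := eq_pair_of_card_two (hQ2 _ hB₂) ha₂ hc hca.symm
  have hbc : b ≠ c := by rintro rfl; exact hne rfl
  have hbc_of : ∀ A : Finset ℕ, A.card = 2 → a ∉ A → (A ∩ {a, b}).Nonempty →
      (A ∩ {a, c}).Nonempty → A = {b, c} := by
    rintro A hA haA ⟨x, hx⟩ ⟨y, hy⟩
    simp only [mem_inter, mem_insert, mem_singleton] at hx hy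
    have hbA : b ∈ A := by
      rcases hx.2 with rfl | rfl
      · exact absurd hx.1 haA
      · exact hx.1
    have hcA : c ∈ A := by
      rcases hy.2 with rfl | rfl
      · exact absurd hy.1 haA
      · exact hy.1
    exact eq_pair_of_card_two hA hbA hcA hbc
  by_cases hall : ∀ B ∈ Q, a ∈ B
  · left
    obtain ⟨A, hA, haA⟩ : ∃ A ∈ P, a ∉ A := by
      rcases hno a with h | ⟨B, hB, haB⟩
      · exact h
      · exact absurd (hall B hB) haB
    obtain rfl := hbc_of A (hP2 A hA) haA (hcross _ hA _ hB₁) (hcross _ hA _ hB₂)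
    refine ⟨a, b, c, hba.symm, hca.symm, hbc, ?_, hA⟩
    ext B
    simp only [mem_insert, mem_singleton]
    constructor
    · intro hB
      obtain ⟨x, hx⟩ := hcross _ hA _ hB
      simp only [mem_inter, mem_insert, mem_singleton] at hx
      rcases hx with ⟨rfl | rfl, hxB⟩
      · exact Or.inl (eq_pair_of_card_two (hQ2 B hB) (hall B hB) hxB hba.symm)
      · exact Or.inr (eq_pair_of_card_two (hQ2 B hB) (hall B hB) hxB hca.symm)
    · rintro (rfl | rfl) <;> assumption
  · right
    push Not at hall
    obtain ⟨B, hB, haB⟩ := hall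
    obtain rfl := hbc_of B (hQ2 B hB) haB (not_disjoint_iff_nonempty_inter.1 (hQd _ hB _ hB₁))
      (not_disjoint_iff_nonempty_inter.1 (hQd _ hB _ hB₂))
    exact ⟨a, b, c, hba.symm, hca.symm, hbc, hB₁, hB₂, hB⟩

/-- A pair meeting all three sides of a triangle must contain two of its corners. -/
lemma subset_powersetCard_of_triangle {P Q : Finset (Finset ℕ)} (hP2 : ∀ A ∈ P, A.card = 2)
    (hcross : ∀ A ∈ P, ∀ B ∈ Q, (A ∩ B).Nonempty) {a b c : ℕ} (hab : a ≠ b) (hac : a ≠ c)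
    (hbc : b ≠ c) (h1 : {a, b} ∈ Q) (h2 : {a, c} ∈ Q) (h3 : {b, c} ∈ Q) :
    P ⊆ powersetCard 2 {a, b, c} := by
  intro A hA
  rw [mem_powersetCard]
  refine ⟨?_, hP2 A hA⟩
  obtain ⟨x, hx⟩ := hcross A hA _ h1
  obtain ⟨y, hy⟩ := hcross A hA _ h2
  obtain ⟨z, hz⟩ := hcross A hA _ h3
  simp only [mem_inter, mem_insert, mem_singleton] at hx hy hz
  have : ∃ u v, u ∈ A ∧ v ∈ A ∧ u ≠ v ∧ u ∈ ({a, b, c} : Finset ℕ) ∧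
      v ∈ ({a, b, c} : Finset ℕ) := by
    rcases hz.2 with rfl | rfl
    · rcases hy.2 with rfl | rfl
      · exact ⟨z, y, hz.1, hy.1, hab.symm, by simp, by simp⟩
      · exact ⟨z, y, hz.1, hy.1, hbc, by simp, by simp⟩
    · rcases hx.2 with rfl | rfl
      · exact ⟨z, x, hz.1, hx.1, hac.symm, by simp, by simp⟩
      · exact ⟨z, x, hz.1, hx.1, hbc.symm, by simp, by simp⟩
  obtain ⟨u, v, hu, hv, huv, hu', hv'⟩ := this
  rw [eq_pair_of_card_two (hP2 A hA) hu hv huv]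
  exact insert_subset hu' (singleton_subset_iff.2 hv')

lemma three_le_card_of_triangle {Q : Finset (Finset ℕ)} {a b c : ℕ} (hab : a ≠ b) (hac : a ≠ c)
    (hbc : b ≠ c) (h1 : {a, b} ∈ Q) (h2 : {a, c} ∈ Q) (h3 : {b, c} ∈ Q) : 3 ≤ Q.card := by
  have hsub : ({{a, b}, {a, c}, {b, c}} : Finset (Finset ℕ)) ⊆ Q := by
    simp only [insert_subset_iff, singleton_subset_iff]
    exact ⟨h1, h2, h3⟩
  refine le_trans (le_of_eq ?_) (card_le_card hsub)
  rw [eq_comm, card_eq_three]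
  refine ⟨_, _, _, ?_, ?_, ?_, rfl⟩
  · intro h
    have : b ∈ ({a, c} : Finset ℕ) := h ▸ (by simp)
    simp [hab.symm, hbc] at this
  · intro h
    have : a ∈ ({b, c} : Finset ℕ) := h ▸ (by simp)
    simp [hab, hac] at this
  · intro h
    have : a ∈ ({b, c} : Finset ℕ) := h ▸ (by simp)
    simp [hab, hac] at this

/-- Two cross-intersecting families of pairs without a common element. -/
lemma cross_intersecting_pairs {P Q : Finset (Finset ℕ)} (hP2 : ∀ A ∈ P, A.card = 2)
    (hQ2 : ∀ B ∈ Q, B.card = 2) (hcross : ∀ A ∈ P, ∀ B ∈ Q, (A ∩ B).Nonempty)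
    (hno : ∀ y, (∃ A ∈ P, y ∉ A) ∨ ∃ B ∈ Q, y ∉ B) (hP : 2 ≤ P.card) (hQ : 2 ≤ Q.card) :
    IsCherry P Q ∨ IsCherry Q P ∨ (P.card ≤ 4 ∧ Q.card ≤ 4 ∧
      ∃ U : Finset ℕ, U.card = 3 ∧ ∀ u ∈ U, ∃ A ∈ P, ∃ B ∈ Q, A ∩ B = {u}) := by
  have hcross' : ∀ B ∈ Q, ∀ A ∈ P, (B ∩ A).Nonempty := fun B hB A hA => by
    rw [inter_comm]; exact hcross A hA B hB
  by_cases hQd : ∃ B ∈ Q, ∃ B' ∈ Q, Disjoint B B'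
  · obtain ⟨B₁, hB₁, B₂, hB₂, hB⟩ := hQd
    exact Or.inr (isCherry_or_of_disjoint hP2 hQ2 hcross hP hB₁ hB₂ hB)
  by_cases hPd : ∃ A ∈ P, ∃ A' ∈ P, Disjoint A A'
  · obtain ⟨A₁, hA₁, A₂, hA₂, hA⟩ := hPd
    rcases isCherry_or_of_disjoint hQ2 hP2 hcross' hQ hA₁ hA₂ hA with h | ⟨h1, h2, U, hU, hU'⟩
    · exact Or.inl h
    · refine Or.inr (Or.inr ⟨h2, h1, U, hU, fun u hu => ?_⟩)
      obtain ⟨B, hB, A, hA, h⟩ := hU' u hu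
      exact ⟨A, hA, B, hB, by rw [inter_comm, h]⟩
  push Not at hQd hPd
  rcases isCherry_or_triangle hP2 hQ2 hcross hno hQ hQd with h | ⟨a, b, c, hab, hac, hbc, h1, h2, h3⟩
  · exact Or.inl h
  rcases isCherry_or_triangle hQ2 hP2 hcross' (fun y => (hno y).symm) hP hPd with
    h | ⟨a', b', c', hab', hac', hbc', h1', h2', h3'⟩
  · exact Or.inr (Or.inl h)
  have hPs := subset_powersetCard_of_triangle hP2 hcross hab hac hbc h1 h2 h3
  have hQs := subset_powersetCard_of_triangle hQ2 hcross' hab' hac' hbc' h1' h2' h3'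
  have hP3 := three_le_card_of_triangle hab' hac' hbc' h1' h2' h3'
  have hc3 : (powersetCard 2 ({a, b, c} : Finset ℕ)).card = 3 := by
    rw [card_powersetCard, card_eq_three.2 ⟨a, b, c, hab, hac, hbc, rfl⟩]
    rfl
  have hc3' : (powersetCard 2 ({a', b', c'} : Finset ℕ)).card = 3 := by
    rw [card_powersetCard, card_eq_three.2 ⟨a', b', c', hab', hac', hbc', rfl⟩]
    rfl
  -- `P` contains a triangle and lies in the three sides of one, so it is all of them; each corner
  -- is then the intersection of a side in `P` with a different side in `Q`.
  have hPe : P = powersetCard 2 {a, b, c} := eq_of_subset_of_card_le hPs (by omega)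
  have hQc := card_le_card hQs
  refine Or.inr (Or.inr ⟨by rw [hPe]; omega, by omega, {a, b, c},
    card_eq_three.2 ⟨a, b, c, hab, hac, hbc, rfl⟩, ?_⟩)
  have hmem : ∀ x y, x ≠ y → x ∈ ({a, b, c} : Finset ℕ) → y ∈ ({a, b, c} : Finset ℕ) →
      {x, y} ∈ P := by
    intro x y hxy hx hy
    rw [hPe, mem_powersetCard]
    exact ⟨insert_subset hx (singleton_subset_iff.2 hy), card_pair hxy⟩
  intro u hu
  rw [mem_insert, mem_insert, mem_singleton] at hu
  rcases hu with rfl | rfl | rfl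
  · refine ⟨{u, b}, hmem _ _ hab (by simp) (by simp), _, h2, ?_⟩
    ext x; simp; grind
  · refine ⟨{u, a}, hmem _ _ hab.symm (by simp) (by simp), _, h3, ?_⟩
    ext x; simp; grind
  · refine ⟨{u, a}, hmem _ _ hac.symm (by simp) (by simp), _, h3, ?_⟩
    ext x; simp; grind

/-- At least three families of pairs, such that all choices of one member from each of them have
a common element, but there is no element common to all members. -/
lemma cross_intersecting_pairs_of_three_le {D : Finset ℕ} (hD : 3 ≤ D.card)
    {Y : ℕ → Finset (Finset ℕ)} (hY2 : ∀ i ∈ D, ∀ A ∈ Y i, A.card = 2)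
    (hne : ∀ i ∈ D, (Y i).Nonempty)
    (hcross : ∀ Z : ℕ → Finset ℕ, (∀ i ∈ D, Z i ∈ Y i) → ∃ y, ∀ i ∈ D, y ∈ Z i)
    (hno : ∀ y, ∃ i ∈ D, ∃ A ∈ Y i, y ∉ A) :
    ∃ i₀ ∈ D, ∃ a b, a ≠ b ∧ ∀ j ∈ D, j ≠ i₀ → Y j = {{a, b}} := by
  choose! Z hZ using hne
  obtain ⟨c, hc⟩ := hcross Z hZ
  obtain ⟨i₀, hi₀, A, hA, hcA⟩ := hno c
  have hupd : ∀ i ∈ D, ∀ T ∈ Y i, ∃ y ∈ T, ∀ j ∈ D, j ≠ i → y ∈ Z j := by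
    intro i hi T hT
    obtain ⟨y, hy⟩ := hcross (Function.update Z i T) fun j hj => by
      by_cases h : j = i
      · subst h; simpa using hT
      · simpa [h] using hZ j hj
    refine ⟨y, by simpa using hy i hi, fun j hj hji => by simpa [hji] using hy j hj⟩
  obtain ⟨b, hbA, hb⟩ := hupd i₀ hi₀ A hA
  have hcb : c ≠ b := fun h => hcA (h ▸ hbA)
  -- All `Z j` with `j ≠ i₀` contain `c`, and also the point `b ≠ c` obtained by replacing `Z i₀` by
  -- the pair `A` that misses `c`.
  have hZe : ∀ j ∈ D, j ≠ i₀ → Z j = {c, b} := fun j hj hji =>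
    eq_pair_of_card_two (hY2 j hj _ (hZ j hj)) (hc j hj) (hb j hj hji) hcb
  have hthird : ∀ j, ∃ j' ∈ D, j' ≠ i₀ ∧ j' ≠ j := by
    intro j
    by_contra h
    push Not at h
    have : D ⊆ {i₀, j} := fun x hx => by
      rw [mem_insert, mem_singleton]
      by_cases hx0 : x = i₀
      · exact Or.inl hx0
      · exact Or.inr (h x hx hx0)
    have := card_le_card this
    have := card_le_two (a := i₀) (b := j)
    omega
  -- A third index `j'`, available because `|D| ≥ 3`, keeps `Z j' = {c, b}` in the choice and so
  -- confines the common point to `c` or `b`.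
  have hupd2 : ∀ S ∈ Y i₀, ∀ j ∈ D, j ≠ i₀ → ∀ T ∈ Y j, ∃ y ∈ S, y ∈ T ∧ (y = c ∨ y = b) := by
    intro S hS j hj hj0 T hT
    obtain ⟨j', hj', h1, h2⟩ := hthird j
    obtain ⟨y, hy⟩ := hcross (Function.update (Function.update Z i₀ S) j T) fun i hi => by
      by_cases h : i = j
      · subst h; simpa using hT
      · by_cases h' : i = i₀
        · subst h'; simpa [h] using hS
        · simpa [h, h'] using hZ i hi
    have e1 := hy i₀ hi₀
    have e2 := hy j hj
    have e3 := hy j' hj'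
    rw [Function.update_of_ne hj0.symm, Function.update_self] at e1
    rw [Function.update_self] at e2
    rw [Function.update_of_ne h2, Function.update_of_ne h1, hZe j' hj' h1, mem_insert,
      mem_singleton] at e3
    exact ⟨y, e1, e2, e3⟩
  have hbT : ∀ j ∈ D, j ≠ i₀ → ∀ T ∈ Y j, b ∈ T := by
    intro j hj hj0 T hT
    obtain ⟨y, hyA, hyT, rfl | rfl⟩ := hupd2 A hA j hj hj0 T hT
    · exact absurd hyA hcA
    · exact hyT
  have hcT : ∀ j ∈ D, j ≠ i₀ → ∀ T ∈ Y j, c ∈ T := by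
    intro j hj hj0 T hT
    obtain ⟨i₁, hi₁, A', hA', hbA'⟩ := hno b
    -- The pairs at all other indices contain `b`, so the pair `A'` missing `b` sits at `i₀`; it
    -- forces `c` just as `A` forced `b`.
    have : i₁ = i₀ := by
      by_contra h
      exact hbA' (hbT i₁ hi₁ h A' hA')
    subst this
    obtain ⟨y, hyA, hyT, rfl | rfl⟩ := hupd2 A' hA' j hj hj0 T hT
    · exact hyT
    · exact absurd hyA hbA'
  refine ⟨i₀, hi₀, c, b, hcb, fun j hj hj0 => ?_⟩
  rw [eq_singleton_iff_unique_mem]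
  refine ⟨hZe j hj hj0 ▸ hZ j hj, fun T hT => ?_⟩
  exact eq_pair_of_card_two (hY2 j hj T hT) (hcT j hj hj0 T hT) (hbT j hj hj0 T hT) hcb

/-! ### Counting the star. -/

/-- Enumerate `X` and classify the sets by the first element of `X` they contain: the `j`-th summand
counts those that contain one element and avoid the `j` preceding ones. -/
lemma card_filter_inter_nonempty {S R X : Finset ℕ} (hS : S ⊆ Icc 1 n) (hR : R ⊆ Icc 1 n)
    (hX : X ⊆ Icc 1 n) (hSR : Disjoint S R) (hSX : Disjoint S X) (hRX : Disjoint R X)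
    (hSk : S.card + 1 ≤ k) :
    {A ∈ kSubsets n k | S ⊆ A ∧ Disjoint A R ∧ (A ∩ X).Nonempty}.card =
      ∑ j ∈ range X.card, (n - S.card - 1 - R.card - j).choose (k - S.card - 1) := by
  induction X using Finset.induction_on with
  | empty => simp
  | insert x X hx ih =>
    rw [disjoint_insert_right] at hSX hRX
    rw [insert_subset_iff] at hX
    rw [card_insert_of_notMem hx, sum_range_succ, ← ih hX.2 hSX.2 hRX.2]
    have h1 : {A ∈ kSubsets n k | S ⊆ A ∧ Disjoint A R ∧ (A ∩ insert x X).Nonempty} =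
        {A ∈ kSubsets n k | S ⊆ A ∧ Disjoint A R ∧ (A ∩ X).Nonempty} ∪
        {A ∈ kSubsets n k | insert x S ⊆ A ∧ Disjoint A (R ∪ X)} := by
      ext A
      simp only [mem_filter, mem_union, insert_subset_iff, disjoint_union_right,
        ← not_disjoint_iff_nonempty_inter, disjoint_insert_right]
      tauto
    rw [h1, card_union_of_disjoint, card_filter_subset_disjoint
      (insert_subset hX.1 hS) (union_subset hR hX.2)]
    · rw [card_insert_of_notMem hSX.1, card_union_of_disjoint hRX.2, Nat.sub_sub, Nat.sub_sub,
        Nat.sub_sub, Nat.sub_sub, Nat.sub_sub]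
      congr 3
      omega
    · rw [disjoint_insert_left, disjoint_union_right, mem_union]
      exact ⟨by tauto, hSR, hSX.2⟩
    · rw [card_insert_of_notMem hSX.1]
      exact hSk
    · rw [disjoint_left]
      intro A hA hA'
      simp only [mem_filter, disjoint_union_right] at hA hA'
      exact not_disjoint_iff_nonempty_inter.2 hA.2.2.2 hA'.2.2.2

/-- The number of `k`-sets containing a given `(d - 1)`-set and meeting a given `l`-set disjoint
from it. -/
def starSize (n k d l : ℕ) : ℕ := ∑ j ∈ range l, (n - d - j).choose (k - d)

lemma Config.card_star (hc : Config n k d D X) :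
    {A ∈ kSubsets n k | D ⊆ A ∧ (A ∩ X).Nonempty}.card = starSize n k d X.card := by
  have h1 := hc.card_D
  have h2 := hc.lt
  have := card_filter_inter_nonempty (k := k) hc.D_subset (empty_subset _) hc.X_subset
    (disjoint_empty_right D) hc.disj (disjoint_empty_left X) (by omega)
  simp only [disjoint_empty_right, true_and, card_empty] at this
  rw [this, starSize]
  refine sum_congr rfl fun j _ => ?_
  congr 1 <;> omega

/-! ### Traces and the structure of maximal families. -/

/-- The sets `A \ (D ∪ X)`, where `i` is the only element of `D` missing from `A ∈ F`. -/
def traces (F : Finset (Finset ℕ)) (D X : Finset ℕ) (i : ℕ) : Finset (Finset ℕ) :=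
  {A ∈ F | D \ A = {i}}.image fun A => A \ (D ∪ X)

lemma mem_traces {Z : Finset ℕ} {i : ℕ} :
    Z ∈ traces F D X i ↔ ∃ A ∈ F, D \ A = {i} ∧ A \ (D ∪ X) = Z := by
  simp [traces, and_assoc]

/-- To identify a maximal family it is enough to place it inside a `d`-wise intersecting model. -/
lemma IsMaxNontrivial.eq_of_subset (hF : IsMaxNontrivial n k d F) {G : Finset (Finset ℕ)}
    (hG : G ⊆ kSubsets n k) (hGd : DWiseIntersecting d G) (hFG : F ⊆ G) : F = G := by
  refine hFG.antisymm fun A hA => ?_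
  by_contra hAF
  exact hF.maximal A (hG hA) hAF fun t ht => hGd t fun i => insert_subset hA hFG (ht i)

/-- A configuration such that `X` consists of all elements `x` outside `D` for which `D ∪ {x}`
generates members of `F`. -/
structure MaxConfig (n k d : ℕ) (F : Finset (Finset ℕ)) (D X : Finset ℕ) : Prop
    extends Config n k d D X where
  isMax : IsMaxNontrivial n k d F
  generates : ∀ x ∈ X, Generates n k F (insert x D)
  complete : ∀ x ∈ Icc 1 n, x ∉ D → Generates n k F (insert x D) → x ∈ X

namespace MaxConfig

variable (hm : MaxConfig n k d F D X)
include hm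

lemma subset_or {A : Finset ℕ} (hA : A ∈ F) : D ⊆ A ∨ ∃ i, D \ A = {i} ∧ X ⊆ A :=
  hm.toConfig.subset_or hm.isMax.toNontrivial hm.generates hA

lemma X_subset_of {A : Finset ℕ} (hA : A ∈ F) {i : ℕ} (hi : D \ A = {i}) : X ⊆ A := by
  rcases hm.subset_or hA with h | ⟨_, -, h⟩
  · exact absurd h (not_subset_of_sdiff_eq hi)
  · exact h

/-- Otherwise `D ∪ {y}` would generate and `y` would belong to `X`. Indeed, if no point of `D` is
common to `d - 1` given members, each of these misses exactly one point of `D`, so all of them would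
contain `y`. -/
lemma exists_missing_notMem {y : ℕ} (hy : y ∈ Icc 1 n) (hyD : y ∉ D) (hyX : y ∉ X) :
    ∃ i ∈ D, ∃ A ∈ F, D \ A = {i} ∧ y ∉ A := by
  have h3 := hm.three_le
  have hl := hm.large
  have hlt := hm.lt
  by_contra hall
  push Not at hall
  refine hyX (hm.complete y hy hyD fun A hA hDA => ?_)
  refine hm.isMax.mem_of_forall_common (by omega) (by omega) hA fun t ht => ?_
  by_contra hno
  push Not at hno
  rw [insert_subset_iff] at hDA
  have : Nonempty (Fin (d - 1)) := ⟨⟨0, by omega⟩⟩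
  choose! j hj using hno
  have hmiss : ∀ i ∈ D, D \ t (j i) = {i} := by
    intro i hi
    have h1 := hj i (hDA.2 hi)
    rcases hm.subset_or (ht (j i)) with h | ⟨i', h, -⟩
    · exact absurd (h hi) h1
    · have : i ∈ D \ t (j i) := mem_sdiff.2 ⟨hi, h1⟩
      rw [h, mem_singleton] at this
      rw [h, this]
  have hinj : Set.InjOn j D := by
    intro a ha b hb hab
    have h3 := hmiss a ha
    rw [hab, hmiss b hb, singleton_inj] at h3
    exact h3.symm
  have huniv : D.image j = univ := by
    apply eq_univ_of_card
    rw [card_image_of_injOn hinj]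
    have := hm.card_D
    simp
    omega
  have h2 := mem_univ (j y)
  rw [← huniv, mem_image] at h2
  obtain ⟨i, hi, hij⟩ := h2
  exact hj y hDA.1 (hij ▸ hall i hi _ (ht (j i)) (hmiss i hi))

/-- By `subset_or`, a member can violate the definition of `HFam` only by containing `D` and
avoiding `X`. -/
lemma eq_HFam_or : F = HFam n k D X ∨ ∃ E ∈ F, D ⊆ E ∧ Disjoint E X := by
  by_cases h : ∃ E ∈ F, D ⊆ E ∧ Disjoint E X
  · exact Or.inr h
  left
  push Not at h
  refine hm.isMax.eq_of_subset (fun A hA => (mem_HFam.1 hA).1) hm.toConfig.dWiseIntersecting_HFam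
    fun A hA => mem_HFam.2 ⟨hm.isMax.uniform hA, ?_⟩
  rcases hm.subset_or hA with h1 | h1
  · exact Or.inl ⟨h1, not_disjoint_iff_nonempty_inter.1 (h A hA h1)⟩
  · exact Or.inr h1

lemma traces_nonempty {i : ℕ} (hi : i ∈ D) : (traces F D X i).Nonempty := by
  obtain ⟨A, hA, hiA⟩ := hm.isMax.toNontrivial.exists_notMem (hm.D_subset hi)
  rcases hm.subset_or hA with h | ⟨j, h, -⟩
  · exact absurd (h hi) hiA
  · have : i ∈ D \ A := mem_sdiff.2 ⟨hi, hiA⟩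
    rw [h, mem_singleton] at this
    subst this
    exact ⟨_, mem_traces.2 ⟨A, hA, h, rfl⟩⟩

lemma card_trace {i : ℕ} {Z : Finset ℕ} (hZ : Z ∈ traces F D X i) :
    Z.card + X.card + d = k + 2 := by
  obtain ⟨A, hA, hiA, rfl⟩ := mem_traces.1 hZ
  have h1 : A ∩ (D ∪ X) = D.erase i ∪ X := by
    obtain ⟨-, h2, h3⟩ := sdiff_eq_singleton_iff.1 hiA
    have h4 := hm.X_subset_of hA hiA
    ext x
    simp only [mem_inter, mem_union, mem_erase]
    constructor
    · rintro ⟨hx, hD | hX⟩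
      · exact Or.inl ⟨fun h => h2 (h ▸ hx), hD⟩
      · exact Or.inr hX
    · rintro (h | h)
      · exact ⟨h3 (mem_erase.2 h), Or.inl h.2⟩
      · exact ⟨h4 h, Or.inr h⟩
  have h2 := card_sdiff_add_card_inter A (D ∪ X)
  have h3 := hm.toConfig.card_erase_union (sdiff_eq_singleton_iff.1 hiA).1
  rw [h1, (mem_kSubsets.1 (hm.isMax.uniform hA)).2] at h2
  omega

lemma mem_trace {i : ℕ} {Z : Finset ℕ} (hZ : Z ∈ traces F D X i) {y : ℕ} (hy : y ∈ Z) :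
    y ∈ Icc 1 n ∧ y ∉ D ∧ y ∉ X := by
  obtain ⟨A, hA, hiA, rfl⟩ := mem_traces.1 hZ
  simp only [mem_sdiff, mem_union, not_or] at hy
  exact ⟨(mem_kSubsets.1 (hm.isMax.uniform hA)).1 hy.1, hy.2⟩

lemma exists_trace_notMem (y : ℕ) : ∃ i ∈ D, ∃ Z ∈ traces F D X i, y ∉ Z := by
  by_cases hy : y ∈ Icc 1 n ∧ y ∉ D ∧ y ∉ X
  · obtain ⟨i, hi, A, hA, hiA, hyA⟩ := hm.exists_missing_notMem hy.1 hy.2.1 hy.2.2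
    exact ⟨i, hi, _, mem_traces.2 ⟨A, hA, hiA, rfl⟩, fun h => hyA (mem_sdiff.1 h).1⟩
  · obtain ⟨i, hi⟩ := hm.toConfig.D_nonempty
    obtain ⟨Z, hZ⟩ := hm.traces_nonempty hi
    exact ⟨i, hi, Z, hZ, fun h => hy (hm.mem_trace hZ h)⟩

/-- A point common to `E` and one member missing each `i ∈ D` lies outside `D`, and outside `X`
because `E` avoids `X`; hence it lies in all the traces. -/
lemma exists_common_trace {E : Finset ℕ} (hE : E ∈ F) (hEX : Disjoint E X) {Z : ℕ → Finset ℕ}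
    (hZ : ∀ i ∈ D, Z i ∈ traces F D X i) : ∃ y ∈ E, ∀ i ∈ D, y ∈ Z i := by
  simp only [mem_traces] at hZ
  choose! t ht htD htZ using hZ
  obtain ⟨y, hyE, hyD, hy⟩ := hm.isMax.intersecting.exists_common_notMem hm.card_D ht
    (fun i hi => (sdiff_eq_singleton_iff.1 (htD i hi)).2.1) hE
  refine ⟨y, hyE, fun i hi => ?_⟩
  rw [← htZ i hi, mem_sdiff, mem_union, not_or]
  exact ⟨hy i hi, hyD, disjoint_left.1 hEX hyE⟩

/-- If `|X| > k - d`, traces have at most one point. Exchanging one trace leaves another unchanged,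
so the common point would stay the same for all choices, against `exists_trace_notMem`. -/
lemma card_X_of_exists (hX : k ≤ X.card + d) {E : Finset ℕ} (hE : E ∈ F) (hEX : Disjoint E X) :
    X.card + d = k := by
  by_contra hne
  have h3 := hm.three_le
  have hDc := hm.card_D
  have hne' : ∀ i ∈ D, (traces F D X i).Nonempty := fun i hi => hm.traces_nonempty hi
  choose! Z hZ using hne'
  obtain ⟨y, -, hy⟩ := hm.exists_common_trace hE hEX hZ
  obtain ⟨i, hi, T, hT, hyT⟩ := hm.exists_trace_notMem y
  obtain ⟨j, hj, hji⟩ := exists_mem_ne (by omega : 1 < D.card) i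
  obtain ⟨z, -, hz⟩ := hm.exists_common_trace hE hEX (Z := Function.update Z i T) fun l hl => by
    by_cases h : l = i
    · subst h; simpa using hT
    · simpa [h] using hZ l hl
  have h1 := hz i hi
  have h2 := hz j hj
  rw [Function.update_self] at h1
  rw [Function.update_of_ne hji] at h2
  have h4 := hm.card_trace (hZ j hj)
  have h5 := card_le_one.1 (by omega : (Z j).card ≤ 1) y (hy j hj) z h2
  exact hyT (h5 ▸ h1)

/-- Common points of traces are confined to `{a, b}`. Some trace at `i₀` misses `a` and some trace
there misses `b`, which forces both into every member that contains `D` and avoids `X`. -/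
lemma eq_GFam {E : Finset ℕ} (hE : E ∈ F) (hEX : Disjoint E X) {i₀ a b : ℕ} (hi₀ : i₀ ∈ D)
    (h : ∀ j ∈ D, j ≠ i₀ → traces F D X j = {{a, b}}) : F = GFam n k D X i₀ a b := by
  have h3 := hm.three_le
  have hDc := hm.card_D
  obtain ⟨j, hj, hji⟩ := exists_mem_ne (by omega : 1 < D.card) i₀
  have key : ∀ T ∈ traces F D X i₀, ∀ A ∈ F, Disjoint A X → ∃ y ∈ A, y ∈ T ∧ (y = a ∨ y = b) := by
    intro T hT A hA hAX
    obtain ⟨y, hyA, hy⟩ := hm.exists_common_trace hA hAX (Z := fun l => if l = i₀ then T else {a, b})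
      fun l hl => by
        by_cases hli : l = i₀
        · subst hli; simpa using hT
        · simp [hli, h l hl hli]
    refine ⟨y, hyA, by simpa using hy i₀ hi₀, by simpa [hji] using hy j hj⟩
  refine hm.isMax.eq_of_subset (fun A hA => (mem_GFam.1 hA).1)
    (hm.toConfig.dWiseIntersecting_GFam _ _ _) fun A hA => mem_GFam.2 ⟨hm.isMax.uniform hA, ?_⟩
  rcases hm.subset_or hA with hDA | ⟨i, hiA, hXA⟩
  · refine Or.inl ⟨hDA, or_iff_not_imp_left.2 fun hAX => ?_⟩
    rw [← not_disjoint_iff_nonempty_inter, not_not] at hAX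
    have hno : ∀ c, c = a ∨ c = b → ∃ T ∈ traces F D X i₀, c ∉ T := by
      intro c hcab
      obtain ⟨i, hi, T, hT, hcT⟩ := hm.exists_trace_notMem c
      by_cases hii : i = i₀
      · exact ⟨T, hii ▸ hT, hcT⟩
      · rw [h i hi hii, mem_singleton] at hT
        subst hT
        simp at hcT
        tauto
    obtain ⟨T, hT, haT⟩ := hno a (Or.inl rfl)
    obtain ⟨T', hT', hbT'⟩ := hno b (Or.inr rfl)
    obtain ⟨y, hyA, hyT, hy⟩ := key T hT A hA hAX
    obtain ⟨y', hyA', hyT', hy'⟩ := key T' hT' A hA hAX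
    constructor
    · rcases hy' with rfl | rfl
      · exact hyA'
      · exact absurd hyT' hbT'
    · rcases hy with rfl | rfl
      · exact absurd hyT haT
      · exact hyA
  · have hT : A \ (D ∪ X) ∈ traces F D X i := mem_traces.2 ⟨A, hA, hiA, rfl⟩
    right
    by_cases hii : i = i₀
    · subst hii
      obtain ⟨y, -, hyT, hy⟩ := key _ hT E hE hEX
      have hyA := (mem_sdiff.1 hyT).1
      refine Or.inl ⟨hiA, hXA, ?_⟩
      rcases hy with rfl | rfl <;> tauto
    · rw [h i (sdiff_eq_singleton_iff.1 hiA).1 hii, mem_singleton] at hT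
      have ha : a ∈ A \ (D ∪ X) := by rw [hT]; simp
      have hb : b ∈ A \ (D ∪ X) := by rw [hT]; simp
      exact Or.inr ⟨i, hiA, hXA, (mem_sdiff.1 ha).1, (mem_sdiff.1 hb).1⟩

lemma exists_common_trace_pair {i₁ i₂ : ℕ} (hD : D = {i₁, i₂}) (hi : i₁ ≠ i₂) {E : Finset ℕ}
    (hE : E ∈ F) (hEX : Disjoint E X) {S T : Finset ℕ} (hS : S ∈ traces F D X i₁)
    (hT : T ∈ traces F D X i₂) : ∃ y ∈ E, y ∈ S ∧ y ∈ T := by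
  have hi₁ : i₁ ∈ D := by simp [hD]
  have hi₂ : i₂ ∈ D := by simp [hD]
  obtain ⟨y, hyE, hy⟩ := hm.exists_common_trace hE hEX (Z := fun i => if i = i₁ then S else T)
    fun i hiD => by
      rw [hD, mem_insert, mem_singleton] at hiD
      rcases hiD with rfl | rfl
      · simpa using hS
      · simpa [hi.symm] using hT
  exact ⟨y, hyE, by simpa using hy i₁ hi₁, by simpa [hi.symm] using hy i₂ hi₂⟩

/-- Meeting `{a, b}` and `{a, c}` restricts the traces at `i₁`. For a member containing `D` and
avoiding `X`, the trace `{b, c}` forces `b` and `c`, and a second trace `T₀` at `i₁`, necessarily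
through `a`, forces `a`. -/
lemma eq_SFam {i₁ i₂ : ℕ} (hD : D = {i₁, i₂}) (hi : i₁ ≠ i₂) {E : Finset ℕ}
    (hE : E ∈ F) (hEX : Disjoint E X) (hX : X.card + d = k) {a b c : ℕ} (hac : a ≠ c)
    (hbc : b ≠ c) (hab : a ≠ b) (h₂ : traces F D X i₂ = {{a, b}, {a, c}})
    (h₁ : {b, c} ∈ traces F D X i₁)
    (hcard : 2 ≤ (traces F D X i₁).card) : F = SFam n k D X i₁ i₂ a b c := by
  have hb2 : {a, b} ∈ traces F D X i₂ := by simp [h₂]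
  have hc2 : {a, c} ∈ traces F D X i₂ := by simp [h₂]
  have hT : ∀ T ∈ traces F D X i₁, a ∈ T ∨ (b ∈ T ∧ c ∈ T) := by
    intro T hT
    obtain ⟨y, -, hyT, hy⟩ := hm.exists_common_trace_pair hD hi hE hEX hT hb2
    obtain ⟨z, -, hzT, hz⟩ := hm.exists_common_trace_pair hD hi hE hEX hT hc2
    rw [mem_insert, mem_singleton] at hy hz
    rcases hy with rfl | rfl
    · exact Or.inl hyT
    · rcases hz with rfl | rfl
      · exact Or.inl hzT
      · exact Or.inr ⟨hyT, hzT⟩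
  obtain ⟨T₀, hT₀, hne⟩ := exists_mem_ne (by omega : 1 < (traces F D X i₁).card) {b, c}
  have hT₀c : T₀.card = 2 := by
    have := hm.card_trace hT₀
    omega
  have haT₀ : a ∈ T₀ := by
    rcases hT T₀ hT₀ with h | h
    · exact h
    · exact absurd (eq_pair_of_card_two hT₀c h.1 h.2 hbc) hne
  refine hm.isMax.eq_of_subset (fun A hA => (mem_SFam.1 hA).1)
    (hm.toConfig.dWiseIntersecting_SFam hD hi _ _ _)
    fun A hA => mem_SFam.2 ⟨hm.isMax.uniform hA, ?_⟩
  rcases hm.subset_or hA with hDA | ⟨i, hiA, hXA⟩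
  · refine Or.inl ⟨hDA, or_iff_not_imp_left.2 fun hAX => ?_⟩
    rw [← not_disjoint_iff_nonempty_inter, not_not] at hAX
    obtain ⟨y, hyA, hy1, hy2⟩ := hm.exists_common_trace_pair hD hi hA hAX h₁ hb2
    obtain ⟨z, hzA, hz1, hz2⟩ := hm.exists_common_trace_pair hD hi hA hAX h₁ hc2
    obtain ⟨u, huA, hu1, hu2⟩ := hm.exists_common_trace_pair hD hi hA hAX hT₀ hb2
    obtain ⟨v, hvA, hv1, hv2⟩ := hm.exists_common_trace_pair hD hi hA hAX hT₀ hc2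
    simp only [mem_insert, mem_singleton] at hy1 hy2 hz1 hz2 hu2 hv2
    refine ⟨?_, ?_, ?_⟩
    · rcases hu2 with rfl | rfl
      · exact huA
      · rcases hv2 with rfl | rfl
        · exact hvA
        · have h4 := eq_pair_of_card_two hT₀c hu1 hv1 hbc
          rw [h4, mem_insert, mem_singleton] at haT₀
          exact absurd haT₀ (by tauto)
    · rcases hy2 with rfl | rfl
      · exact absurd hy1 (by tauto)
      · exact hyA
    · rcases hz2 with rfl | rfl
      · exact absurd hz1 (by tauto)
      · exact hzA
  · right
    have hTA : A \ (D ∪ X) ∈ traces F D X i := mem_traces.2 ⟨A, hA, hiA, rfl⟩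
    have hiD := (sdiff_eq_singleton_iff.1 hiA).1
    rw [hD, mem_insert, mem_singleton] at hiD
    rcases hiD with rfl | rfl
    · left
      refine ⟨hiA, hXA, ?_⟩
      have := hT _ hTA
      simp only [mem_sdiff] at this
      tauto
    · right
      refine ⟨hiA, hXA, ?_⟩
      rw [h₂, mem_insert, mem_singleton] at hTA
      have h5 : ∀ x, x ∈ A \ (D ∪ X) → x ∈ A := fun x hx => (mem_sdiff.1 hx).1
      rcases hTA with h | h
      · exact ⟨h5 a (by rw [h]; simp), Or.inl (h5 b (by rw [h]; simp))⟩
      · exact ⟨h5 a (by rw [h]; simp), Or.inr (h5 c (by rw [h]; simp))⟩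

/-- A member missing `i` contains the rest of `D` and all of `X`, so its trace determines it. -/
lemma card_missing_eq (i : ℕ) : {A ∈ F | D \ A = {i}}.card = (traces F D X i).card := by
  rw [traces, card_image_of_injOn]
  intro A hA B hB hAB
  simp only [coe_filter, Set.mem_ofPred_eq] at hA hB
  have hAX := hm.X_subset_of hA.1 hA.2
  have hBX := hm.X_subset_of hB.1 hB.2
  obtain ⟨-, hA1, hA2⟩ := sdiff_eq_singleton_iff.1 hA.2
  obtain ⟨-, hB1, hB2⟩ := sdiff_eq_singleton_iff.1 hB.2
  ext x
  by_cases hxX : x ∈ X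
  · simp [hAX hxX, hBX hxX]
  by_cases hxD : x ∈ D
  · by_cases hxi : x = i
    · subst hxi
      simp [hA1, hB1]
    · simp [hA2 (mem_erase.2 ⟨hxi, hxD⟩), hB2 (mem_erase.2 ⟨hxi, hxD⟩)]
  · have := Finset.ext_iff.1 hAB x
    simpa [hxD, hxX] using this

/-- Each `u ∈ U` is the only common point of two traces, so members that contain `D` and avoid `X`
contain the five points of `D ∪ U`. The members missing `i₁` or `i₂` number at most `4 + 4`. -/
lemma card_le_of_triple {i₁ i₂ : ℕ} (hD : D = {i₁, i₂}) (hi : i₁ ≠ i₂) (hX : X.card + d = k)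
    (h₁ : (traces F D X i₁).card ≤ 4) (h₂ : (traces F D X i₂).card ≤ 4) {U : Finset ℕ}
    (hU : U.card = 3)
    (h : ∀ u ∈ U, ∃ S ∈ traces F D X i₁, ∃ T ∈ traces F D X i₂, S ∩ T = {u}) :
    F.card ≤ starSize n k d (k - d) + (n - k - 2).choose (k - 5) + 8 := by
  have hDc := hm.card_D
  have hd : d = 3 := by
    rw [hD, card_pair hi] at hDc
    omega
  have hlt := hm.lt
  have hmemU : ∀ u ∈ U, u ∈ Icc 1 n ∧ u ∉ D ∧ u ∉ X := by
    intro u hu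
    obtain ⟨S, hS, T, hT, hST⟩ := h u hu
    have : u ∈ S ∩ T := by simp [hST]
    exact hm.mem_trace hS (mem_inter.1 this).1
  have hDU : Disjoint D U := disjoint_right.2 fun u hu => (hmemU u hu).2.1
  have hXU : Disjoint X U := disjoint_right.2 fun u hu => (hmemU u hu).2.2
  have hDUc : (D ∪ U).card = 5 := by
    rw [card_union_of_disjoint hDU]
    omega
  have hsub : F ⊆ {A ∈ kSubsets n k | D ⊆ A ∧ (A ∩ X).Nonempty} ∪
      {A ∈ kSubsets n k | D ∪ U ⊆ A ∧ Disjoint A X} ∪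
      ({A ∈ F | D \ A = {i₁}} ∪ {A ∈ F | D \ A = {i₂}}) := by
    intro A hA
    have hAk := hm.isMax.uniform hA
    simp only [mem_union, mem_filter]
    rcases hm.subset_or hA with hDA | ⟨i, hiA, hXA⟩
    · left
      by_cases hAX : Disjoint A X
      · refine Or.inr ⟨hAk, union_subset hDA fun u hu => ?_, hAX⟩
        obtain ⟨S, hS, T, hT, hST⟩ := h u hu
        obtain ⟨y, hyA, hyS, hyT⟩ := hm.exists_common_trace_pair hD hi hA hAX hS hT
        have : y ∈ S ∩ T := mem_inter.2 ⟨hyS, hyT⟩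
        rw [hST, mem_singleton] at this
        exact this ▸ hyA
      · exact Or.inl ⟨hAk, hDA, not_disjoint_iff_nonempty_inter.1 hAX⟩
    · right
      have hiD := (sdiff_eq_singleton_iff.1 hiA).1
      rw [hD, mem_insert, mem_singleton] at hiD
      rcases hiD with rfl | rfl
      · exact Or.inl ⟨hA, hiA⟩
      · exact Or.inr ⟨hA, hiA⟩
  have e1 := hm.toConfig.card_star
  have e2 := card_filter_subset_disjoint (k := k)
    (union_subset hm.D_subset fun u hu => (hmemU u hu).1) hm.X_subset
    (disjoint_union_left.2 ⟨hm.disj, hXU.symm⟩) (by omega)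
  rw [hDUc] at e2
  have e3 := hm.card_missing_eq i₁
  have e4 := hm.card_missing_eq i₂
  have e5 := card_union_le {A ∈ F | D \ A = {i₁}} {A ∈ F | D \ A = {i₂}}
  have e6 : n - 5 - X.card = n - k - 2 := by omega
  have e7 : X.card = k - d := by omega
  rw [e6] at e2
  rw [e7] at e1
  refine (card_le_card hsub).trans ((card_union_le _ _).trans ?_)
  have e8 := card_union_le {A ∈ kSubsets n k | D ⊆ A ∧ (A ∩ X).Nonempty}
    {A ∈ kSubsets n k | D ∪ U ⊆ A ∧ Disjoint A X}
  omega

end MaxConfig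

/-- The data defining a family `GFam`. -/
structure GConfig (n k d : ℕ) (D X : Finset ℕ) (i₀ a b : ℕ) : Prop
    extends Config n k d D X where
  card_X : X.card + d = k
  i₀_mem : i₀ ∈ D
  a_mem : a ∈ Icc 1 n ∧ a ∉ D ∧ a ∉ X
  b_mem : b ∈ Icc 1 n ∧ b ∉ D ∧ b ∉ X
  ab : a ≠ b

/-- The data defining a family `SFam`. -/
structure SConfig (n k d : ℕ) (D X : Finset ℕ) (i₁ i₂ a b c : ℕ) : Prop
    extends Config n k d D X where
  card_X : X.card + d = k
  D_eq : D = {i₁, i₂}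
  i_ne : i₁ ≠ i₂
  a_mem : a ∈ Icc 1 n ∧ a ∉ D ∧ a ∉ X
  b_mem : b ∈ Icc 1 n ∧ b ∉ D ∧ b ∉ X
  c_mem : c ∈ Icc 1 n ∧ c ∉ D ∧ c ∉ X
  ab : a ≠ b
  ac : a ≠ c
  bc : b ≠ c

lemma GConfig.isMaxNontrivial {i₀ a b : ℕ} (h : GConfig n k d D X i₀ a b) :
    IsMaxNontrivial n k d (GFam n k D X i₀ a b) :=
  h.toConfig.isMaxNontrivial_GFam h.card_X h.i₀_mem h.a_mem.1 h.b_mem.1 h.a_mem.2.1 h.b_mem.2.1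
    h.a_mem.2.2 h.b_mem.2.2 h.ab

lemma SConfig.isMaxNontrivial {i₁ i₂ a b c : ℕ} (h : SConfig n k d D X i₁ i₂ a b c) :
    IsMaxNontrivial n k d (SFam n k D X i₁ i₂ a b c) :=
  h.toConfig.isMaxNontrivial_SFam h.card_X h.D_eq h.i_ne h.a_mem.1 h.b_mem.1 h.c_mem.1
    h.a_mem.2.1 h.b_mem.2.1 h.c_mem.2.1 h.a_mem.2.2 h.b_mem.2.2 h.c_mem.2.2 h.ab h.ac h.bc

/-- The possible structures of a maximal family with many generators. -/
def IsStructured (n k d : ℕ) (F : Finset (Finset ℕ)) : Prop :=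
  (∃ D X, Config n k d D X ∧ (X.card = 2 ∨ k ≤ X.card + d) ∧ F = HFam n k D X) ∨
  (∃ D X i₀ a b, GConfig n k d D X i₀ a b ∧ F = GFam n k D X i₀ a b) ∨
  (d = 3 ∧ ∃ D X i₁ i₂ a b c, SConfig n k d D X i₁ i₂ a b c ∧ F = SFam n k D X i₁ i₂ a b c) ∨
  -- The finitely many shapes with few traces need no description: this bound already lies below
  -- `sSize`, whose linear term `n - k` exceeds `8`.
  (d = 3 ∧ F.card ≤ starSize n k d (k - d) + (n - k - 2).choose (k - 5) + 8)

lemma MaxConfig.gConfig (hm : MaxConfig n k d F D X) (hX : X.card + d = k) {i₀ j a b : ℕ}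
    (hi₀ : i₀ ∈ D) (hab : a ≠ b) (h : {a, b} ∈ traces F D X j) :
    GConfig n k d D X i₀ a b :=
  ⟨hm.toConfig, hX, hi₀, hm.mem_trace h (by simp), hm.mem_trace h (by simp), hab⟩

lemma MaxConfig.isStructured_of_cherry (hm : MaxConfig n k d F D X) (hX : X.card + d = k)
    {i₁ i₂ : ℕ} (hD : D = {i₁, i₂}) (hi : i₁ ≠ i₂) {E : Finset ℕ} (hE : E ∈ F)
    (hEX : Disjoint E X) (h1 : 2 ≤ (traces F D X i₁).card)
    (h : IsCherry (traces F D X i₁) (traces F D X i₂)) : IsStructured n k d F := by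
  obtain ⟨a, b, c, hab, hac, hbc, hQ, hP⟩ := h
  have hb : {a, b} ∈ traces F D X i₂ := by simp [hQ]
  have hDc := hm.card_D
  refine Or.inr (Or.inr (Or.inl ⟨?_, D, X, i₁, i₂, a, b, c, ?_,
    hm.eq_SFam hD hi hE hEX hX hac hbc hab hQ hP h1⟩))
  · rw [hD, card_pair hi] at hDc
    omega
  · exact ⟨hm.toConfig, hX, hD, hi, hm.mem_trace hb (by simp), hm.mem_trace hP (by simp),
      hm.mem_trace hP (by simp), hab, hac, hbc⟩

lemma MaxConfig.isStructured (hm : MaxConfig n k d F D X) (hX : k ≤ X.card + d) :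
    IsStructured n k d F := by
  rcases hm.eq_HFam_or with h | ⟨E, hE, hDE, hEX⟩
  · exact Or.inl ⟨D, X, hm.toConfig, Or.inr hX, h⟩
  have hXk := hm.card_X_of_exists hX hE hEX
  have h3 := hm.three_le
  have hDc := hm.card_D
  have hT2 : ∀ i, ∀ Z ∈ traces F D X i, Z.card = 2 := fun i Z hZ => by
    have := hm.card_trace hZ
    omega
  by_cases hd3 : d = 3
  · obtain ⟨i₁, i₂, hi, hD⟩ := card_eq_two.1 (by omega : D.card = 2)
    have hi₁ : i₁ ∈ D := by simp [hD]
    have hi₂ : i₂ ∈ D := by simp [hD]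
    have hG : ∀ i j, i ∈ D → j ∈ D → D = {i, j} → (traces F D X j).card = 1 →
        IsStructured n k d F := by
      intro i j hi hj hDij hc
      obtain ⟨Z, hZ⟩ := card_eq_one.1 hc
      obtain ⟨a, b, hab, rfl⟩ := card_eq_two.1 (hT2 j Z (by simp [hZ]))
      refine Or.inr (Or.inl ⟨D, X, i, a, b, hm.gConfig hXk hi hab (j := j) (by simp [hZ]),
        hm.eq_GFam hE hEX hi fun l hl hli => ?_⟩)
      rw [hDij, mem_insert, mem_singleton] at hl
      rw [hl.resolve_left hli, hZ]
    have hp1 := card_pos.2 (hm.traces_nonempty hi₁)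
    have hp2 := card_pos.2 (hm.traces_nonempty hi₂)
    by_cases hc1 : (traces F D X i₁).card = 1
    · exact hG i₂ i₁ hi₂ hi₁ (by rw [hD, pair_comm]) hc1
    by_cases hc2 : (traces F D X i₂).card = 1
    · exact hG i₁ i₂ hi₁ hi₂ hD hc2
    have hcross : ∀ A ∈ traces F D X i₁, ∀ B ∈ traces F D X i₂, (A ∩ B).Nonempty := by
      intro A hA B hB
      obtain ⟨y, -, hy1, hy2⟩ := hm.exists_common_trace_pair hD hi hE hEX hA hB
      exact ⟨y, mem_inter.2 ⟨hy1, hy2⟩⟩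
    have hno : ∀ y, (∃ A ∈ traces F D X i₁, y ∉ A) ∨ ∃ B ∈ traces F D X i₂, y ∉ B := by
      intro y
      obtain ⟨i, hi, Z, hZ, hyZ⟩ := hm.exists_trace_notMem y
      have hi' : i = i₁ ∨ i = i₂ := by rwa [hD, mem_insert, mem_singleton] at hi
      rcases hi' with rfl | rfl
      · exact Or.inl ⟨Z, hZ, hyZ⟩
      · exact Or.inr ⟨Z, hZ, hyZ⟩
    rcases cross_intersecting_pairs (hT2 i₁) (hT2 i₂) hcross hno (by omega) (by omega) with
      h | h | ⟨h1, h2, U, hU, hU'⟩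
    · exact hm.isStructured_of_cherry hXk hD hi hE hEX (by omega) h
    · exact hm.isStructured_of_cherry hXk (by rw [hD, pair_comm]) hi.symm hE hEX (by omega) h
    · exact Or.inr (Or.inr (Or.inr ⟨hd3, hm.card_le_of_triple hD hi hXk h1 h2 hU hU'⟩))
  · obtain ⟨i₀, hi₀, a, b, hab, h⟩ := cross_intersecting_pairs_of_three_le
      (by omega : 3 ≤ D.card) (fun i _ => hT2 i) (fun i hi => hm.traces_nonempty hi)
      (fun Z hZ => by
        obtain ⟨y, -, hy⟩ := hm.exists_common_trace hE hEX hZ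
        exact ⟨y, hy⟩) hm.exists_trace_notMem
    obtain ⟨j, hj, hji⟩ := exists_mem_ne (by omega : 1 < D.card) i₀
    exact Or.inr (Or.inl ⟨D, X, i₀, a, b,
      hm.gConfig hXk hi₀ hab (j := j) (by simp [h j hj hji]), hm.eq_GFam hE hEX hi₀ h⟩)

/-- Pairwise intersections of size at least `d - 1` make the generating `d`-sets a sunflower with
kernel `D = B₁ ∩ B₂`, unless one of them does not contain `D`. In a sunflower the petals form `X`,
with at least `k - d` elements; the other case gives the model with `|X| = 2`. -/
lemma IsMaxNontrivial.isStructured (hF : IsMaxNontrivial n k d F) (hd : 3 ≤ d) (hk : d + 2 ≤ k)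
    (hn : 4 * k ≤ n) (hgen : k ≤ (generators n k d F).card + d) : IsStructured n k d F := by
  classical
  obtain ⟨B₁, hB₁, B₂, hB₂, hne⟩ := one_lt_card.1 (by omega : 1 < (generators n k d F).card)
  have hnt := hF.toNontrivial
  have hint : ∀ B ∈ generators n k d F, ∀ B' ∈ generators n k d F, d ≤ (B ∩ B').card + 1 := by
    intro B hB B' hB'
    rw [mem_generators] at hB hB'
    exact hnt.card_inter_ge_of_generates (by omega) hB.1 (by omega) hB.2.2 hB'.1 (by omega)
      hB'.2.2
  have h12 := hint _ hB₁ _ hB₂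
  have g1 := mem_generators.1 hB₁
  have g2 := mem_generators.1 hB₂
  obtain ⟨D, hDdef⟩ : ∃ D, D = B₁ ∩ B₂ := ⟨_, rfl⟩
  rw [← hDdef] at h12
  have hD1 : D ⊆ B₁ := hDdef ▸ inter_subset_left
  have hD2 : D ⊆ B₂ := hDdef ▸ inter_subset_right
  have hDn : D ⊆ Icc 1 n := hD1.trans g1.1
  have hDc : D.card + 1 = d := by
    have h1 := card_le_card hD1
    by_contra hcon
    have e1 := eq_of_subset_of_card_le hD1 (by omega)
    have e2 := eq_of_subset_of_card_le hD2 (by omega)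
    exact hne (e1.symm.trans e2)
  have hins : ∀ B ∈ generators n k d F, D ⊆ B → ∃ x ∈ Icc 1 n, x ∉ D ∧ B = insert x D := by
    intro B hB hDB
    rw [mem_generators] at hB
    have h1 := card_sdiff_of_subset hDB
    obtain ⟨x, hx⟩ := card_eq_one.1 (by omega : (B \ D).card = 1)
    have hxB : x ∈ B \ D := by simp [hx]
    rw [mem_sdiff] at hxB
    refine ⟨x, hB.1 hxB.1, hxB.2, ?_⟩
    rw [insert_eq, ← hx, sdiff_union_of_subset hDB]
  have hconf : ∀ x y, x ∈ Icc 1 n → y ∈ Icc 1 n → x ∉ D → y ∉ D → x ≠ y →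
      Config n k d D {x, y} := by
    intro x y hx hy hxD hyD hxy
    have := card_pair hxy
    exact ⟨hd, hk, hn, hDn, insert_subset hx (singleton_subset_iff.2 hy),
      by simp [disjoint_right, hxD, hyD], hDc, by omega, by omega⟩
  have hgen_pair : ∀ x y, Generates n k F (insert x D) → Generates n k F (insert y D) →
      ∀ z ∈ ({x, y} : Finset ℕ), Generates n k F (insert z D) := by
    intro x y hx hy z hz
    rw [mem_insert, mem_singleton] at hz
    rcases hz with rfl | rfl <;> assumption
  by_cases hstar : ∀ B ∈ generators n k d F, D ⊆ B
  · obtain ⟨X, hX⟩ : ∃ X : Finset ℕ,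
        X = {x ∈ Icc 1 n | x ∉ D ∧ Generates n k F (insert x D)} := ⟨_, rfl⟩
    have hXmem : ∀ x, x ∈ X ↔ x ∈ Icc 1 n ∧ x ∉ D ∧ Generates n k F (insert x D) := by
      intro x
      rw [hX, mem_filter]
    have hXc : (generators n k d F).card ≤ X.card := by
      have hsub : generators n k d F ⊆ X.image fun x => insert x D := by
        intro B hB
        obtain ⟨x, hx, hxD, rfl⟩ := hins B hB (hstar B hB)
        exact mem_image.2 ⟨x, (hXmem x).2 ⟨hx, hxD, (mem_generators.1 hB).2.2⟩, rfl⟩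
      exact (card_le_card hsub).trans card_image_le
    have hXD : Disjoint D X := disjoint_right.2 fun x hx => ((hXmem x).1 hx).2.1
    obtain ⟨i, hi⟩ : D.Nonempty := card_pos.1 (by omega)
    obtain ⟨A, hA, hiA⟩ := hnt.exists_notMem (hDn hi)
    -- This bounds `|X|` by `k - d + 2`. The full configuration is not yet available, so `subset_or`
    -- is applied to two elements of `X` at a time.
    have hXA : D.erase i ∪ X ⊆ A := by
      have key : ∀ x ∈ X, x ∈ A ∧ D.erase i ⊆ A := by
        intro x hx
        obtain ⟨y, hy, hyx⟩ := exists_mem_ne (by omega : 1 < X.card) x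
        rw [hXmem] at hx hy
        rcases (hconf x y hx.1 hy.1 hx.2.1 hy.2.1 hyx.symm).subset_or hnt
          (hgen_pair x y hx.2.2 hy.2.2) hA with h | ⟨j, h, hxy⟩
        · exact absurd (h hi) hiA
        · have : i ∈ D \ A := mem_sdiff.2 ⟨hi, hiA⟩
          rw [h, mem_singleton] at this
          subst this
          exact ⟨hxy (by simp), (sdiff_eq_singleton_iff.1 h).2.2⟩
      obtain ⟨x, hx⟩ : X.Nonempty := card_pos.1 (by omega)
      exact union_subset (key x hx).2 fun y hy => (key y hy).1
    have hcard := card_le_card hXA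
    rw [card_union_of_disjoint (hXD.mono_left (erase_subset _ _)), card_erase_of_mem hi,
      (mem_kSubsets.1 (hF.uniform hA)).2] at hcard
    have hm : MaxConfig n k d F D X :=
      { three_le := hd
        lt := hk
        large := hn
        D_subset := hDn
        X_subset := fun x hx => ((hXmem x).1 hx).1
        disj := hXD
        card_D := hDc
        two_le := by omega
        card_le := by omega
        isMax := hF
        generates := fun x hx => ((hXmem x).1 hx).2.2
        complete := fun x hx hxD hg => (hXmem x).2 ⟨hx, hxD, hg⟩ }
    exact hm.isStructured (by omega)
  · push Not at hstar
    obtain ⟨B₃, hB₃, hD3⟩ := hstar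
    have g3 := mem_generators.1 hB₃
    obtain ⟨x, hx, hxD, rfl⟩ := hins B₁ hB₁ hD1
    obtain ⟨y, hy, hyD, rfl⟩ := hins B₂ hB₂ hD2
    have hxy : x ≠ y := by rintro rfl; exact hne rfl
    have hc := hconf x y hx hy hxD hyD hxy
    have hlt : (D ∩ B₃).card < D.card := card_lt_card
      ⟨inter_subset_left, fun h => hD3 (h.trans inter_subset_right)⟩
    have hmem3 : ∀ z, insert z D ∈ generators n k d F → z ∈ B₃ := by
      intro z hz
      by_contra hz3
      have := hint _ hz _ hB₃
      rw [insert_inter_of_notMem hz3] at this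
      omega
    have hx3 := hmem3 x hB₁
    have hy3 := hmem3 y hB₂
    refine Or.inl ⟨D, {x, y}, hc, Or.inl (card_pair hxy), ?_⟩
    refine hF.eq_of_subset (fun A hA => (mem_HFam.1 hA).1) hc.dWiseIntersecting_HFam
      fun A hA => mem_HFam.2 ⟨hF.uniform hA, ?_⟩
    rcases hc.subset_or hnt (hgen_pair x y g1.2.2 g2.2.2) hA with h | h
    · refine Or.inl ⟨h, ?_⟩
      by_contra hemp
      rw [not_nonempty_iff_eq_empty, ← disjoint_iff_inter_eq_empty, disjoint_right] at hemp
      have hxA := hemp (by simp : x ∈ ({x, y} : Finset ℕ))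
      have hyA := hemp (by simp : y ∈ ({x, y} : Finset ℕ))
      -- `B₃` contains both `x` and `y`, so a member avoiding both would meet it in at most `d - 2`
      -- points.
      have h4 := hnt.card_inter_ge (by omega) g3.1 (by omega) g3.2.2 hA
      have h5 : B₃ ∩ A ⊆ (B₃.erase x).erase y := by
        intro z hz
        rw [mem_inter] at hz
        rw [mem_erase, mem_erase]
        exact ⟨fun h => hyA (h ▸ hz.2), fun h => hxA (h ▸ hz.2), hz.1⟩
      have h6 := card_le_card h5
      rw [card_erase_of_mem (mem_erase.2 ⟨hxy.symm, hy3⟩), card_erase_of_mem hx3] at h6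
      omega
    · exact Or.inr h

/-! ### Exact sizes of the model families. -/

/-- The size of `𝓗(k,d,l)`. -/
def hSize (n k d l : ℕ) : ℕ := starSize n k d l + (d - 1) * (n + 1 - d - l).choose (k + 2 - d - l)

/-- The size of `𝓖(k,d)`. -/
def gSize (n k d : ℕ) : ℕ :=
  starSize n k d (k - d) + (n - k - 1).choose (k - d - 1) + (2 * (n - k - 1) + 1) + (d - 2)

/-- The size of `𝓢₁(k,3)`. -/
def sSize (n k : ℕ) : ℕ := starSize n k 3 (k - 3) + (n - k - 2).choose (k - 5) + (n - k) + 3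

lemma missing_iff {A : Finset ℕ} {i : ℕ} (hi : i ∈ D) :
    (D \ A = {i} ∧ X ⊆ A) ↔ D.erase i ∪ X ⊆ A ∧ Disjoint A {i} := by
  rw [sdiff_eq_singleton_iff, union_subset_iff, disjoint_singleton_right]
  tauto

namespace Config

variable (hc : Config n k d D X)
include hc

/-- The number of `k`-sets containing `D \ {i} ∪ X ∪ Y` and avoiding `{i} ∪ R`. -/
lemma card_missing {i : ℕ} (hi : i ∈ D) {Y R : Finset ℕ} (hY : Y ⊆ Icc 1 n) (hR : R ⊆ Icc 1 n)
    (hYD : Disjoint Y D) (hYX : Disjoint Y X) (hRD : Disjoint R D) (hRX : Disjoint R X)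
    (hRY : Disjoint R Y) (hYc : Y.card + X.card + d ≤ k + 2) :
    {A ∈ kSubsets n k | D.erase i ∪ X ∪ Y ⊆ A ∧ Disjoint A (insert i R)}.card =
      (n + 1 - (X.card + d + Y.card + R.card)).choose (k + 2 - (X.card + d + Y.card)) := by
  have h1 := hc.card_erase_union hi
  have h2 := hc.two_le
  have h3 := hc.three_le
  have hiX : i ∉ X := disjoint_left.1 hc.disj hi
  have hiY : i ∉ Y := disjoint_right.1 hYD hi
  have hiR : i ∉ R := disjoint_right.1 hRD hi
  have h4 : (D.erase i ∪ X ∪ Y).card = X.card + d - 2 + Y.card := by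
    rw [card_union_of_disjoint]
    · omega
    · exact disjoint_union_left.2 ⟨hYD.symm.mono_left (erase_subset _ _), hYX.symm⟩
  rw [card_filter_subset_disjoint (union_subset (hc.erase_union_subset i) hY)
    (Finset.insert_subset (hc.D_subset hi) hR), card_insert_of_notMem hiR, h4]
  · congr 1 <;> omega
  · rw [disjoint_insert_right, disjoint_union_left, disjoint_union_left]
    refine ⟨by simp [hiX, hiY], ⟨hRD.symm.mono_left (erase_subset _ _), hRX.symm⟩, hRY.symm⟩
  · omega

lemma card_HFam : (HFam n k D X).card = hSize n k d X.card := by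
  have hle := hc.card_le
  have h2 := hc.two_le
  have h3 := hc.three_le
  have hDc := hc.card_D
  have h1 : HFam n k D X = {A ∈ kSubsets n k | D ⊆ A ∧ (A ∩ X).Nonempty} ∪
      D.biUnion fun i => {A ∈ kSubsets n k | D.erase i ∪ X ∪ ∅ ⊆ A ∧ Disjoint A (insert i ∅)} := by
    ext A
    simp only [mem_HFam, mem_union, mem_filter, mem_biUnion, union_empty, insert_empty_eq]
    constructor
    · rintro ⟨hA, h | ⟨i, h⟩⟩
      · exact Or.inl ⟨hA, h⟩
      · have hi := (sdiff_eq_singleton_iff.1 h.1).1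
        exact Or.inr ⟨i, hi, hA, (missing_iff hi).1 h⟩
    · rintro (⟨hA, h⟩ | ⟨i, hi, hA, h⟩)
      · exact ⟨hA, Or.inl h⟩
      · exact ⟨hA, Or.inr ⟨i, (missing_iff hi).2 h⟩⟩
  rw [h1, card_union_of_disjoint, hc.card_star, card_biUnion, hSize]
  · rw [sum_congr rfl fun i hi => hc.card_missing hi (empty_subset _) (empty_subset _) (by simp)
      (by simp) (by simp) (by simp) (by simp) (by simpa using hle), sum_const, smul_eq_mul]
    simp only [card_empty]
    congr 2
    · omega
    · congr 1 <;> omega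
  · intro i hi j hj hij
    rw [Function.onFun, disjoint_left]
    intro A hA hA'
    simp only [mem_filter, union_empty, insert_empty_eq] at hA hA'
    have := disjoint_singleton_right.1 hA'.2.2
    exact this (hA.2.1 (mem_union_left _ (mem_erase.2 ⟨hij.symm, hj⟩)))
  · rw [disjoint_left]
    intro A hA hA'
    simp only [mem_filter, mem_biUnion, union_empty, insert_empty_eq] at hA hA'
    obtain ⟨i, hi, -, -, h⟩ := hA'
    exact disjoint_singleton_right.1 h (hA.2.1 hi)

end Config

/-- Beyond the star there are the sets containing `D ∪ {a, b}` and avoiding `X`; the sets missing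
`i₀`, with two more elements of which one is `a` or `b`, `(n-k) + (n-k-1)` in number; and one set
for each of the other `d - 2` points of `D`. -/
lemma GConfig.card_GFam {i₀ a b : ℕ} (hc : GConfig n k d D X i₀ a b) :
    (GFam n k D X i₀ a b).card = gSize n k d := by
  have hX := hc.card_X
  have h2 := hc.two_le
  have h3 := hc.three_le
  have hlt := hc.lt
  have hl := hc.large
  have hDc := hc.card_D
  have hi₀ := hc.i₀_mem
  have hY : ({a, b} : Finset ℕ) ⊆ Icc 1 n := by
    simp only [insert_subset_iff, singleton_subset_iff]
    exact ⟨hc.a_mem.1, hc.b_mem.1⟩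
  have hYD : Disjoint ({a, b} : Finset ℕ) D := by
    simp [disjoint_left, hc.a_mem.2.1, hc.b_mem.2.1]
  have hYX : Disjoint ({a, b} : Finset ℕ) X := by
    simp [disjoint_left, hc.a_mem.2.2, hc.b_mem.2.2]
  have hYc : ({a, b} : Finset ℕ).card = 2 := card_pair hc.ab
  have hiX : i₀ ∉ X := disjoint_left.1 hc.disj hi₀
  have hiY : i₀ ∉ ({a, b} : Finset ℕ) := disjoint_right.1 hYD hi₀
  have h1 : GFam n k D X i₀ a b = ({A ∈ kSubsets n k | D ⊆ A ∧ (A ∩ X).Nonempty} ∪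
      {A ∈ kSubsets n k | D ∪ {a, b} ⊆ A ∧ Disjoint A X}) ∪
      ({A ∈ kSubsets n k | D.erase i₀ ∪ X ⊆ A ∧ Disjoint A {i₀} ∧ (A ∩ {a, b}).Nonempty} ∪
      (D.erase i₀).biUnion fun i => {A ∈ kSubsets n k | D.erase i ∪ X ∪ {a, b} ⊆ A ∧
        Disjoint A (insert i ∅)}) := by
    ext A
    have hab : (A ∩ {a, b}).Nonempty ↔ a ∈ A ∨ b ∈ A := by
      simp [Finset.Nonempty, and_or_left, exists_or]
    simp only [mem_GFam, mem_union, mem_filter, mem_biUnion, insert_empty_eq]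
    constructor
    · rintro ⟨hA, ⟨h, h'⟩ | ⟨h, h', h''⟩ | ⟨i, h, h', ha, hb⟩⟩
      · left
        by_cases hAX : (A ∩ X).Nonempty
        · exact Or.inl ⟨hA, h, hAX⟩
        · have := h'.resolve_left hAX
          refine Or.inr ⟨hA, union_subset h (Finset.insert_subset this.1
            (singleton_subset_iff.2 this.2)), ?_⟩
          by_contra hd
          exact hAX (not_disjoint_iff_nonempty_inter.1 hd)
      · have := (missing_iff hi₀).1 ⟨h, h'⟩
        exact Or.inr (Or.inl ⟨hA, this.1, this.2, hab.2 h''⟩)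
      · have hi := (sdiff_eq_singleton_iff.1 h).1
        have := (missing_iff hi).1 ⟨h, h'⟩
        right
        by_cases hii : i = i₀
        · subst hii
          exact Or.inl ⟨hA, this.1, this.2, hab.2 (Or.inl ha)⟩
        · exact Or.inr ⟨i, mem_erase.2 ⟨hii, hi⟩, hA, union_subset this.1
            (Finset.insert_subset ha (singleton_subset_iff.2 hb)), this.2⟩
    · rintro ((⟨hA, h⟩ | ⟨hA, h, h'⟩) | ⟨hA, h, h', h''⟩ | ⟨i, hi, hA, h, h'⟩)
      · exact ⟨hA, Or.inl ⟨h.1, Or.inl h.2⟩⟩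
      · exact ⟨hA, Or.inl ⟨subset_union_left.trans h, Or.inr ⟨h (by simp), h (by simp)⟩⟩⟩
      · have := (missing_iff hi₀).2 ⟨h, h'⟩
        exact ⟨hA, Or.inr (Or.inl ⟨this.1, this.2, hab.1 h''⟩)⟩
      · have := (missing_iff (mem_erase.1 hi).2).2 ⟨subset_union_left.trans h, h'⟩
        exact ⟨hA, Or.inr (Or.inr ⟨i, this.1, this.2, h (by simp), h (by simp)⟩)⟩
  have hDYc : (D ∪ {a, b}).card = d + 1 := by
    rw [card_union_of_disjoint hYD.symm]
    omega
  have hEc : (D.erase i₀ ∪ X).card = k - 2 := by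
    have := hc.toConfig.card_erase_union hi₀
    omega
  rw [h1, card_union_of_disjoint, card_union_of_disjoint, card_union_of_disjoint,
    hc.toConfig.card_star, card_filter_subset_disjoint (union_subset hc.D_subset hY) hc.X_subset
      (disjoint_union_left.2 ⟨hc.disj, hYX⟩) (by omega), hDYc,
    card_filter_inter_nonempty (hc.toConfig.erase_union_subset i₀)
      (singleton_subset_iff.2 (hc.D_subset hi₀)) hY (by simp [hiX])
      (disjoint_union_left.2 ⟨hYD.symm.mono_left (erase_subset _ _), hYX.symm⟩)
      (disjoint_singleton_left.2 hiY) (by omega), hEc, hYc, card_biUnion,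
    sum_congr rfl fun i hi => hc.toConfig.card_missing (mem_erase.1 hi).2 hY (empty_subset _)
      hYD hYX (by simp) (by simp) (by simp) (by omega), sum_const, card_erase_of_mem hi₀, hYc,
    sum_range_succ, sum_range_succ, gSize]
  · have e1 : X.card = k - d := by omega
    have e2 : k - (k - 2) - 1 = 1 := by omega
    have e3 : n - (d + 1) - (k - d) = n - k - 1 := by omega
    have e4 : k - (d + 1) = k - d - 1 := by omega
    have e5 : k + 2 - (k - d + d + 2) = 0 := by omega
    rw [e1, e2, e3, e4, e5]
    simp
    omega
  · intro i hi j hj hij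
    rw [Function.onFun, disjoint_left]
    intro A hA hA'
    simp only [mem_filter, insert_empty_eq] at hA hA'
    refine disjoint_singleton_right.1 hA'.2.2 (hA.2.1 (mem_union_left _ (mem_union_left _ ?_)))
    exact mem_erase.2 ⟨hij.symm, (mem_erase.1 hj).2⟩
  · rw [disjoint_left]
    intro A hA hA'
    simp only [mem_filter, mem_biUnion, insert_empty_eq] at hA hA'
    obtain ⟨i, hi, -, h, -⟩ := hA'
    rw [mem_erase] at hi
    refine disjoint_singleton_right.1 hA.2.2.1 (h (mem_union_left _ (mem_union_left _ ?_)))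
    exact mem_erase.2 ⟨hi.1.symm, hi₀⟩
  · rw [disjoint_left]
    intro A hA hA'
    simp only [mem_filter] at hA hA'
    exact not_disjoint_iff_nonempty_inter.2 hA.2.2 hA'.2.2
  · rw [disjoint_left]
    intro A hA hA'
    simp only [mem_union, mem_filter, mem_biUnion, insert_empty_eq] at hA hA'
    have hDA : D ⊆ A := by
      rcases hA with h | h
      · exact h.2.1
      · exact subset_union_left.trans h.2.1
    rcases hA' with h | ⟨i, hi, -, -, h⟩
    · exact disjoint_singleton_right.1 h.2.2.1 (hDA hi₀)
    · exact disjoint_singleton_right.1 h (hDA (mem_erase.1 hi).2)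

/-- Beyond the sets containing `D`, there are `n - k` sets missing `i₁` with `a` in the trace, and
three single sets with traces `{b, c}`, `{a, b}`, `{a, c}`. The added avoidance conditions make the
pieces disjoint. -/
lemma SConfig.card_SFam {i₁ i₂ a b c : ℕ} (hc : SConfig n k d D X i₁ i₂ a b c) (hd : d = 3) :
    (SFam n k D X i₁ i₂ a b c).card = sSize n k := by
  have hX := hc.card_X
  have h2 := hc.two_le
  have h3 := hc.three_le
  have hlt := hc.lt
  have hl := hc.large
  have hDc := hc.card_D
  have hD := hc.D_eq
  have hi₁ : i₁ ∈ D := by simp [hD]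
  have hi₂ : i₂ ∈ D := by simp [hD]
  have e₁ : D.erase i₁ = {i₂} := by
    rw [hD, erase_insert (by simpa using hc.i_ne)]
  have e₂ : D.erase i₂ = {i₁} := by
    rw [hD, pair_comm, erase_insert (by simpa using hc.i_ne.symm)]
  obtain ⟨ha, haD, haX⟩ := hc.a_mem
  obtain ⟨hb, hbD, hbX⟩ := hc.b_mem
  obtain ⟨hcn, hcD, hcX⟩ := hc.c_mem
  have hab := hc.ab
  have hac := hc.ac
  have hbc := hc.bc
  have hYn : ({a, b, c} : Finset ℕ) ⊆ Icc 1 n := by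
    simp only [insert_subset_iff, singleton_subset_iff]
    exact ⟨ha, hb, hcn⟩
  have hYD : Disjoint ({a, b, c} : Finset ℕ) D := by simp [disjoint_left, haD, hbD, hcD]
  have hYX : Disjoint ({a, b, c} : Finset ℕ) X := by simp [disjoint_left, haX, hbX, hcX]
  have hYc : ({a, b, c} : Finset ℕ).card = 3 := card_eq_three.2 ⟨a, b, c, hab, hac, hbc, rfl⟩
  have hm : ∀ i ∈ D, ∀ Y R : Finset ℕ, Y ⊆ {a, b, c} → R ⊆ {a, b, c} → Disjoint R Y →
      Y.card ≤ 2 → {A ∈ kSubsets n k | D.erase i ∪ X ∪ Y ⊆ A ∧ Disjoint A (insert i R)}.card =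
        (n + 1 - (X.card + d + Y.card + R.card)).choose (k + 2 - (X.card + d + Y.card)) :=
    fun i hi Y R hY hR hYR hYc => hc.toConfig.card_missing hi (hY.trans hYn) (hR.trans hYn)
      (hYD.mono_left hY) (hYX.mono_left hY) (hYD.mono_left hR) (hYX.mono_left hR) hYR (by omega)
  have m1 := hm i₁ hi₁ {a} ∅ (by simp) (by simp) (by simp) (by simp)
  have m2 := hm i₁ hi₁ {b, c} {a} (by simp) (by simp) (by simp [hab, hac])
    (card_le_two)
  have m3 := hm i₂ hi₂ {a, b} ∅ (by simp [insert_subset_iff]) (by simp) (by simp) card_le_two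
  have m4 := hm i₂ hi₂ {a, c} {b} (by simp [insert_subset_iff]) (by simp)
    (by simp [hab.symm, hbc]) card_le_two
  have h1 : SFam n k D X i₁ i₂ a b c = ({A ∈ kSubsets n k | D ⊆ A ∧ (A ∩ X).Nonempty} ∪
      {A ∈ kSubsets n k | D ∪ {a, b, c} ⊆ A ∧ Disjoint A X}) ∪
      (({A ∈ kSubsets n k | D.erase i₁ ∪ X ∪ {a} ⊆ A ∧ Disjoint A (insert i₁ ∅)} ∪
        {A ∈ kSubsets n k | D.erase i₁ ∪ X ∪ {b, c} ⊆ A ∧ Disjoint A (insert i₁ {a})}) ∪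
      ({A ∈ kSubsets n k | D.erase i₂ ∪ X ∪ {a, b} ⊆ A ∧ Disjoint A (insert i₂ ∅)} ∪
        {A ∈ kSubsets n k | D.erase i₂ ∪ X ∪ {a, c} ⊆ A ∧ Disjoint A (insert i₂ {b})})) := by
    ext A
    simp only [mem_SFam, mem_union, mem_filter, ← not_disjoint_iff_nonempty_inter,
      union_subset_iff, insert_subset_iff, singleton_subset_iff, disjoint_insert_right,
      disjoint_singleton_right, disjoint_empty_right, sdiff_eq_singleton_iff, hi₁, hi₂,
      true_and, and_true]
    generalize (A ∈ kSubsets n k) = p₀, (D ⊆ A) = p₁, (Disjoint A X) = p₂,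
      (D.erase i₁ ⊆ A) = p₃, (D.erase i₂ ⊆ A) = p₄, (X ⊆ A) = p₅, (i₁ ∈ A) = q₁, (i₂ ∈ A) = q₂,
      (a ∈ A) = qa, (b ∈ A) = qb, (c ∈ A) = qc
    clear * -
    by_cases qa <;> by_cases qb <;> by_cases qc <;> grind
  have hDYc : (D ∪ {a, b, c}).card = 5 := by
    rw [card_union_of_disjoint hYD.symm]
    omega
  rw [h1, card_union_of_disjoint, card_union_of_disjoint, card_union_of_disjoint,
    card_union_of_disjoint, card_union_of_disjoint, m1, m2, m3, m4,
    hc.toConfig.card_star, card_filter_subset_disjoint (union_subset hc.D_subset hYn) hc.X_subset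
      (disjoint_union_left.2 ⟨hc.disj, hYX⟩) (by omega), hDYc, sSize, card_pair hbc, card_pair hab,
    card_pair hac]
  · subst hd
    have f1 : X.card = k - 3 := by omega
    have f2 : k + 2 - (k - 3 + 3 + 1) = 1 := by omega
    have f3 : k + 2 - (k - 3 + 3 + 2) = 0 := by omega
    have f4 : n - 5 - (k - 3) = n - k - 2 := by omega
    simp only [f1, f2, f3, f4, card_singleton, card_empty, Nat.choose_one_right,
      Nat.choose_zero_right]
    omega
  all_goals
    rw [disjoint_left]
    intro A hA hA'
    simp only [mem_union, mem_filter, ← not_disjoint_iff_nonempty_inter,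
      union_subset_iff, insert_subset_iff, singleton_subset_iff, disjoint_insert_right,
      disjoint_singleton_right, disjoint_empty_right, e₁, e₂] at hA hA'
    tauto

/-! ### Permutations and isomorphism of the models. -/

lemma exists_perm_image_eq {U A A' : Finset ℕ} (hA : A ⊆ U) (hA' : A' ⊆ U)
    (h : A.card = A'.card) :
    ∃ π : Equiv.Perm ℕ, (∀ x, x ∉ U → π x = x) ∧ A.image π = A' := by
  classical
  have hcard : ∀ B ⊆ U, Fintype.card {x : {x // x ∈ U} // x.1 ∈ B} = B.card := by
    intro B hB
    rw [Fintype.card_of_subtype (B.subtype (· ∈ U)) (by simp), card_subtype]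
    congr 1
    exact filter_true_of_mem hB
  let e : {x : {x // x ∈ U} // x.1 ∈ A} ≃ {x : {x // x ∈ U} // x.1 ∈ A'} :=
    Fintype.equivOfCardEq (by rw [hcard A hA, hcard A' hA', h])
  refine ⟨Equiv.Perm.ofSubtype e.extendSubtype, fun x hx =>
    Equiv.Perm.ofSubtype_apply_of_not_mem _ hx, ?_⟩
  apply eq_of_subset_of_card_le
  · intro y hy
    obtain ⟨x, hx, rfl⟩ := mem_image.1 hy
    rw [Equiv.Perm.ofSubtype_apply_of_mem _ (hA hx)]
    exact e.extendSubtype_mem ⟨x, hA hx⟩ hx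
  · rw [card_image_of_injective _ (Equiv.injective _), h]

/-- Move the first block to its target by `σ`, then treat the `σ`-images of the other blocks inside
`U \ A'`, so that later permutations fix `A'` pointwise. -/
lemma exists_perm_image_eq_of_pairwise (L : List (Finset ℕ × Finset ℕ)) (U : Finset ℕ)
    (h : ∀ p ∈ L, p.1 ⊆ U ∧ p.2 ⊆ U ∧ p.1.card = p.2.card)
    (hL : L.Pairwise fun p q => Disjoint p.1 q.1 ∧ Disjoint p.2 q.2) :
    ∃ π : Equiv.Perm ℕ, (∀ x, x ∉ U → π x = x) ∧ ∀ p ∈ L, p.1.image π = p.2 := by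
  induction hm : L.length generalizing L U with
  | zero =>
    rw [List.length_eq_zero_iff] at hm
    subst hm
    exact ⟨Equiv.refl _, fun _ _ => rfl, by simp⟩
  | succ m ih =>
    obtain ⟨⟨A, A'⟩, L, rfl⟩ := List.exists_cons_of_length_eq_add_one hm
    rw [List.pairwise_cons] at hL
    obtain ⟨hA, hA', hAc⟩ := h (A, A') (by simp)
    obtain ⟨σ, hσ, hσA⟩ := exists_perm_image_eq hA hA' hAc
    change A.image σ = A' at hσA
    have hσU : ∀ B ⊆ U, B.image σ ⊆ U := by
      intro B hB x hx
      obtain ⟨y, hy, rfl⟩ := mem_image.1 hx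
      by_contra hxU
      have h1 := σ.injective (hσ _ hxU)
      rw [h1] at hxU
      exact hxU (hB hy)
    obtain ⟨τ, hτ, hτL⟩ := ih (L.map fun p => (p.1.image σ, p.2)) (U \ A')
      (by
        intro p hp
        obtain ⟨q, hq, rfl⟩ := List.mem_map.1 hp
        obtain ⟨h1, h2, h3⟩ := h q (List.mem_cons_of_mem _ hq)
        obtain ⟨h4, h5⟩ := hL.1 q hq
        refine ⟨subset_sdiff.2 ⟨hσU _ h1, ?_⟩, subset_sdiff.2 ⟨h2, h5.symm⟩, ?_⟩
        · change Disjoint (q.1.image σ) A'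
          rw [← hσA, disjoint_image σ.injective]
          exact h4.symm
        · rw [card_image_of_injective _ σ.injective, h3])
      (by
        rw [List.pairwise_map]
        refine hL.2.imp fun h => ?_
        rw [disjoint_image σ.injective]
        exact h)
      (by simpa using hm)
    refine ⟨σ.trans τ, fun x hx => ?_, fun p hp => ?_⟩
    · rw [Equiv.trans_apply, hσ x hx, hτ x fun h => hx (mem_sdiff.1 h).1]
    · rw [Equiv.coe_trans, ← image_image]
      rcases List.mem_cons.1 hp with rfl | hp
      · rw [hσA]
        dsimp only
        conv_rhs => rw [← image_id (s := A')]
        exact image_congr fun x hx => hτ x fun h => (mem_sdiff.1 h).2 hx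
      · exact hτL (p.1.image σ, p.2) (List.mem_map.2 ⟨p, hp, rfl⟩)

lemma image_subset_Icc {π : Equiv.Perm ℕ} (hπ : ∀ x, x ∉ Icc 1 n → π x = x) {A : Finset ℕ}
    (hA : A ⊆ Icc 1 n) : A.image π ⊆ Icc 1 n := by
  intro x hx
  obtain ⟨y, hy, rfl⟩ := mem_image.1 hx
  by_contra hxU
  have h1 := π.injective (hπ _ hxU)
  rw [h1] at hxU
  exact hxU (hA hy)

lemma mem_image_perm (π : Equiv.Perm ℕ) {A : Finset ℕ} {x : ℕ} : π x ∈ A.image π ↔ x ∈ A :=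
  π.injective.mem_finset_image

lemma image_sdiff_eq_singleton (π : Equiv.Perm ℕ) {A : Finset ℕ} {i : ℕ} (h : D \ A = {i}) :
    D.image π \ A.image π = {π i} := by
  rw [← image_sdiff _ _ π.injective, h, image_singleton]

lemma Config.image {π : Equiv.Perm ℕ} (hπ : ∀ x, x ∉ Icc 1 n → π x = x)
    (hc : Config n k d D X) : Config n k d (D.image π) (X.image π) := by
  have h1 := card_image_of_injective D π.injective
  have h2 := card_image_of_injective X π.injective
  obtain ⟨a1, a2, a3, a4, a5, a6, a7, a8, a9⟩ := hc
  exact ⟨a1, a2, a3, image_subset_Icc hπ a4, image_subset_Icc hπ a5,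
    (disjoint_image π.injective).2 a6, by omega, by omega, by omega⟩

lemma mem_compl_image {π : Equiv.Perm ℕ} (hπ : ∀ x, x ∉ Icc 1 n → π x = x) {x : ℕ}
    (h : x ∈ Icc 1 n ∧ x ∉ D ∧ x ∉ X) :
    π x ∈ Icc 1 n ∧ π x ∉ D.image π ∧ π x ∉ X.image π := by
  rw [mem_image_perm, mem_image_perm]
  refine ⟨image_subset_Icc hπ (singleton_subset_iff.2 h.1) (by simp), h.2⟩

lemma GConfig.image {π : Equiv.Perm ℕ} (hπ : ∀ x, x ∉ Icc 1 n → π x = x) {i₀ a b : ℕ}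
    (hc : GConfig n k d D X i₀ a b) :
    GConfig n k d (D.image π) (X.image π) (π i₀) (π a) (π b) :=
  ⟨hc.toConfig.image hπ, by rw [card_image_of_injective X π.injective, hc.card_X],
    (mem_image_perm π).2 hc.i₀_mem, mem_compl_image hπ hc.a_mem, mem_compl_image hπ hc.b_mem,
    π.injective.ne hc.ab⟩

lemma SConfig.image {π : Equiv.Perm ℕ} (hπ : ∀ x, x ∉ Icc 1 n → π x = x) {i₁ i₂ a b c : ℕ}
    (hc : SConfig n k d D X i₁ i₂ a b c) :
    SConfig n k d (D.image π) (X.image π) (π i₁) (π i₂) (π a) (π b) (π c) :=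
  ⟨hc.toConfig.image hπ, by rw [card_image_of_injective X π.injective, hc.card_X],
    by rw [hc.D_eq]; simp, π.injective.ne hc.i_ne,
    mem_compl_image hπ hc.a_mem, mem_compl_image hπ hc.b_mem, mem_compl_image hπ hc.c_mem,
    π.injective.ne hc.ab, π.injective.ne hc.ac, π.injective.ne hc.bc⟩

lemma image_mem_kSubsets {π : Equiv.Perm ℕ} (hπ : ∀ x, x ∉ Icc 1 n → π x = x) {A : Finset ℕ}
    (hA : A ∈ kSubsets n k) : A.image π ∈ kSubsets n k := by
  rw [mem_kSubsets] at hA ⊢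
  exact ⟨image_subset_Icc hπ hA.1, by rw [card_image_of_injective _ π.injective, hA.2]⟩

lemma image_inter_nonempty {π : Equiv.Perm ℕ} {A : Finset ℕ} (h : (A ∩ X).Nonempty) :
    (A.image π ∩ X.image π).Nonempty := by
  rw [← image_inter _ _ π.injective]
  exact h.image π

/-- Equal sizes turn an inclusion into an equality, so the exact counts make the converse inclusion
unnecessary. -/
lemma image_family_eq {π : Equiv.Perm ℕ} {G G' : Finset (Finset ℕ)}
    (h : ∀ A ∈ G, A.image π ∈ G') (hc : G.card = G'.card) : G.image (fun A => A.image π) = G' := by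
  apply eq_of_subset_of_card_le
  · intro A hA
    obtain ⟨B, hB, rfl⟩ := mem_image.1 hA
    exact h B hB
  · rw [card_image_of_injective _ (image_injective π.injective), hc]

lemma Config.image_HFam {π : Equiv.Perm ℕ} (hπ : ∀ x, x ∉ Icc 1 n → π x = x)
    (hc : Config n k d D X) :
    (HFam n k D X).image (fun A => A.image π) = HFam n k (D.image π) (X.image π) := by
  apply image_family_eq
  · intro A hA
    rw [mem_HFam] at hA ⊢
    refine ⟨image_mem_kSubsets hπ hA.1, ?_⟩
    rcases hA.2 with h | ⟨i, h, h'⟩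
    · exact Or.inl ⟨image_subset_image h.1, image_inter_nonempty h.2⟩
    · exact Or.inr ⟨π i, image_sdiff_eq_singleton π h, image_subset_image h'⟩
  · rw [hc.card_HFam, (hc.image hπ).card_HFam, card_image_of_injective X π.injective]

lemma GConfig.image_GFam {π : Equiv.Perm ℕ} (hπ : ∀ x, x ∉ Icc 1 n → π x = x) {i₀ a b : ℕ}
    (hc : GConfig n k d D X i₀ a b) : (GFam n k D X i₀ a b).image (fun A => A.image π) =
      GFam n k (D.image π) (X.image π) (π i₀) (π a) (π b) := by
  apply image_family_eq
  · intro A hA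
    rw [mem_GFam] at hA ⊢
    refine ⟨image_mem_kSubsets hπ hA.1, ?_⟩
    simp only [mem_image_perm]
    rcases hA.2 with h | h | ⟨i, h⟩
    · exact Or.inl ⟨image_subset_image h.1, h.2.imp image_inter_nonempty id⟩
    · exact Or.inr (Or.inl ⟨image_sdiff_eq_singleton π h.1, image_subset_image h.2.1, h.2.2⟩)
    · exact Or.inr (Or.inr ⟨π i, image_sdiff_eq_singleton π h.1, image_subset_image h.2.1, h.2.2⟩)
  · rw [hc.card_GFam, (hc.image hπ).card_GFam]

lemma SConfig.image_SFam {π : Equiv.Perm ℕ} (hπ : ∀ x, x ∉ Icc 1 n → π x = x) (hd : d = 3)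
    {i₁ i₂ a b c : ℕ}
    (hc : SConfig n k d D X i₁ i₂ a b c) : (SFam n k D X i₁ i₂ a b c).image (fun A => A.image π) =
      SFam n k (D.image π) (X.image π) (π i₁) (π i₂) (π a) (π b) (π c) := by
  apply image_family_eq
  · intro A hA
    rw [mem_SFam] at hA ⊢
    refine ⟨image_mem_kSubsets hπ hA.1, ?_⟩
    simp only [mem_image_perm]
    rcases hA.2 with h | h | h
    · exact Or.inl ⟨image_subset_image h.1, h.2.imp image_inter_nonempty id⟩
    · exact Or.inr (Or.inl ⟨image_sdiff_eq_singleton π h.1, image_subset_image h.2.1, h.2.2⟩)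
    · exact Or.inr (Or.inr ⟨image_sdiff_eq_singleton π h.1, image_subset_image h.2.1, h.2.2⟩)
  · rw [hc.card_SFam hd, (hc.image hπ).card_SFam hd]

lemma FamilyIso.symm {G G' : Finset (Finset ℕ)} (h : FamilyIso n G G') : FamilyIso n G' G := by
  obtain ⟨π, hπ, rfl⟩ := h
  refine ⟨π.symm, fun x hx => ?_, ?_⟩
  · rw [Equiv.symm_apply_eq, hπ x hx]
  · rw [image_image]
    conv_rhs => rw [← image_id (s := G)]
    refine image_congr fun A _ => ?_
    simp [image_image]

/-- All families `HFam` with `|X| = l` are isomorphic. -/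
lemma Config.familyIso_iff (hc : Config n k d D X) : FamilyIso n F (HFam n k D X) ↔
    ∃ D' X', Config n k d D' X' ∧ X'.card = X.card ∧ F = HFam n k D' X' := by
  constructor
  · intro h
    obtain ⟨π, hπ, h⟩ := h.symm
    rw [hc.image_HFam hπ] at h
    exact ⟨_, _, hc.image hπ, card_image_of_injective X π.injective, h.symm⟩
  · rintro ⟨D', X', hc', hX, rfl⟩
    obtain ⟨π, hπ, h⟩ := exists_perm_image_eq_of_pairwise [(D', D), (X', X)] (Icc 1 n)
      (by
        have := hc.card_D
        have := hc'.card_D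
        simp only [List.mem_cons, List.not_mem_nil, or_false, forall_eq_or_imp, forall_eq]
        exact ⟨⟨hc'.D_subset, hc.D_subset, by omega⟩, hc'.X_subset, hc.X_subset, hX⟩)
      (by simpa using ⟨hc'.disj, hc.disj⟩)
    refine ⟨π, hπ, ?_⟩
    rw [hc'.image_HFam hπ, h (D', D) (by simp), h (X', X) (by simp)]

lemma image_singleton_eq {π : Equiv.Perm ℕ} {x y : ℕ} (h : ({x} : Finset ℕ).image π = {y}) :
    π x = y := by
  simpa using h

/-- The block sizes depend only on `k` and `d`, so a permutation matches any two configurations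
block by block; `i₀` must be a block of its own inside `D`. -/
lemma GConfig.familyIso_iff {i₀ a b : ℕ} (hc : GConfig n k d D X i₀ a b) :
    FamilyIso n F (GFam n k D X i₀ a b) ↔
    ∃ D' X' i₀' a' b', GConfig n k d D' X' i₀' a' b' ∧ F = GFam n k D' X' i₀' a' b' := by
  constructor
  · intro h
    obtain ⟨π, hπ, h⟩ := h.symm
    rw [hc.image_GFam hπ] at h
    exact ⟨_, _, _, _, _, hc.image hπ, h.symm⟩
  · rintro ⟨D', X', i, a', b', hc', rfl⟩
    have e1 := card_erase_of_mem hc.i₀_mem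
    have e2 := card_erase_of_mem hc'.i₀_mem
    have e3 := hc.card_X
    have e4 := hc'.card_X
    have e5 := hc.card_D
    have e6 := hc'.card_D
    obtain ⟨π, hπ, h⟩ := exists_perm_image_eq_of_pairwise
      [({i}, {i₀}), (D'.erase i, D.erase i₀), (X', X), ({a'}, {a}), ({b'}, {b})] (Icc 1 n)
      (by
        simp only [List.mem_cons, List.not_mem_nil, or_false, forall_eq_or_imp, forall_eq,
          singleton_subset_iff, card_singleton, and_true]
        exact ⟨⟨hc'.D_subset hc'.i₀_mem, hc.D_subset hc.i₀_mem⟩,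
          ⟨(erase_subset _ _).trans hc'.D_subset, (erase_subset _ _).trans hc.D_subset, by omega⟩,
          ⟨hc'.X_subset, hc.X_subset, by omega⟩, ⟨hc'.a_mem.1, hc.a_mem.1⟩,
          hc'.b_mem.1, hc.b_mem.1⟩)
      (by
        have aux : ∀ {D X i a b}, GConfig n k d D X i a b → i ∉ X ∧ i ≠ a ∧ i ≠ b ∧
            Disjoint (D.erase i) X ∧ a ∉ D.erase i ∧ b ∉ D.erase i ∧ a ∉ X ∧ b ∉ X ∧ a ≠ b :=
          fun h => ⟨disjoint_left.1 h.disj h.i₀_mem, fun e => h.a_mem.2.1 (e ▸ h.i₀_mem),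
            fun e => h.b_mem.2.1 (e ▸ h.i₀_mem), h.disj.mono_left (erase_subset _ _),
            fun e => h.a_mem.2.1 (mem_erase.1 e).2, fun e => h.b_mem.2.1 (mem_erase.1 e).2,
            h.a_mem.2.2, h.b_mem.2.2, h.ab⟩
        obtain ⟨a1, a2, a3, a4, a5, a6, a7, a8, a9⟩ := aux hc
        obtain ⟨b1, b2, b3, b4, b5, b6, b7, b8, b9⟩ := aux hc'
        simp only [List.pairwise_cons, List.mem_cons, List.not_mem_nil, or_false,
          forall_eq_or_imp, forall_eq, disjoint_singleton_left, disjoint_singleton_right,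
          mem_singleton, notMem_erase, not_false_eq_true, true_and, and_true,
          IsEmpty.forall_iff, implies_true, List.Pairwise.nil]
        exact ⟨⟨⟨b1, a1⟩, ⟨b2, a2⟩, b3, a3⟩, ⟨⟨b4, a4⟩, ⟨b5, a5⟩, b6, a6⟩, ⟨⟨b7, a7⟩, b8, a8⟩,
          b9, a9⟩)
    have h1 := h ({i}, {i₀}) (by simp)
    have h2 := h (D'.erase i, D.erase i₀) (by simp)
    have h3 := h (X', X) (by simp)
    have h4 := h ({a'}, {a}) (by simp)
    have h5 := h ({b'}, {b}) (by simp)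
    dsimp only at h1 h2 h3 h4 h5
    have h6 : D'.image π = D := by
      rw [← insert_erase hc'.i₀_mem, image_insert, h2, image_singleton_eq h1,
        insert_erase hc.i₀_mem]
    refine ⟨π, hπ, ?_⟩
    rw [hc'.image_GFam hπ, h6, h3, image_singleton_eq h1, image_singleton_eq h4,
      image_singleton_eq h5]

lemma SConfig.familyIso_iff (hd : d = 3) {i₁ i₂ a b c : ℕ}
    (hc : SConfig n k d D X i₁ i₂ a b c) :
    FamilyIso n F (SFam n k D X i₁ i₂ a b c) ↔
    ∃ D' X' i₁' i₂' a' b' c', SConfig n k d D' X' i₁' i₂' a' b' c' ∧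
      F = SFam n k D' X' i₁' i₂' a' b' c' := by
  constructor
  · intro h
    obtain ⟨π, hπ, h⟩ := h.symm
    rw [hc.image_SFam hπ hd] at h
    exact ⟨_, _, _, _, _, _, _, hc.image hπ, h.symm⟩
  · rintro ⟨D', X', i, j, a', b', c', hc', rfl⟩
    have e3 := hc.card_X
    have e4 := hc'.card_X
    have aux : ∀ {D X i j a b c}, SConfig n k d D X i j a b c → i ∈ D ∧ j ∈ D ∧ i ∉ X ∧ j ∉ X ∧
        i ≠ a ∧ i ≠ b ∧ i ≠ c ∧ j ≠ a ∧ j ≠ b ∧ j ≠ c := by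
      intro D X i j a b c h
      have hi : i ∈ D := by simp [h.D_eq]
      have hj : j ∈ D := by simp [h.D_eq]
      have hne : ∀ u ∈ D, ∀ v, v ∉ D → u ≠ v := fun u hu v hv e => hv (e ▸ hu)
      exact ⟨hi, hj, disjoint_left.1 h.disj hi, disjoint_left.1 h.disj hj,
        hne _ hi _ h.a_mem.2.1, hne _ hi _ h.b_mem.2.1, hne _ hi _ h.c_mem.2.1,
        hne _ hj _ h.a_mem.2.1, hne _ hj _ h.b_mem.2.1, hne _ hj _ h.c_mem.2.1⟩
    obtain ⟨a1, a2, a3, a4, a5, a6, a7, a8, a9, a10⟩ := aux hc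
    obtain ⟨b1, b2, b3, b4, b5, b6, b7, b8, b9, b10⟩ := aux hc'
    obtain ⟨π, hπ, h⟩ := exists_perm_image_eq_of_pairwise
      [({i}, {i₁}), ({j}, {i₂}), (X', X), ({a'}, {a}), ({b'}, {b}), ({c'}, {c})] (Icc 1 n)
      (by
        simp only [List.mem_cons, List.not_mem_nil, or_false, forall_eq_or_imp, forall_eq,
          singleton_subset_iff, card_singleton, and_true]
        exact ⟨⟨hc'.D_subset b1, hc.D_subset a1⟩, ⟨hc'.D_subset b2, hc.D_subset a2⟩,
          ⟨hc'.X_subset, hc.X_subset, by omega⟩, ⟨hc'.a_mem.1, hc.a_mem.1⟩,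
          ⟨hc'.b_mem.1, hc.b_mem.1⟩, hc'.c_mem.1, hc.c_mem.1⟩)
      (by
        simp only [List.pairwise_cons, List.mem_cons, List.not_mem_nil, or_false,
          forall_eq_or_imp, forall_eq, disjoint_singleton_left, disjoint_singleton_right,
          mem_singleton, and_true,
          IsEmpty.forall_iff, implies_true, List.Pairwise.nil]
        exact ⟨⟨⟨hc'.i_ne, hc.i_ne⟩, ⟨b3, a3⟩, ⟨b5, a5⟩, ⟨b6, a6⟩, b7, a7⟩,
          ⟨⟨b4, a4⟩, ⟨b8, a8⟩, ⟨b9, a9⟩, b10, a10⟩,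
          ⟨⟨hc'.a_mem.2.2, hc.a_mem.2.2⟩, ⟨hc'.b_mem.2.2, hc.b_mem.2.2⟩, hc'.c_mem.2.2,
            hc.c_mem.2.2⟩, ⟨⟨hc'.ab, hc.ab⟩, hc'.ac, hc.ac⟩, hc'.bc, hc.bc⟩)
    have h1 := image_singleton_eq (h ({i}, {i₁}) (by simp))
    have h2 := image_singleton_eq (h ({j}, {i₂}) (by simp))
    have h3 := h (X', X) (by simp)
    have h4 := image_singleton_eq (h ({a'}, {a}) (by simp))
    have h5 := image_singleton_eq (h ({b'}, {b}) (by simp))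
    have h6 := image_singleton_eq (h ({c'}, {c}) (by simp))
    dsimp only at h3
    have h7 : D'.image π = D := by
      rw [hc'.D_eq, hc.D_eq, image_insert, image_singleton, h1, h2]
    refine ⟨π, hπ, ?_⟩
    rw [hc'.image_SFam hπ hd, h7, h3, h1, h2, h4, h5, h6]

/-! ### Comparison of the sizes for large `n`. -/

lemma choose_lt_choose_of_two_mul_le {N i j : ℕ} (hij : i < j) (hj : 2 * j ≤ N) :
    N.choose i < N.choose j := by
  induction j with
  | zero => omega
  | succ j ih =>
    have h1 := Nat.choose_succ_right_eq N j
    have h2 : 0 < N.choose j := Nat.choose_pos (by omega)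
    have h3 : N.choose j < N.choose (j + 1) := by
      by_contra h
      push Not at h
      have h4 : N.choose (j + 1) * (j + 1) ≤ N.choose j * (j + 1) := Nat.mul_le_mul_right _ h
      rw [h1] at h4
      have := Nat.le_of_mul_le_mul_left h4 h2
      omega
    rcases Nat.lt_succ_iff_lt_or_eq.1 hij with h | rfl
    · exact (ih h (by omega)).trans h3
    · exact h3

lemma choose_le_choose_of_two_mul_le {N i j : ℕ} (hij : i ≤ j) (hj : 2 * j ≤ N) :
    N.choose i ≤ N.choose j := by
  rcases hij.eq_or_lt with rfl | h
  · exact le_rfl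
  · exact (choose_lt_choose_of_two_mul_le h hj).le

lemma mul_choose_le_choose_succ {M N j : ℕ} (h : M * (j + 1) ≤ N + 1) :
    M * N.choose j ≤ (N + 1).choose (j + 1) := by
  have h1 := Nat.add_one_mul_choose_eq N j
  have h2 : M * (j + 1) * N.choose j ≤ (N + 1) * N.choose j := Nat.mul_le_mul_right _ h
  rw [h1] at h2
  have h3 : (M * N.choose j) * (j + 1) ≤ (N + 1).choose (j + 1) * (j + 1) := by
    calc _ = M * (j + 1) * N.choose j := by ring
      _ ≤ _ := h2
  exact Nat.le_of_mul_le_mul_right h3 (by omega)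

/-- Each of the `j` Pascal steps costs at most `C(N, q)`. -/
lemma choose_succ_le_add_mul (N q j : ℕ) (hj : j ≤ N + 1) :
    (N + 1).choose (q + 1) ≤ (N + 1 - j).choose (q + 1) + j * N.choose q := by
  induction j with
  | zero => simp
  | succ j ih =>
    have h1 := ih (by omega)
    obtain ⟨m, hm⟩ : ∃ m, N + 1 - j = m + 1 := ⟨N - j, by omega⟩
    have h2 : N + 1 - (j + 1) = m := by omega
    rw [hm, Nat.choose_succ_succ' m] at h1
    rw [h2]
    have h3 : m.choose q ≤ N.choose q := Nat.choose_le_choose q (by omega)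
    linarith

lemma starSize_succ (l : ℕ) :
    starSize n k d (l + 1) = starSize n k d l + (n - d - l).choose (k - d) :=
  sum_range_succ _ _

lemma starSize_two : starSize n k d 2 = (n - d).choose (k - d) + (n - d - 1).choose (k - d) := by
  simp [starSize, sum_range_succ]

lemma starSize_le (l : ℕ) : starSize n k d (l + 2) ≤
    starSize n k d 2 + l * (n - d - 2).choose (k - d) := by
  induction l with
  | zero => simp
  | succ l ih =>
    rw [show l + 1 + 2 = l + 2 + 1 by ring, starSize_succ]
    have : (n - d - (l + 2)).choose (k - d) ≤ (n - d - 2).choose (k - d) :=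
      Nat.choose_le_choose _ (by omega)
    linarith

lemma le_of_large (hbig : 1000 * k ^ k ≤ n) (hk : 1 ≤ k) : 1000 * k ≤ n := by
  have : k ≤ k ^ k := Nat.le_self_pow (by omega) k
  omega

/-- Families with fewer than `l` generators are smaller than `starSize n k d l`. -/
lemma lt_starSize (hd : 3 ≤ d) (hk : d + 2 ≤ k) (hbig : 1000 * k ^ k ≤ n) {m l : ℕ} (hml : m < l)
    (hl : l ≤ k) : m * (n - d).choose (k - d) + k ^ (d + 1) * (n - d - 1).choose (k - d - 1) <
      starSize n k d l := by
  have hn := le_of_large hbig (by omega)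
  obtain ⟨q, hq⟩ : ∃ q, k - d = q + 1 := ⟨k - d - 1, by omega⟩
  obtain ⟨N, hN⟩ : ∃ N, n - d = N + 1 := ⟨n - d - 1, by omega⟩
  have e1 : k - d - 1 = q := by omega
  have e2 : n - d - 1 = N := by omega
  -- Replacing every summand of the star by the first one changes it by at most `l² · C(n-d-1,
  -- k-d-1)`.
  have h1 : l * (N + 1).choose (q + 1) ≤ starSize n k d l + l * l * N.choose q := by
    have h2 : ∀ j ∈ range l, (N + 1).choose (q + 1) ≤
        (n - d - j).choose (k - d) + l * N.choose q := by
      intro j hj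
      rw [mem_range] at hj
      rw [hq, hN]
      refine (choose_succ_le_add_mul N q j (by omega)).trans ?_
      gcongr
    have h3 := sum_le_sum h2
    rw [sum_add_distrib, sum_const, sum_const, card_range, smul_eq_mul, smul_eq_mul] at h3
    rw [starSize]
    linarith
  -- One extra `C(n-d, k-d)` absorbs both the loss `l²` in the star and the `k ^ (d + 1)` leaves of
  -- the branching; this is where `n ≥ 1000 k^k` is used.
  have h2 : (l * l + k ^ (d + 1) + 1) * N.choose q ≤ (N + 1).choose (q + 1) := by
    apply mul_choose_le_choose_succ
    have f1 : k ^ 2 ≤ k ^ (d + 1) := Nat.pow_le_pow_right (by omega) (by omega)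
    have f2 : 1 ≤ k ^ (d + 1) := Nat.one_le_pow _ _ (by omega)
    have f3 : k ^ (d + 1) * k ≤ k ^ k := by
      rw [← pow_succ]
      exact Nat.pow_le_pow_right (by omega) (by omega)
    have f4 : l * l ≤ k ^ 2 := by
      rw [sq]
      exact Nat.mul_le_mul hl hl
    calc (l * l + k ^ (d + 1) + 1) * (q + 1) ≤ (3 * k ^ (d + 1)) * k :=
          Nat.mul_le_mul (by omega) (by omega)
      _ = 3 * (k ^ (d + 1) * k) := by ring
      _ ≤ 3 * k ^ k := by omega
      _ ≤ N + 1 := by omega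
  have h3 : 0 < N.choose q := Nat.choose_pos (by omega)
  rw [hN, e1, hq, show N + 1 - 1 = N by omega]
  have h4 : (m + 1) * (N + 1).choose (q + 1) ≤ l * (N + 1).choose (q + 1) :=
    Nat.mul_le_mul_right _ hml
  nlinarith

/-- For `|X| = 2` the family is generated by the `d + 1` subsets of size `d` of `D ∪ X`, so it has
at most `(d + 1)·C(n-d, k-d)` members, too few against `l ≥ d + 2` star terms. -/
lemma hSize_two_lt_starSize (hd : 3 ≤ d) (hk : d + 2 ≤ k) (hbig : 1000 * k ^ k ≤ n) {l : ℕ}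
    (hl : d + 2 ≤ l) (hlk : l ≤ k) : hSize n k d 2 < starSize n k d l := by
  refine lt_of_le_of_lt ?_ (lt_starSize hd hk hbig (m := d + 1) (by omega) hlk)
  have hn := le_of_large hbig (by omega)
  rw [hSize, starSize_two, show n + 1 - d - 2 = n - d - 1 by omega,
    show k + 2 - d - 2 = k - d by omega]
  have h1 : (n - d - 1).choose (k - d) ≤ (n - d).choose (k - d) :=
    Nat.choose_le_choose _ (by omega)
  obtain ⟨e, rfl⟩ : ∃ e, d = e + 1 := ⟨d - 1, by omega⟩
  rw [show e + 1 - 1 = e by omega]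
  generalize (n - (e + 1) - 1).choose (k - (e + 1)) = x at *
  generalize (n - (e + 1)).choose (k - (e + 1)) = y at *
  have h2 : e * x ≤ e * y := Nat.mul_le_mul_left _ h1
  calc y + x + e * x ≤ y + y + e * y := by omega
    _ = (e + 1 + 1) * y := by ring
    _ ≤ _ := Nat.le_add_right _ _

/-- With `N = n - d - 2` and `q = k - d - 1`, the star gains at most `(l - 2)·C(N, q+1)`, while
Pascal's rule splits the second part of `hSize n k d 2` into `(d-1)·C(N, q+1)` and `(d-1)·C(N, q)`.
For `l = 3` the second summands agree and strictness comes from `1 < d - 1`. -/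
lemma hSize_lt_hSize_two (hd : 3 ≤ d) (hk : d + 2 ≤ k) (hn : 1000 * k ≤ n) {l : ℕ}
    (hl3 : 3 ≤ l) (hld : l ≤ d + 1) (hlk : l + d ≤ k + 2) : hSize n k d l < hSize n k d 2 := by
  obtain ⟨m, rfl⟩ : ∃ m, l = m + 2 := ⟨l - 2, by omega⟩
  have h1 := starSize_le (n := n) (k := k) (d := d) m
  obtain ⟨q, hq⟩ : ∃ q, k - d = q + 1 := ⟨k - d - 1, by omega⟩
  obtain ⟨N, hN⟩ : ∃ N, n - d = N + 2 := ⟨n - d - 2, by omega⟩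
  obtain ⟨e, rfl⟩ : ∃ e, d = e + 1 := ⟨d - 1, by omega⟩
  rw [hSize, hSize, show n + 1 - (e + 1) - 2 = N + 1 by omega,
    show k + 2 - (e + 1) - 2 = q + 1 by omega, Nat.choose_succ_succ', show e + 1 - 1 = e by omega]
  rw [hq, show n - (e + 1) - 2 = N by omega] at h1
  have hpos : 0 < N.choose (q + 1) := Nat.choose_pos (by omega)
  by_cases hm : m = 1
  · subst hm
    rw [show n + 1 - (e + 1) - (1 + 2) = N by omega, show k + 2 - (e + 1) - (1 + 2) = q by omega]
    have : 2 * N.choose (q + 1) ≤ e * N.choose (q + 1) := Nat.mul_le_mul_right _ (by omega)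
    rw [Nat.mul_add]
    omega
  · have h2 : (n + 1 - (e + 1) - (m + 2)).choose (k + 2 - (e + 1) - (m + 2)) < N.choose q :=
      lt_of_le_of_lt (Nat.choose_le_choose _ (by omega : _ ≤ N))
        (choose_lt_choose_of_two_mul_le (by omega) (by omega))
    have h3 : m * N.choose (q + 1) ≤ e * N.choose (q + 1) := Nat.mul_le_mul_right _ (by omega)
    have h4 := Nat.mul_lt_mul_of_pos_left h2 (by omega : 0 < e)
    rw [Nat.mul_add]
    omega

lemma choose_two_mul_two (N : ℕ) : N.choose 2 * 2 = N * (N - 1) := by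
  have := Nat.choose_succ_right_eq N 1
  simpa using this

lemma choose_three_mul_three (N : ℕ) : N.choose 3 * 3 = N.choose 2 * (N - 2) :=
  Nat.choose_succ_right_eq N 2

lemma mul_choose_two_lt_choose_three {M N : ℕ} (h : 3 * M + 3 ≤ N) :
    M * N.choose 2 < N.choose 3 := by
  have h1 := choose_three_mul_three N
  have h2 : 0 < N.choose 2 := Nat.choose_pos (by omega)
  have h3 : N.choose 2 * (3 * M + 1) ≤ N.choose 2 * (N - 2) := Nat.mul_le_mul_left _ (by omega)
  nlinarith

lemma choose_add_two (N : ℕ) : (N + 2).choose 2 = N.choose 2 + (2 * N + 1) := by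
  rw [Nat.choose_succ_succ' (N + 1) 1, Nat.choose_succ_succ' N 1]
  simp
  omega

lemma mul_le_choose_two {M N : ℕ} (h : 2 * M + 1 ≤ N) : M * N ≤ N.choose 2 := by
  have h1 := choose_two_mul_two N
  have h2 : N * (2 * M) ≤ N * (N - 1) := Nat.mul_le_mul_left _ (by omega)
  nlinarith

/-- The additional star term is at least quadratic in `n`; the term lost is linear. -/
lemma hSize_lt_hSize_top (hd : 3 ≤ d) (hk : d + 2 ≤ k) (hn : 1000 * k ≤ n) :
    hSize n k d (k - d + 1) < hSize n k d (k - d + 2) := by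
  obtain ⟨N, rfl⟩ : ∃ N, n = k + 1 + N := ⟨n - k - 1, by omega⟩
  rw [hSize, hSize, starSize_succ (k - d + 1), show k + 1 + N - d - (k - d + 1) = N by omega,
    show k + 1 + N + 1 - d - (k - d + 1) = N + 1 by omega,
    show k + 2 - d - (k - d + 1) = 1 by omega, show k + 2 - d - (k - d + 2) = 0 by omega,
    Nat.choose_one_right, Nat.choose_zero_right]
  have h1 : N.choose 2 ≤ N.choose (k - d) := choose_le_choose_of_two_mul_le (by omega) (by omega)
  have h2 : d * N ≤ N.choose 2 := mul_le_choose_two (by omega)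
  obtain ⟨e, rfl⟩ : ∃ e, d = e + 1 := ⟨d - 1, by omega⟩
  rw [show e + 1 - 1 = e by omega]
  have : 0 < N := by omega
  nlinarith

/-- Pascal's rule splits the additional star term into the binomial term of `gSize` plus a positive
one, and `(d-1)(N+1)` covers the remaining `2N + 1 + (d-2)`, where `N = n - k - 1`. -/
lemma gSize_lt_hSize_top (hd : 3 ≤ d) (hk : d + 2 ≤ k) (hn : 1000 * k ≤ n) :
    gSize n k d < hSize n k d (k - d + 1) := by
  obtain ⟨N, rfl⟩ : ∃ N, n = k + 1 + N := ⟨n - k - 1, by omega⟩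
  obtain ⟨q, hq⟩ : ∃ q, k - d = q + 1 := ⟨k - d - 1, by omega⟩
  rw [hSize, gSize, starSize_succ (k - d), show k + 1 + N - d - (k - d) = N + 1 by omega,
    show k + 1 + N + 1 - d - (k - d + 1) = N + 1 by omega,
    show k + 2 - d - (k - d + 1) = 1 by omega,
    Nat.choose_one_right, show k + 1 + N - k - 1 = N by omega, hq, Nat.choose_succ_succ',
    show q + 1 - 1 = q by omega]
  have h1 : 0 < N.choose (q + 1) := Nat.choose_pos (by omega)
  obtain ⟨e, rfl⟩ : ∃ e, d = e + 3 := ⟨d - 3, by omega⟩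
  rw [show e + 3 - 1 = e + 2 by omega, show e + 3 - 2 = e + 1 by omega]
  have : e * 1 ≤ e * (N + 1) := Nat.mul_le_mul_left _ (by omega)
  rw [Nat.add_mul]
  omega

lemma hSize_eq_bot (hk : d + 2 ≤ k) (hn : 1000 * k ≤ n) :
    hSize n k d (k - d) = starSize n k d (k - d) + (d - 1) * (n - k - 1 + 2).choose 2 := by
  rw [hSize]
  congr 3 <;> omega

/-- For `k ≥ d + 3` the next star term is at least cubic and beats the quadratic second part of
`hSize n k d (k - d)`. -/
lemma hSize_bot_lt_hSize_top (hd : 3 ≤ d) (hk : d + 3 ≤ k) (hn : 1000 * k ≤ n) :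
    hSize n k d (k - d) < hSize n k d (k - d + 1) := by
  rw [hSize_eq_bot (by omega) hn]
  obtain ⟨N, rfl⟩ : ∃ N, n = k + 1 + N := ⟨n - k - 1, by omega⟩
  rw [hSize, starSize_succ (k - d), show k + 1 + N - d - (k - d) = N + 1 by omega,
    show k + 1 + N + 1 - d - (k - d + 1) = N + 1 by omega,
    show k + 2 - d - (k - d + 1) = 1 by omega,
    Nat.choose_one_right, show k + 1 + N - k - 1 = N by omega, Nat.choose_succ_succ' (N + 1),
    Nat.choose_one_right]
  have h1 : (N + 1).choose 3 ≤ (N + 1).choose (k - d) :=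
    choose_le_choose_of_two_mul_le (by omega) (by omega)
  have h2 : (d - 1) * (N + 1).choose 2 < (N + 1).choose 3 :=
    mul_choose_two_lt_choose_three (by omega)
  rw [Nat.mul_add]
  simp only [Nat.reduceAdd] at *
  omega

/-- `C(n-k-1, k-d-1)` is at least cubic here, against the quadratic `(d-1)·C(n-k+1, 2)`. -/
lemma hSize_bot_lt_gSize (hd : 3 ≤ d) (hk : d + 4 ≤ k) (hn : 1000 * k ≤ n) :
    hSize n k d (k - d) < gSize n k d := by
  rw [hSize_eq_bot (by omega) hn, gSize]
  obtain ⟨N, rfl⟩ : ∃ N, n = k + 1 + N := ⟨n - k - 1, by omega⟩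
  rw [show k + 1 + N - k - 1 = N by omega, choose_add_two]
  have h1 : N.choose 3 ≤ N.choose (k - d - 1) :=
    choose_le_choose_of_two_mul_le (by omega) (by omega)
  have h2 : (2 * (d - 1)) * N.choose 2 < N.choose 3 := mul_choose_two_lt_choose_three (by omega)
  have h3 : 3 * N ≤ N.choose 2 := mul_le_choose_two (by omega)
  have h4 : (d - 1) * (N.choose 2 + (2 * N + 1)) ≤ (d - 1) * (2 * N.choose 2) :=
    Nat.mul_le_mul_left _ (by omega)
  have h5 : (d - 1) * (2 * N.choose 2) = (2 * (d - 1)) * N.choose 2 := by ring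
  omega

/-- At `k = d + 3` both excesses over the star are quadratic and the order is reversed: that of
`gSize` is `C(n-k+1, 2) + (d-2)`, against `(d-1)·C(n-k+1, 2)`. -/
lemma gSize_lt_hSize_bot (hd : 3 ≤ d) (hk : k = d + 3) (hn : 1000 * k ≤ n) :
    gSize n k d < hSize n k d (k - d) := by
  rw [hSize_eq_bot (by omega) hn, gSize]
  obtain ⟨N, rfl⟩ : ∃ N, n = k + 1 + N := ⟨n - k - 1, by omega⟩
  rw [show k + 1 + N - k - 1 = N by omega, choose_add_two, show k - d - 1 = 2 by omega]
  obtain ⟨e, rfl⟩ : ∃ e, d = e + 3 := ⟨d - 3, by omega⟩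
  rw [show e + 3 - 1 = e + 2 by omega, show e + 3 - 2 = e + 1 by omega]
  have : e * 1 ≤ e * (N.choose 2 + (2 * N + 1)) := Nat.mul_le_mul_left _ (by omega)
  rw [Nat.add_mul]
  omega

/-- The `k - d - 2 ≤ d - 1` star terms after the second are absorbed by one half of the Pascal
splitting of `hSize n k d 2`; the other half absorbs the remaining terms of `gSize`. -/
lemma gSize_lt_hSize_two (hd : 3 ≤ d) (hk : d + 4 ≤ k) (hk2 : k ≤ 2 * d + 1)
    (hn : 1000 * k ≤ n) : gSize n k d < hSize n k d 2 := by
  obtain ⟨m, hm⟩ : ∃ m, k - d = m + 2 := ⟨k - d - 2, by omega⟩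
  have h1 := starSize_le (n := n) (k := k) (d := d) m
  obtain ⟨N, hN⟩ : ∃ N, n - d = N + 2 := ⟨n - d - 2, by omega⟩
  rw [hSize, gSize, show n + 1 - d - 2 = N + 1 by omega,
    show k + 2 - d - 2 = m + 1 + 1 by omega, Nat.choose_succ_succ', hm,
    show m + 2 - 1 = m + 1 by omega]
  rw [hm, show n - d - 2 = N by omega] at h1
  have h2 : (n - k - 1).choose (m + 1) ≤ N.choose (m + 1) := Nat.choose_le_choose _ (by omega)
  have h3 : N.choose 2 < N.choose (m + 1) := choose_lt_choose_of_two_mul_le (by omega) (by omega)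
  have h4 : 3 * N ≤ N.choose 2 := mul_le_choose_two (by omega)
  have h5 : m * N.choose (m + 2) ≤ (d - 1) * N.choose (m + 2) := Nat.mul_le_mul_right _ (by omega)
  have h6 : 2 * N.choose (m + 1) ≤ (d - 1) * N.choose (m + 1) := Nat.mul_le_mul_right _ (by omega)
  rw [Nat.mul_add]
  simp only [add_assoc, Nat.reduceAdd] at *
  omega

lemma sSize_lt_gSize (hk : 5 ≤ k) (hn : 1000 * k ≤ n) : sSize n k < gSize n k 3 := by
  rw [sSize, gSize]
  obtain ⟨N, rfl⟩ : ∃ N, n = k + 2 + N := ⟨n - k - 2, by omega⟩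
  obtain ⟨q, rfl⟩ : ∃ q, k = q + 5 := ⟨k - 5, by omega⟩
  rw [show q + 5 + 2 + N - (q + 5) - 2 = N by omega, show q + 5 - 5 = q by omega,
    show q + 5 + 2 + N - (q + 5) - 1 = N + 1 by omega, show q + 5 - 3 - 1 = q + 1 by omega,
    Nat.choose_succ_succ']
  omega

/-- From `k ≥ 8` on, `C(n-k-2, k-5)` is at least cubic. -/
lemma hSize_bot_lt_sSize (hk : 8 ≤ k) (hn : 1000 * k ≤ n) : hSize n k 3 (k - 3) < sSize n k := by
  rw [hSize_eq_bot (by omega) hn, sSize]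
  obtain ⟨N, rfl⟩ : ∃ N, n = k + 2 + N := ⟨n - k - 2, by omega⟩
  rw [show k + 2 + N - k - 2 = N by omega, show k + 2 + N - k - 1 + 2 = N + 1 + 2 by omega,
    choose_add_two, Nat.choose_succ_succ' N 1, Nat.choose_one_right]
  have h1 : N.choose 3 ≤ N.choose (k - 5) :=
    choose_le_choose_of_two_mul_le (by omega) (by omega)
  have h2 : 10 * N.choose 2 < N.choose 3 := mul_choose_two_lt_choose_three (by omega)
  have h3 : 3 * N ≤ N.choose 2 := mul_le_choose_two (by omega)
  simp only [Nat.reduceAdd] at *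
  omega

/-- Only this weak consequence of the bound on `n` is needed. It follows from `k^(k-d) - 1 ≥ 4k` and
`4^k ≥ 4^5 > 1000`, as `k ≥ 5`. -/
lemma large_of_nOne_lt (hd : 3 ≤ d) (hk : d + 2 ≤ k) (hn : nOne k d < n) : 1000 * k ^ k ≤ n := by
  have h1 : 4 * k ≤ k ^ (k - d) - 1 := by
    have h2 : k ^ 2 ≤ k ^ (k - d) := Nat.pow_le_pow_right (by omega) (by omega)
    have h3 : 5 * k ≤ k ^ 2 := by nlinarith
    omega
  have h2 : (4 * k) ^ k ≤ (k ^ (k - d) - 1) ^ k := Nat.pow_le_pow_left h1 k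
  have h3 : 4 ^ 5 ≤ 4 ^ k := Nat.pow_le_pow_right (by omega) (by omega)
  have h4 : 1000 * k ^ k ≤ (4 * k) ^ k := by
    rw [mul_pow]
    exact Nat.mul_le_mul_right _ (by omega)
  have h5 : 1 ≤ 2 * (k - d) ^ 2 := by
    have : 0 < (k - d) ^ 2 := pow_pos (by omega) 2
    omega
  have h6 : 1 ≤ k.factorial := Nat.factorial_pos k
  have h7 : (k ^ (k - d) - 1) ^ k ≤ 2 * (k - d) ^ 2 * (k ^ (k - d) - 1) ^ k :=
    Nat.le_mul_of_pos_left _ h5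
  have h8 := Nat.le_mul_of_pos_right (2 * (k - d) ^ 2 * (k ^ (k - d) - 1) ^ k) h6
  rw [nOne] at hn
  omega

/-! ### The explicit families on intervals as instances of the models. -/

lemma exists_eq_union_singleton {A T : Finset ℕ} (hA : A ∈ kSubsets n k) (hT : T ⊆ A)
    (hc : T.card + 1 = k) : ∃ i ∈ Icc 1 n, i ∉ T ∧ A = T ∪ {i} := by
  rw [mem_kSubsets] at hA
  have h1 := card_sdiff_of_subset hT
  obtain ⟨i, hi⟩ := card_eq_one.1 (by omega : (A \ T).card = 1)
  have hiA : i ∈ A \ T := by simp [hi]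
  rw [mem_sdiff] at hiA
  exact ⟨i, hA.1 hiA.1, hiA.2, by rw [← hi, union_sdiff_of_subset hT]⟩

lemma union_singleton_mem_kSubsets {T : Finset ℕ} {i : ℕ} (hT : T ⊆ Icc 1 n)
    (hi : i ∈ Icc 1 n) (hiT : i ∉ T) (hc : T.card + 1 = k) : T ∪ {i} ∈ kSubsets n k := by
  rw [mem_kSubsets, card_union_of_disjoint (disjoint_singleton_right.2 hiT), card_singleton]
  exact ⟨union_subset hT (singleton_subset_iff.2 hi), hc⟩

lemma card_inter_eq_iff {A : Finset ℕ} (hd : 2 ≤ d) :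
    (Icc 1 (d - 1) ∩ A).card = d - 2 ↔ ∃ i, Icc 1 (d - 1) \ A = {i} := by
  have h1 := card_sdiff_add_card_inter (Icc 1 (d - 1)) A
  rw [Nat.card_Icc] at h1
  rw [← card_eq_one]
  omega

lemma config_Icc (hd : 3 ≤ d) (hk : d + 2 ≤ k) (hn : 4 * k ≤ n) {l : ℕ} (hl : 2 ≤ l)
    (hlk : l + d ≤ k + 2) : Config n k d (Icc 1 (d - 1)) (Icc d (d + l - 1)) where
  three_le := hd
  lt := hk
  large := hn
  D_subset := Icc_subset_Icc le_rfl (by omega)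
  X_subset := Icc_subset_Icc (by omega) (by omega)
  disj := disjoint_left.2 fun x hx hx' => by
    rw [mem_Icc] at hx hx'
    omega
  card_D := by
    rw [Nat.card_Icc]
    omega
  two_le := by
    rw [Nat.card_Icc]
    omega
  card_le := by
    rw [Nat.card_Icc]
    omega

lemma gConfig_Icc (hd : 3 ≤ d) (hk : d + 2 ≤ k) (hn : 4 * k ≤ n) :
    GConfig n k d (Icc 1 (d - 1)) (Icc d (k - 1)) 1 k (k + 1) := by
  have h := config_Icc hd hk hn (l := k - d) (by omega) (by omega)
  rw [show d + (k - d) - 1 = k - 1 by omega] at h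
  refine ⟨h, ?_, ?_, ?_, ?_, by omega⟩
  · rw [Nat.card_Icc]
    omega
  all_goals
    simp only [mem_Icc]
    omega

lemma sConfig_Icc (hk : 5 ≤ k) (hn : 4 * k ≤ n) :
    SConfig n k 3 (Icc 1 2) (Icc 3 (k - 1)) 1 2 k (k + 1) (k + 2) := by
  have h := config_Icc (le_refl 3) hk hn (l := k - 3) (by omega) (by omega)
  rw [show 3 + (k - 3) - 1 = k - 1 by omega] at h
  refine ⟨h, ?_, rfl, by omega, ?_, ?_, ?_, by omega, by omega, by omega⟩
  · rw [Nat.card_Icc]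
    omega
  all_goals
    simp only [mem_Icc]
    omega

lemma familyH_eq_HFam (hd : 2 ≤ d) (l : ℕ) :
    familyH n k d l = HFam n k (Icc 1 (d - 1)) (Icc d (d + l - 1)) := by
  ext A
  simp only [familyH, mem_union, mem_filter, mem_HFam, card_inter_eq_iff hd,
    ← nonempty_iff_ne_empty, exists_and_right]
  tauto

lemma familyG_eq_GFam (hd : 3 ≤ d) (hk : d + 2 ≤ k) (hn : 4 * k ≤ n) :
    familyG n k d = GFam n k (Icc 1 (d - 1)) (Icc d (k - 1)) 1 k (k + 1) := by
  have hmiss : ∀ A : Finset ℕ, (Icc 1 (d - 1) \ A = {1} ∧ Icc d (k - 1) ⊆ A) ↔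
      1 ∉ A ∧ Icc 2 (k - 1) ⊆ A := by
    intro A
    rw [sdiff_eq_singleton_iff]
    simp only [subset_iff, mem_erase, mem_Icc]
    constructor
    · rintro ⟨⟨-, h1, h2⟩, h3⟩
      refine ⟨h1, fun x hx => ?_⟩
      by_cases hxd : x ≤ d - 1
      · exact h2 (by omega)
      · exact h3 (by omega)
    · rintro ⟨h1, h2⟩
      exact ⟨⟨by omega, h1, fun x hx => h2 (by omega)⟩, fun x hx => h2 (by omega)⟩
  have hc1 : (Icc 2 k).card + 1 = k := by
    rw [Nat.card_Icc]
    omega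
  have hc2 : (insert (k + 1) (Icc 2 (k - 1))).card + 1 = k := by
    rw [card_insert_of_notMem (by simp), Nat.card_Icc]
    omega
  have hs1 : Icc 2 k ⊆ Icc 1 n := Icc_subset_Icc (by omega) (by omega)
  have hs2 : insert (k + 1) (Icc 2 (k - 1)) ⊆ Icc 1 n :=
    insert_subset (mem_Icc.2 (by omega)) (Icc_subset_Icc (by omega) (by omega))
  have hu : ∀ i, Icc 2 (k - 1) ∪ {k + 1, i} = insert (k + 1) (Icc 2 (k - 1)) ∪ {i} := by
    intro i
    ext x
    simp only [mem_union, mem_insert, mem_singleton]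
    tauto
  have hfull : ∀ A : Finset ℕ, Icc d (k + 1) ⊆ A ↔ Icc d (k - 1) ⊆ A ∧ k ∈ A ∧ k + 1 ∈ A := by
    intro A
    simp only [subset_iff, mem_Icc]
    constructor
    · intro h
      exact ⟨fun x hx => h (by omega), h (by omega), h (by omega)⟩
    · rintro ⟨h1, h2, h3⟩ x hx
      rcases (by omega : x ≤ k - 1 ∨ x = k ∨ x = k + 1) with h | rfl | rfl
      · exact h1 (by omega)
      · exact h2
      · exact h3
  have hpair : ∀ A : Finset ℕ, Icc k (k + 1) ⊆ A ↔ k ∈ A ∧ k + 1 ∈ A := by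
    intro A
    simp only [subset_iff, mem_Icc]
    constructor
    · intro h
      exact ⟨h (by omega), h (by omega)⟩
    · rintro ⟨h2, h3⟩ x hx
      rcases (by omega : x = k ∨ x = k + 1) with rfl | rfl <;> assumption
  ext A
  simp only [familyG, mem_union, mem_filter, mem_image, mem_GFam, card_inter_eq_iff (show 2 ≤ d by omega),
    ← nonempty_iff_ne_empty, hu, union_subset_iff, hfull, hpair]
  constructor
  · rintro ((((h | ⟨i, hi, rfl⟩) | h) | ⟨i, hi, rfl⟩) | h)
    · exact ⟨h.1, Or.inl ⟨h.2.1, Or.inl h.2.2⟩⟩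
    · rw [mem_Icc] at hi
      refine ⟨union_singleton_mem_kSubsets hs1 (by rw [mem_Icc]; omega)
        (by rw [mem_Icc]; omega) hc1, Or.inr (Or.inl ?_)⟩
      rw [← and_assoc, hmiss]
      refine ⟨⟨?_, ?_⟩, Or.inl ?_⟩
      · simp only [mem_union, mem_Icc, mem_singleton]
        omega
      · exact (Icc_subset_Icc le_rfl (by omega)).trans subset_union_left
      · simp only [mem_union, mem_Icc, mem_singleton]
        omega
    · exact ⟨h.1, Or.inl ⟨h.2.1, Or.inr h.2.2⟩⟩
    · rw [mem_Icc] at hi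
      refine ⟨union_singleton_mem_kSubsets hs2 (by rw [mem_Icc]; omega)
        (by rw [mem_insert, mem_Icc]; omega) hc2, Or.inr (Or.inl ?_)⟩
      rw [← and_assoc, hmiss]
      refine ⟨⟨?_, (subset_insert _ _).trans subset_union_left⟩, Or.inr (by simp)⟩
      simp only [mem_union, mem_insert, mem_Icc, mem_singleton]
      omega
    · obtain ⟨hA, ⟨i, hi⟩, h⟩ := h
      exact ⟨hA, Or.inr (Or.inr ⟨i, hi, h⟩)⟩
  · rintro ⟨hA, ⟨h, h' | h'⟩ | ⟨h1, h2, h3⟩ | ⟨i, h⟩⟩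
    · exact Or.inl (Or.inl (Or.inl (Or.inl ⟨hA, h, h'⟩)))
    · exact Or.inl (Or.inl (Or.inr ⟨hA, h, h'⟩))
    · by_cases hboth : k ∈ A ∧ k + 1 ∈ A
      -- A set missing `1` that contains both `k` and `k + 1` belongs to the last piece; the two
      -- image families hold those with exactly one of them, which is why their index starts at `k +
      -- 2`.
      · exact Or.inr ⟨hA, ⟨1, h1⟩, h2, hboth⟩
      obtain ⟨h4, h5⟩ := (hmiss A).1 ⟨h1, h2⟩
      by_cases hkA : k ∈ A
      · have hsub : Icc 2 k ⊆ A := by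
          intro x hx
          rw [mem_Icc] at hx
          rcases (by omega : x ≤ k - 1 ∨ x = k) with h | rfl
          · exact h5 (by rw [mem_Icc]; omega)
          · exact hkA
        obtain ⟨i, hi, hi', rfl⟩ := exists_eq_union_singleton hA hsub hc1
        refine Or.inl (Or.inl (Or.inl (Or.inr ⟨i, ?_, rfl⟩)))
        rw [mem_Icc] at hi hi' ⊢
        have e1 : i ≠ 1 := by
          rintro rfl
          exact h4 (by simp)
        have e2 : i ≠ k + 1 := by
          rintro rfl
          exact hboth ⟨hkA, by simp⟩
        omega
      · have hk1 : k + 1 ∈ A := h3.resolve_left hkA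
        obtain ⟨i, hi, hi', rfl⟩ := exists_eq_union_singleton hA (insert_subset hk1 h5) hc2
        refine Or.inl (Or.inr ⟨i, ?_, rfl⟩)
        rw [mem_insert, mem_Icc] at hi'
        rw [mem_Icc] at hi ⊢
        have e1 : i ≠ 1 := by
          rintro rfl
          exact h4 (by simp)
        have e2 : i ≠ k := by
          rintro rfl
          exact hkA (by simp)
        omega
    · exact Or.inr ⟨hA, ⟨i, h.1⟩, h.2⟩

lemma familyS₁_eq_SFam (hk : 5 ≤ k) (hn : 4 * k ≤ n) :
    familyS₁ n k = SFam n k (Icc 1 2) (Icc 3 (k - 1)) 1 2 k (k + 1) (k + 2) := by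
  have hmiss₁ : ∀ A : Finset ℕ, (Icc 1 2 \ A = {1} ∧ Icc 3 (k - 1) ⊆ A) ↔
      1 ∉ A ∧ Icc 2 (k - 1) ⊆ A := by
    intro A
    rw [sdiff_eq_singleton_iff]
    simp only [subset_iff, mem_erase, mem_Icc]
    constructor
    · rintro ⟨⟨-, h1, h2⟩, h3⟩
      refine ⟨h1, fun x hx => ?_⟩
      by_cases hxd : x ≤ 2
      · exact h2 (by omega)
      · exact h3 (by omega)
    · rintro ⟨h1, h2⟩
      exact ⟨⟨by omega, h1, fun x hx => h2 (by omega)⟩, fun x hx => h2 (by omega)⟩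
  have hmiss₂ : ∀ A : Finset ℕ, (Icc 1 2 \ A = {2} ∧ Icc 3 (k - 1) ⊆ A) ↔
      2 ∉ A ∧ (Icc 1 (k - 1)).erase 2 ⊆ A := by
    intro A
    rw [sdiff_eq_singleton_iff]
    simp only [subset_iff, mem_erase, mem_Icc]
    constructor
    · rintro ⟨⟨-, h1, h2⟩, h3⟩
      refine ⟨h1, fun x hx => ?_⟩
      by_cases hxd : x ≤ 2
      · exact h2 (by omega)
      · exact h3 (by omega)
    · rintro ⟨h1, h2⟩
      exact ⟨⟨by omega, h1, fun x hx => h2 (by omega)⟩, fun x hx => h2 (by omega)⟩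
  have hc1 : (Icc 2 k).card + 1 = k := by
    rw [Nat.card_Icc]
    omega
  have hs1 : Icc 2 k ⊆ Icc 1 n := Icc_subset_Icc (by omega) (by omega)
  have hpair : ∀ A : Finset ℕ, Icc k (k + 2) ⊆ A ↔ k ∈ A ∧ k + 1 ∈ A ∧ k + 2 ∈ A := by
    intro A
    simp only [subset_iff, mem_Icc]
    constructor
    · intro h
      exact ⟨h (by omega), h (by omega), h (by omega)⟩
    · rintro ⟨h2, h3, h4⟩ x hx
      rcases (by omega : x = k ∨ x = k + 1 ∨ x = k + 2) with rfl | rfl | rfl <;> assumption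
  have hk1 : Icc 2 (k + 2) \ {k} ∈ kSubsets n k := by
    rw [mem_kSubsets, card_sdiff_of_subset (by simp; omega), Nat.card_Icc, card_singleton]
    exact ⟨sdiff_subset.trans (Icc_subset_Icc (by omega) (by omega)), by omega⟩
  have hk2 : Icc 1 (k + 1) \ {2} ∈ kSubsets n k := by
    rw [mem_kSubsets, card_sdiff_of_subset (by simp; omega), Nat.card_Icc, card_singleton]
    exact ⟨sdiff_subset.trans (Icc_subset_Icc (by omega) (by omega)), by omega⟩
  have hk3 : Icc 1 (k + 2) \ {2, k + 1} ∈ kSubsets n k := by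
    rw [mem_kSubsets, card_sdiff_of_subset (by simp [insert_subset_iff]), Nat.card_Icc,
      card_pair (by omega)]
    exact ⟨sdiff_subset.trans (Icc_subset_Icc (by omega) (by omega)), by omega⟩
  -- The three exceptional sets have size `k`, so it suffices to find them inside `A`.
  have heq : ∀ A B : Finset ℕ, A ∈ kSubsets n k → B ∈ kSubsets n k → B ⊆ A → A = B := by
    intro A B hA hB hBA
    rw [mem_kSubsets] at hA hB
    exact (eq_of_subset_of_card_le hBA (by omega)).symm
  ext A
  simp only [familyS₁, mem_union, mem_filter, mem_image, mem_SFam, mem_insert, mem_singleton,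
    ← nonempty_iff_ne_empty, union_subset_iff, hpair]
  constructor
  · rintro (((h | h) | ⟨i, hi, rfl⟩) | rfl | rfl | rfl)
    · exact ⟨h.1, Or.inl ⟨h.2.1, Or.inl h.2.2⟩⟩
    · exact ⟨h.1, Or.inl ⟨h.2.1, Or.inr h.2.2⟩⟩
    · rw [mem_Icc] at hi
      refine ⟨union_singleton_mem_kSubsets hs1 (by rw [mem_Icc]; omega)
        (by rw [mem_Icc]; omega) hc1, Or.inr (Or.inl ?_)⟩
      rw [← and_assoc, hmiss₁]
      refine ⟨⟨?_, ?_⟩, Or.inl ?_⟩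
      · simp only [mem_union, mem_Icc, mem_singleton]
        omega
      · exact (Icc_subset_Icc le_rfl (by omega)).trans subset_union_left
      · simp only [mem_union, mem_Icc, mem_singleton]
        omega
    · refine ⟨hk1, Or.inr (Or.inl ?_)⟩
      rw [← and_assoc, hmiss₁]
      simp only [subset_iff, mem_sdiff, mem_Icc, mem_singleton]
      exact ⟨⟨by omega, fun x hx => by omega⟩, by omega⟩
    · refine ⟨hk2, Or.inr (Or.inr ?_)⟩
      rw [← and_assoc, hmiss₂]
      simp only [subset_iff, mem_sdiff, mem_Icc, mem_singleton, mem_erase]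
      exact ⟨⟨by simp, fun x hx => by omega⟩, by omega⟩
    · refine ⟨hk3, Or.inr (Or.inr ?_)⟩
      rw [← and_assoc, hmiss₂]
      simp only [subset_iff, mem_sdiff, mem_Icc, mem_singleton, mem_erase, mem_insert]
      exact ⟨⟨by simp, fun x hx => by omega⟩, by omega⟩
  · rintro ⟨hA, ⟨h, h' | h'⟩ | ⟨h1, h2, h3⟩ | ⟨h1, h2, h3⟩⟩
    · exact Or.inl (Or.inl (Or.inl ⟨hA, h, h'⟩))
    · exact Or.inl (Or.inl (Or.inr ⟨hA, h, h'⟩))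
    · obtain ⟨h4, h5⟩ := (hmiss₁ A).1 ⟨h1, h2⟩
      by_cases hkA : k ∈ A
      · have hsub : Icc 2 k ⊆ A := by
          intro x hx
          rw [mem_Icc] at hx
          rcases (by omega : x ≤ k - 1 ∨ x = k) with h | rfl
          · exact h5 (by rw [mem_Icc]; omega)
          · exact hkA
        obtain ⟨i, hi, hi', rfl⟩ := exists_eq_union_singleton hA hsub hc1
        refine Or.inl (Or.inr ⟨i, ?_, rfl⟩)
        rw [mem_Icc] at hi hi' ⊢
        have e1 : i ≠ 1 := by
          rintro rfl
          exact h4 (by simp)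
        omega
      · have h6 := h3.resolve_left hkA
        refine Or.inr (Or.inl (heq _ _ hA hk1 fun x hx => ?_))
        rw [mem_sdiff, mem_Icc, mem_singleton] at hx
        rcases (by omega : x ≤ k - 1 ∨ x = k + 1 ∨ x = k + 2) with h | rfl | rfl
        · exact h5 (by rw [mem_Icc]; omega)
        · exact h6.1
        · exact h6.2
    · obtain ⟨h4, h5⟩ := (hmiss₂ A).1 ⟨h1, h2⟩
      rcases h3 with ⟨h6, h7 | h7⟩
      · refine Or.inr (Or.inr (Or.inl (heq _ _ hA hk2 fun x hx => ?_)))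
        rw [mem_sdiff, mem_Icc, mem_singleton] at hx
        rcases (by omega : x ≤ k - 1 ∨ x = k ∨ x = k + 1) with h | rfl | rfl
        · exact h5 (by rw [mem_erase, mem_Icc]; omega)
        · exact h6
        · exact h7
      · refine Or.inr (Or.inr (Or.inr (heq _ _ hA hk3 fun x hx => ?_)))
        rw [mem_sdiff, mem_Icc, mem_insert, mem_singleton] at hx
        rcases (by omega : x ≤ k - 1 ∨ x = k ∨ x = k + 2) with h | rfl | rfl
        · exact h5 (by rw [mem_erase, mem_Icc]; omega)
        · exact h6
        · exact h7

/-! ### Ranking the sizes and the final case distinction. -/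

/-- The possible sizes of maximal families. -/
lemma IsMaxNontrivial.size_cases (hF : IsMaxNontrivial n k d F) (hd : 3 ≤ d) (hk : d + 2 ≤ k)
    (hbig : 1000 * k ^ k ≤ n) :
    (∃ l, (l = 2 ∨ l = k - d ∨ l = k - d + 1 ∨ l = k - d + 2) ∧ F.card = hSize n k d l ∧
      ∃ D X, Config n k d D X ∧ X.card = l ∧ F = HFam n k D X) ∨
    (F.card = gSize n k d ∧ ∃ D X i₀ a b, GConfig n k d D X i₀ a b ∧ F = GFam n k D X i₀ a b) ∨
    (d = 3 ∧ F.card = sSize n k ∧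
      ∃ D X i₁ i₂ a b c, SConfig n k d D X i₁ i₂ a b c ∧ F = SFam n k D X i₁ i₂ a b c) ∨
    (d = 3 ∧ F.card < sSize n k) ∨ F.card < starSize n k d (k - d) := by
  have hn := le_of_large hbig (by omega)
  by_cases hg : k ≤ (generators n k d F).card + d
  · rcases hF.isStructured hd hk (by omega) hg with ⟨D, X, hc, hX, rfl⟩ | ⟨D, X, i, a, b, hc, rfl⟩ |
      ⟨hd3, D, X, i, j, a, b, c, hc, rfl⟩ | ⟨rfl, h⟩
    · have := hc.card_le
      exact Or.inl ⟨X.card, by omega, hc.card_HFam, D, X, hc, rfl, rfl⟩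
    · exact Or.inr (Or.inl ⟨hc.card_GFam, D, X, i, a, b, hc, rfl⟩)
    · exact Or.inr (Or.inr (Or.inl ⟨hd3, hc.card_SFam hd3, D, X, i, j, a, b, c, hc, rfl⟩))
    · refine Or.inr (Or.inr (Or.inr (Or.inl ⟨rfl, ?_⟩)))
      rw [sSize]
      omega
  · have h1 := hF.card_le (by omega) (by omega) (by omega)
    have h2 := lt_starSize hd hk hbig (m := (generators n k d F).card) (l := k - d) (by omega)
      (by omega)
    exact Or.inr (Or.inr (Or.inr (Or.inr (by omega))))

/-- A family of one of the three top sizes has at most two larger sizes above it, and one smaller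
than `t` has at least four: the three and `t` itself. -/
lemma isNthLargest_four_iff {s₁ s₂ s₃ t : ℕ}
    (h₁ : ∃ F', IsMaxNontrivial n k d F' ∧ F'.card = s₁)
    (h₂ : ∃ F', IsMaxNontrivial n k d F' ∧ F'.card = s₂)
    (h₃ : ∃ F', IsMaxNontrivial n k d F' ∧ F'.card = s₃)
    (ht : ∃ F', IsMaxNontrivial n k d F' ∧ F'.card = t)
    (h12 : s₁ ≠ s₂) (h13 : s₁ ≠ s₃) (h23 : s₂ ≠ s₃) (ht₁ : t < s₁) (ht₂ : t < s₂) (ht₃ : t < s₃)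
    (hall : ∀ F', IsMaxNontrivial n k d F' →
      F'.card = s₁ ∨ F'.card = s₂ ∨ F'.card = s₃ ∨ F'.card ≤ t) :
    IsNthLargest 4 n k d F ↔ IsMaxNontrivial n k d F ∧ F.card = t := by
  unfold IsNthLargest
  refine and_congr_right fun hF => ?_
  generalize hS : {m : ℕ | F.card < m ∧ ∃ F', IsMaxNontrivial n k d F' ∧ F'.card = m} = S
  have hmem : ∀ m, m ∈ S ↔ F.card < m ∧ ∃ F', IsMaxNontrivial n k d F' ∧ F'.card = m := by
    intro m
    rw [← hS]
    rfl
  have hcard3 : ({s₁, s₂, s₃} : Finset ℕ).card = 3 := card_eq_three.2 ⟨_, _, _, h12, h13, h23, rfl⟩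
  constructor
  · intro h
    -- `ncard` is `0` on infinite sets, so the value `3` certifies finiteness.
    have hfin : S.Finite := Set.finite_of_ncard_ne_zero (by omega)
    rcases hall F hF with h' | h' | h' | h'
    · exfalso
      have hsub : S ⊆ (({s₂, s₃} : Finset ℕ) : Set ℕ) := by
        intro m hm
        obtain ⟨h4, F', hF', rfl⟩ := (hmem m).1 hm
        have := hall F' hF'
        simp only [coe_insert, coe_singleton, Set.mem_insert_iff, Set.mem_singleton_iff]
        omega
      have h5 := Set.ncard_le_ncard hsub (Finset.finite_toSet _)
      rw [Set.ncard_coe_finset] at h5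
      have := card_le_two (a := s₂) (b := s₃)
      omega
    · exfalso
      have hsub : S ⊆ (({s₁, s₃} : Finset ℕ) : Set ℕ) := by
        intro m hm
        obtain ⟨h4, F', hF', rfl⟩ := (hmem m).1 hm
        have := hall F' hF'
        simp only [coe_insert, coe_singleton, Set.mem_insert_iff, Set.mem_singleton_iff]
        omega
      have h5 := Set.ncard_le_ncard hsub (Finset.finite_toSet _)
      rw [Set.ncard_coe_finset] at h5
      have := card_le_two (a := s₁) (b := s₃)
      omega
    · exfalso
      have hsub : S ⊆ (({s₁, s₂} : Finset ℕ) : Set ℕ) := by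
        intro m hm
        obtain ⟨h4, F', hF', rfl⟩ := (hmem m).1 hm
        have := hall F' hF'
        simp only [coe_insert, coe_singleton, Set.mem_insert_iff, Set.mem_singleton_iff]
        omega
      have h5 := Set.ncard_le_ncard hsub (Finset.finite_toSet _)
      rw [Set.ncard_coe_finset] at h5
      have := card_le_two (a := s₁) (b := s₂)
      omega
    · by_contra hne
      have hsub : ((insert t {s₁, s₂, s₃} : Finset ℕ) : Set ℕ) ⊆ S := by
        intro m hm
        simp only [coe_insert, coe_singleton, Set.mem_insert_iff, Set.mem_singleton_iff] at hm
        rw [hmem]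
        rcases hm with rfl | rfl | rfl | rfl
        · exact ⟨by omega, ht⟩
        · exact ⟨by omega, h₁⟩
        · exact ⟨by omega, h₂⟩
        · exact ⟨by omega, h₃⟩
      have h5 := Set.ncard_le_ncard hsub hfin
      rw [Set.ncard_coe_finset, card_insert_of_notMem, hcard3] at h5
      · omega
      · simp only [mem_insert, mem_singleton]
        omega
  · intro h
    have : S = (({s₁, s₂, s₃} : Finset ℕ) : Set ℕ) := by
      ext m
      rw [hmem]
      simp only [coe_insert, coe_singleton, Set.mem_insert_iff, Set.mem_singleton_iff]
      constructor
      · rintro ⟨h4, F', hF', rfl⟩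
        have := hall F' hF'
        omega
      · rintro (rfl | rfl | rfl)
        · exact ⟨by omega, h₁⟩
        · exact ⟨by omega, h₂⟩
        · exact ⟨by omega, h₃⟩
    rw [this, Set.ncard_coe_finset, hcard3]

lemma exists_card_eq_hSize (hd : 3 ≤ d) (hk : d + 2 ≤ k) (hn : 4 * k ≤ n) {l : ℕ} (hl : 2 ≤ l)
    (hlk : l + d ≤ k + 2) : ∃ F', IsMaxNontrivial n k d F' ∧ F'.card = hSize n k d l := by
  have hc := config_Icc hd hk hn hl hlk
  refine ⟨_, hc.isMaxNontrivial_HFam, ?_⟩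
  rw [hc.card_HFam, Nat.card_Icc]
  congr 1
  omega

lemma exists_card_eq_gSize (hd : 3 ≤ d) (hk : d + 2 ≤ k) (hn : 4 * k ≤ n) :
    ∃ F', IsMaxNontrivial n k d F' ∧ F'.card = gSize n k d :=
  have hc := gConfig_Icc hd hk hn
  ⟨_, hc.isMaxNontrivial, hc.card_GFam⟩

lemma exists_card_eq_sSize (hk : 5 ≤ k) (hn : 4 * k ≤ n) :
    ∃ F', IsMaxNontrivial n k 3 F' ∧ F'.card = sSize n k :=
  have hc := sConfig_Icc hk hn
  ⟨_, hc.isMaxNontrivial, hc.card_SFam rfl⟩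

lemma starSize_le_hSize (l : ℕ) : starSize n k d l ≤ hSize n k d l := Nat.le_add_right _ _

lemma starSize_le_gSize : starSize n k d (k - d) ≤ gSize n k d := by
  rw [gSize]
  omega

/-- Which size is larger depends on whether `l ≤ d + 1`, but counting distinct sizes needs only that
they differ. -/
lemma hSize_ne_hSize_two (hd : 3 ≤ d) (hk : d + 2 ≤ k) (hbig : 1000 * k ^ k ≤ n) {l : ℕ}
    (hl : 3 ≤ l) (hlk : l + d ≤ k + 2) : hSize n k d l ≠ hSize n k d 2 := by
  by_cases h : l ≤ d + 1
  · exact (hSize_lt_hSize_two hd hk (le_of_large hbig (by omega)) hl h hlk).ne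
  · exact ((hSize_two_lt_starSize hd hk hbig (by omega) (by omega)).trans_le
      (starSize_le_hSize l)).ne'

/-- The only maximal families of the size of `𝓖(k,d)` are the isomorphic ones. -/
lemma isMaxNontrivial_and_card_eq_gSize_iff (hd : 3 ≤ d) (hk : d + 2 ≤ k)
    (hbig : 1000 * k ^ k ≤ n)
    (hH : ∀ l, l = 2 ∨ l = k - d ∨ l = k - d + 1 ∨ l = k - d + 2 → hSize n k d l ≠ gSize n k d) :
    IsMaxNontrivial n k d F ∧ F.card = gSize n k d ↔ FamilyIso n F (familyG n k d) := by
  have hn := le_of_large hbig (by omega)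
  have hstar := starSize_le_gSize (n := n) (k := k) (d := d)
  rw [familyG_eq_GFam hd hk (by omega), (gConfig_Icc hd hk (by omega)).familyIso_iff]
  constructor
  · rintro ⟨hF, hc⟩
    rcases hF.size_cases hd hk hbig with ⟨l, hl, h, -⟩ | h | ⟨rfl, h, -⟩ | ⟨rfl, h⟩ | h
    · exact absurd (h.symm.trans hc) (hH l hl)
    · exact h.2
    · have := sSize_lt_gSize (n := n) (k := k) (by omega) hn
      omega
    · have := sSize_lt_gSize (n := n) (k := k) (by omega) hn
      omega
    · omega
  · rintro ⟨D, X, i, a, b, hc, rfl⟩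
    exact ⟨hc.isMaxNontrivial, hc.card_GFam⟩

/-- The only maximal families of the size of `𝓗(k,d,k-d)` are the isomorphic ones. -/
lemma isMaxNontrivial_and_card_eq_hSize_iff (hd : 3 ≤ d) (hk : d + 2 ≤ k)
    (hbig : 1000 * k ^ k ≤ n)
    (hH : ∀ l, l = 2 ∨ l = k - d + 1 ∨ l = k - d + 2 → hSize n k d l ≠ hSize n k d (k - d))
    (hG : gSize n k d ≠ hSize n k d (k - d)) (hS : d = 3 → sSize n k < hSize n k d (k - d)) :
    IsMaxNontrivial n k d F ∧ F.card = hSize n k d (k - d) ↔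
      FamilyIso n F (familyH n k d (k - d)) := by
  have hn := le_of_large hbig (by omega)
  have hstar := starSize_le_hSize (n := n) (k := k) (d := d) (k - d)
  have hconf := config_Icc hd hk (by omega : 4 * k ≤ n) (l := k - d) (by omega) (by omega)
  have hX : (Icc d (d + (k - d) - 1)).card = k - d := by
    rw [Nat.card_Icc]
    omega
  rw [familyH_eq_HFam (by omega), hconf.familyIso_iff, hX]
  constructor
  · rintro ⟨hF, hc⟩
    rcases hF.size_cases hd hk hbig with ⟨l, hl, h, h'⟩ | h | ⟨hd3, h, -⟩ | ⟨hd3, h⟩ | h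
    · by_cases hlk : l = k - d
      · subst hlk
        exact h'
      · exact absurd (h.symm.trans hc) (hH l (by tauto))
    · exact absurd (h.1.symm.trans hc) hG
    · have := hS hd3
      omega
    · have := hS hd3
      omega
    · omega
  · rintro ⟨D, X, hc, hX', rfl⟩
    exact ⟨hc.isMaxNontrivial_HFam, by rw [hc.card_HFam, hX']⟩

/-- The only maximal families of the size of `𝓢₁(k,3)` are the isomorphic ones. -/
lemma isMaxNontrivial_and_card_eq_sSize_iff (hk : 5 ≤ k) (hbig : 1000 * k ^ k ≤ n)
    (hH : ∀ l, l = 2 ∨ l = k - 3 ∨ l = k - 3 + 1 ∨ l = k - 3 + 2 → hSize n k 3 l ≠ sSize n k) :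
    IsMaxNontrivial n k 3 F ∧ F.card = sSize n k ↔ FamilyIso n F (familyS₁ n k) := by
  have hn := le_of_large hbig (by omega)
  have hstar : starSize n k 3 (k - 3) ≤ sSize n k := by
    rw [sSize]
    omega
  have hsg := sSize_lt_gSize hk hn
  rw [familyS₁_eq_SFam hk (by omega), (sConfig_Icc hk (by omega)).familyIso_iff rfl]
  constructor
  · rintro ⟨hF, hc⟩
    rcases hF.size_cases le_rfl hk hbig with ⟨l, hl, h, -⟩ | h | h | h | h
    · exact absurd (h.symm.trans hc) (hH l hl)
    · omega
    · exact h.2.2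
    · omega
    · omega
  · rintro ⟨D, X, i, j, a, b, c, hc, rfl⟩
    exact ⟨hc.isMaxNontrivial, hc.card_SFam rfl⟩

/-- If `k ≤ 2 d + 1` and the three families `𝓗(k,d,l)` with `l ∈ {2, k - d + 1, k - d + 2}` are
larger than all others, then the fourth largest families are those of the next size `t`. -/
lemma isNthLargest_four_iff_of_le (hd : 3 ≤ d) (hk : d + 2 ≤ k)
    (hbig : 1000 * k ^ k ≤ n) {t : ℕ} (ht : ∃ F', IsMaxNontrivial n k d F' ∧ F'.card = t)
    (ht2 : t < hSize n k d 2) (ht1 : t < hSize n k d (k - d + 1)) (hg : gSize n k d ≤ t)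
    (hh : k = d + 2 ∨ hSize n k d (k - d) ≤ t) :
    IsNthLargest 4 n k d F ↔ IsMaxNontrivial n k d F ∧ F.card = t := by
  have hn := le_of_large hbig (by omega)
  have h12 := hSize_lt_hSize_top hd hk hn
  have e1 := hSize_ne_hSize_two hd hk hbig (l := k - d + 1) (by omega) (by omega)
  have e2 := hSize_ne_hSize_two hd hk hbig (l := k - d + 2) (by omega) (by omega)
  have hstar := starSize_le_gSize (n := n) (k := k) (d := d)
  refine isNthLargest_four_iff
    (exists_card_eq_hSize hd hk (by omega) (l := k - d + 2) (by omega) (by omega))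
    (exists_card_eq_hSize hd hk (by omega) (l := k - d + 1) (by omega) (by omega))
    (exists_card_eq_hSize hd hk (by omega) (l := 2) (by omega) (by omega)) ht
    (by omega) e2 e1 (by omega) ht1 ht2 fun F' hF' => ?_
  rcases hF'.size_cases hd hk hbig with ⟨l, hl, h, -⟩ | h | ⟨rfl, h, -⟩ | ⟨rfl, h⟩ | h
  · rcases hl with rfl | rfl | rfl | rfl
    · omega
    -- For `k = d + 2` the index `k - d` is `2`, already one of the three top sizes; otherwise
    -- `hSize n k d (k - d)` is at most `t`.
    · rcases hh with hh | hh
      · rw [show k - d = 2 by omega] at h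
        omega
      · omega
    · omega
    · omega
  · omega
  · have := sSize_lt_gSize (n := n) (k := k) (by omega) hn
    omega
  · have := sSize_lt_gSize (n := n) (k := k) (by omega) hn
    omega
  · omega

/-- If `k > 2 d + 1`, the three largest sizes are those of `𝓗(k,d,k-d+2)`, `𝓗(k,d,k-d+1)` and
`𝓖(k,d)`. -/
lemma isNthLargest_four_iff_of_lt (hd : 3 ≤ d) (hk : 2 * d + 1 < k)
    (hbig : 1000 * k ^ k ≤ n) {t : ℕ} (ht : ∃ F', IsMaxNontrivial n k d F' ∧ F'.card = t)
    (htg : t < gSize n k d) (hh : hSize n k d (k - d) ≤ t) (hs : d = 3 → sSize n k ≤ t) :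
    IsNthLargest 4 n k d F ↔ IsMaxNontrivial n k d F ∧ F.card = t := by
  have hn := le_of_large hbig (by omega)
  have h12 := hSize_lt_hSize_top hd (by omega) hn
  have hg := gSize_lt_hSize_top hd (by omega) hn
  have hstar := starSize_le_hSize (n := n) (k := k) (d := d) (k - d)
  have h2 := hSize_two_lt_starSize hd (by omega) hbig (l := k - d) (by omega) (by omega)
  refine isNthLargest_four_iff
    (exists_card_eq_hSize hd (by omega) (by omega) (l := k - d + 2) (by omega) (by omega))
    (exists_card_eq_hSize hd (by omega) (by omega) (l := k - d + 1) (by omega) (by omega))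
    (exists_card_eq_gSize hd (by omega) (by omega)) ht
    (by omega) (by omega) (by omega) (by omega) (by omega) htg fun F' hF' => ?_
  rcases hF'.size_cases hd (by omega) hbig with ⟨l, hl, h, -⟩ | h | ⟨hd3, h, -⟩ | ⟨hd3, h⟩ | h
  · rcases hl with rfl | rfl | rfl | rfl <;> omega
  · omega
  · have := hs hd3
    omega
  · have := hs hd3
    omega
  · omega

theorem mainTheorem5 (k d n : ℕ) (hd : 4 ≤ d + 1) (hk : d + 1 < k) (hn : nOne k d < n)
    (F : Finset (Finset ℕ)) :
    (k = d + 2 → (IsNthLargest 4 n k d F ↔ FamilyIso n F (familyG n (d + 2) d))) ∧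
    (k = d + 3 → (IsNthLargest 4 n k d F ↔ FamilyIso n F (familyH n (d + 3) d 3))) ∧
    (d + 4 ≤ k ∧ k ≤ 2 * d + 1 → (IsNthLargest 4 n k d F ↔ FamilyIso n F (familyG n k d))) ∧
    (2 * d + 1 < k ∧ d = 3 → (IsNthLargest 4 n k d F ↔ FamilyIso n F (familyS₁ n k))) ∧
    (2 * d + 1 < k ∧ 4 ≤ d →
      (IsNthLargest 4 n k d F ↔ FamilyIso n F (familyH n k d (k - d)))) := by
  have hd3 : 3 ≤ d := by omega
  have hdk : d + 2 ≤ k := by omega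
  have hbig := large_of_nOne_lt hd3 hdk hn
  have hlarge := le_of_large hbig (by omega)
  have h12 := hSize_lt_hSize_top hd3 hdk hlarge
  have hg1 := gSize_lt_hSize_top hd3 hdk hlarge
  have eG := exists_card_eq_gSize (n := n) hd3 hdk (by omega)
  have eH := exists_card_eq_hSize (n := n) hd3 hdk (by omega) (l := k - d) (by omega) (by omega)
  have ne1 := hSize_ne_hSize_two hd3 hdk hbig (l := k - d + 1) (by omega) (by omega)
  have ne2 := hSize_ne_hSize_two hd3 hdk hbig (l := k - d + 2) (by omega) (by omega)
  refine ⟨fun hk2 => ?_, fun hk3 => ?_, fun hk4 => ?_, fun hk5 => ?_, fun hk6 => ?_⟩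
  -- With `k = d + 2` the top sizes are those for `l = 2, 3, 4`, and `gSize` lies below `l = 3`,
  -- which lies below `l = 2`.
  · have hg2 : gSize n k d < hSize n k d 2 :=
      hg1.trans (hSize_lt_hSize_two hd3 hdk hlarge (by omega) (by omega) (by omega))
    rw [isNthLargest_four_iff_of_le hd3 hdk hbig eG hg2 hg1 le_rfl (Or.inl hk2),
      isMaxNontrivial_and_card_eq_gSize_iff hd3 hdk hbig, hk2]
    rintro l (rfl | h | rfl | rfl)
    · exact hg2.ne'
    · rw [show l = 2 by omega]
      exact hg2.ne'
    · exact hg1.ne'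
    · exact (hg1.trans h12).ne'
  · have hb1 := hSize_bot_lt_hSize_top hd3 (by omega) hlarge
    have hb2 := hSize_lt_hSize_two hd3 hdk hlarge (l := k - d) (by omega) (by omega) (by omega)
    have hgb := gSize_lt_hSize_bot hd3 hk3 hlarge
    rw [isNthLargest_four_iff_of_le hd3 hdk hbig eH hb2 hb1 hgb.le (Or.inr le_rfl),
      isMaxNontrivial_and_card_eq_hSize_iff hd3 hdk hbig _ hgb.ne, show k - d = 3 by omega, hk3]
    · rintro rfl
      exact (sSize_lt_gSize (by omega) hlarge).trans hgb
    · rintro l (rfl | rfl | rfl)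
      · exact hb2.ne'
      · exact hb1.ne'
      · exact (hb1.trans h12).ne'
  · have hg2 := gSize_lt_hSize_two hd3 hk4.1 hk4.2 hlarge
    have hbg := hSize_bot_lt_gSize hd3 hk4.1 hlarge
    rw [isNthLargest_four_iff_of_le hd3 hdk hbig eG hg2 hg1 le_rfl (Or.inr hbg.le),
      isMaxNontrivial_and_card_eq_gSize_iff hd3 hdk hbig]
    rintro l (rfl | rfl | rfl | rfl)
    · exact hg2.ne'
    · exact hbg.ne
    · exact hg1.ne'
    · exact (hg1.trans h12).ne'
  · obtain ⟨hk5, rfl⟩ := hk5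
    have hsg := sSize_lt_gSize (n := n) (k := k) (by omega) hlarge
    have hbs := hSize_bot_lt_sSize (n := n) (k := k) (by omega) hlarge
    have hstar := starSize_le_hSize (n := n) (k := k) (d := 3) (k - 3)
    have h2 := hSize_two_lt_starSize hd3 hdk hbig (l := k - 3) (by omega) (by omega)
    rw [isNthLargest_four_iff_of_lt hd3 hk5 hbig (exists_card_eq_sSize (by omega) (by omega)) hsg
      hbs.le (fun _ => le_rfl), isMaxNontrivial_and_card_eq_sSize_iff (by omega) hbig]
    rintro l (rfl | rfl | rfl | rfl) <;> omega
  · obtain ⟨hk6, hd4⟩ := hk6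
    have hbg := hSize_bot_lt_gSize hd3 (by omega) hlarge
    have hstar := starSize_le_hSize (n := n) (k := k) (d := d) (k - d)
    have h2 := hSize_two_lt_starSize hd3 hdk hbig (l := k - d) (by omega) (by omega)
    rw [isNthLargest_four_iff_of_lt hd3 hk6 hbig eH hbg le_rfl (fun h => by omega),
      isMaxNontrivial_and_card_eq_hSize_iff hd3 hdk hbig _ hbg.ne' (fun h => by omega)]
    rintro l (rfl | rfl | rfl) <;> omega
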